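/- **Channel and capacity region.** Consider the two-user complex Gaussian interference channel $Y_1=X_1+h_{12}X_2+Z_1$, $Y_2=h_{21}X_1+X_2+Z_2$ with $h_{12},h_{21}\in\mathbb C$, noise i.i.d. in time with $Z_i\sim\mathcal{CN}(0,1)$ independent of the inputs, and $P_1,P_2\ge 0$. A code of length $n$ for the rate pair $(R_1,R_2)$, $R_i\ge 0$, consists of encoders from $\{1,\dots,\lceil 2^{nR_i}\rceil\}$ to $\mathbb C^n$ whose codewords satisfy $\|x_i^n\|^2\le nP_i$, and measurable decoders. The pair is achievable if some sequence of codes has average error probabilities (independent uniform messages) tending to $0$ at both receivers. The capacity region is the closure of the set of achievable pairs. Assume weak interference: $|h_{12}|\le 1$ and $|h_{21}|\le 1$. **Notation.** All logarithms are to base $2$ and $h(\cdot)$, $h(\cdot\,|\,\cdot)$ denote (conditional) differential entropy in bits. Let $X_{iG}\sim\mathcal{CN}(0,P_i)$, $Z_i\sim\mathcal{CN}(0,1)$, and let $W_i\sim\mathcal{CN}(0,\sigma_{W_i}^2)$ with $0\le \sigma_{W_i}\le 1$ be jointly circularly symmetric Gaussian with $Z_i$, $\mathbb E[Z_iW_i^*]=\rho_{W_i}\sigma_{W_i}$.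 Put $$Y_{1G}=X_{1G}+h_{12}X_{2G}+Z_1,\quad Y_{2G}=h_{21}X_{1G}+X_{2G}+Z_2,\quad U_{1G}=h_{12}X_{2G}+W_1,\quad U_{2G}=h_{21}X_{1G}+W_2 .$$ Let $\sigma^2_{Z_i-W_i}=\mathrm{Var}(Z_i-W_i)$, let $\sigma^2_{V_{W_i}}=\mathrm{Var}(W_i\,|\,Z_i-W_i)$ be the conditional variance, assume both are positive for $i=1,2$, and let $V_{W_i}\sim\mathcal{CN}(0,\sigma^2_{V_{W_i}})$. Assume that $X_{1G},X_{2G},(Z_1,W_1),V_{W_2}$ are mutually independent and that $X_{1G},X_{2G},(Z_2,W_2),V_{W_1}$ are mutually independent. **Theorem.** Suppose that $$\sigma^2_{V_{W_1}}\ge |h_{12}|^2\sigma^2_{Z_2-W_2},\qquad \sigma^2_{V_{W_2}}\ge |h_{21}|^2\sigma^2_{Z_1-W_1},$$ and set $$\tilde V_{W_1}=\sqrt{1-|h_{12}|^2\sigma_{V_{W_1}}^{-2}\sigma^2_{Z_2-W_2}}\;V_{W_1},\qquad \tilde V_{W_2}=\sqrt{1-|h_{21}|^2\sigma_{V_{W_2}}^{-2}\sigma^2_{Z_1-W_1}}\;V_{W_2}.$$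 Then every $(R_1,R_2)$ in the capacity region satisfies $$\begin{aligned}R_1+R_2\le \tfrac12\Big\{&h(Y_{1G})-h(Y_{1G}|X_{1G})+h(U_{1G})-h(W_1-Z_1)+h(Y_{1G}|U_{1G})-h(h_{21}Y_{1G}+\tilde V_{W_2}|U_{1G})\\&+h(Y_{2G})-h(Y_{2G}|X_{2G})+h(U_{2G})-h(W_2-Z_2)+h(Y_{2G}|U_{2G})-h(h_{12}Y_{2G}+\tilde V_{W_1}|U_{2G})\Big\},\end{aligned}$$ and the right-hand side equals $$\begin{aligned}\tfrac12\Bigg\{&\log\Big(1+\tfrac{P_1}{|h_{12}|^2P_2+1}\Big)+\log\Big(\tfrac{|h_{12}|^2P_2+\sigma_{W_1}^2}{\sigma_{W_1}^2+1-2\mathrm{Re}\{\rho_{W_1}\sigma_{W_1}\}}\Big) +\log\left(\frac{P_1+|h_{12}|^2P_2+1-\frac{\left||h_{12}|^2P_2+\rho_{W_1}\sigma_{W_1}\right|^2}{|h_{12}|^2P_2+\sigma_{W_1}^2}}{|h_{21}|^2P_1+\sigma_{V_{W_2}}^2-\frac{|h_{21}\rho_{W_1}\sigma_{W_1}-h_{21}\sigma_{W_1}^2|^2}{|h_{12}|^2P_2+\sigma_{W_1}^2}}\right)\\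 &+\log\Big(1+\tfrac{P_2}{|h_{21}|^2P_1+1}\Big)+\log\Big(\tfrac{|h_{21}|^2P_1+\sigma_{W_2}^2}{\sigma_{W_2}^2+1-2\mathrm{Re}\{\rho_{W_2}\sigma_{W_2}\}}\Big) +\log\left(\frac{P_2+|h_{21}|^2P_1+1-\frac{\left||h_{21}|^2P_1+\rho_{W_2}\sigma_{W_2}\right|^2}{|h_{21}|^2P_1+\sigma_{W_2}^2}}{|h_{12}|^2P_2+\sigma_{V_{W_1}}^2-\frac{|h_{12}\rho_{W_2}\sigma_{W_2}-h_{12}\sigma_{W_2}^2|^2}{|h_{21}|^2P_1+\sigma_{W_2}^2}}\right)\Bigg\}.\end{aligned}$$ -/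

import Mathlib

open MeasureTheory ProbabilityTheory Filter Topology

namespace GIC

noncomputable section

/-- The circularly symmetric complex Gaussian law `CN(0, v)` of total variance `v`:
independent real and imaginary parts, each distributed as `N(0, v / 2)`. -/
def complexGaussian (v : ℝ) : Measure ℂ :=
  ((gaussianReal 0 (v / 2).toNNReal).prod (gaussianReal 0 (v / 2).toNNReal)).map
    (fun p : ℝ × ℝ => (⟨p.1, p.2⟩ : ℂ))

/-- The law of a jointly Gaussian, jointly circularly symmetric pair of complex random variables. -/
def IsCircularGaussianPair (ν : Measure (ℂ × ℂ)) : Prop :=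
  IsGaussian ν ∧ ∀ c : ℂ, ‖c‖ = 1 → ν.map (fun p => (c * p.1, c * p.2)) = ν

/-- Differential entropy, in bits, of a law on `ℂ` that has a density with respect to
Lebesgue measure. -/
def entropyOfLaw (ν : Measure ℂ) : ℝ :=
  -∫ z, (ν.rnDeriv volume z).toReal * Real.logb 2 (ν.rnDeriv volume z).toReal

/-- Variance of a law on `ℂ`. -/
def varianceOfLaw (ν : Measure ℂ) : ℝ :=
  ∫ z, ‖z - ∫ w, w ∂ν‖ ^ 2 ∂ν

section RandomVariables

variable {Ω : Type*} [MeasurableSpace Ω]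

/-- Differential entropy `h(X)` in bits. -/
def entropy (μ : Measure Ω) (X : Ω → ℂ) : ℝ :=
  entropyOfLaw (μ.map X)

/-- Conditional differential entropy `h(X | T)` in bits: the average over `T` of the
differential entropy of the conditional law of `X` given `T`. -/
def condEntropy (μ : Measure Ω) [IsFiniteMeasure μ] (X T : Ω → ℂ) : ℝ :=
  ∫ t, entropyOfLaw (condDistrib X T μ t) ∂(μ.map T)

/-- Variance of a complex random variable. -/
def variance (μ : Measure Ω) (X : Ω → ℂ) : ℝ :=
  varianceOfLaw (μ.map X)

/-- Conditional variance of `X` given `T`, averaged over `T` (for jointly Gaussian variables the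
variance of the conditional law does not depend on the value of `T`). -/
def condVariance (μ : Measure Ω) [IsFiniteMeasure μ] (X T : Ω → ℂ) : ℝ :=
  ∫ t, varianceOfLaw (condDistrib X T μ t) ∂(μ.map T)

end RandomVariables

/-- A block code of length `n` for two users with `M₁` and `M₂` messages and
average power constraints `P₁` and `P₂` on every codeword. -/
structure Code (P₁ P₂ : ℝ) (n M₁ M₂ : ℕ) where
  enc₁ : Fin M₁ → Fin n → ℂ
  enc₂ : Fin M₂ → Fin n → ℂ
  dec₁ : (Fin n → ℂ) → Fin M₁
  dec₂ : (Fin n → ℂ) → Fin M₂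
  measurable_dec₁ : Measurable dec₁
  measurable_dec₂ : Measurable dec₂
  power₁ : ∀ m, ∑ k, ‖enc₁ m k‖ ^ 2 ≤ n * P₁
  power₂ : ∀ m, ∑ k, ‖enc₂ m k‖ ^ 2 ≤ n * P₂

/-- The law of `n` independent `CN(0, 1)` noise samples. -/
def noiseLaw (n : ℕ) : Measure (Fin n → ℂ) :=
  Measure.pi fun _ => complexGaussian 1

/-- Average error probability at receiver 1, `Y₁ = X₁ + h₁₂ X₂ + Z₁`, for independent uniformly
distributed messages. -/
def Code.error₁ {P₁ P₂ : ℝ} {n M₁ M₂ : ℕ} (c : Code P₁ P₂ n M₁ M₂) (h₁₂ : ℂ) : ℝ :=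
  (∑ m₁, ∑ m₂, (noiseLaw n).real
    {z | c.dec₁ (fun k => c.enc₁ m₁ k + h₁₂ * c.enc₂ m₂ k + z k) ≠ m₁}) / (M₁ * M₂)

/-- Average error probability at receiver 2, `Y₂ = h₂₁ X₁ + X₂ + Z₂`, for independent uniformly
distributed messages. -/
def Code.error₂ {P₁ P₂ : ℝ} {n M₁ M₂ : ℕ} (c : Code P₁ P₂ n M₁ M₂) (h₂₁ : ℂ) : ℝ :=
  (∑ m₁, ∑ m₂, (noiseLaw n).real
    {z | c.dec₂ (fun k => h₂₁ * c.enc₁ m₁ k + c.enc₂ m₂ k + z k) ≠ m₂}) / (M₁ * M₂)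

/-- Achievability of a rate pair (in bits per channel use): there is a sequence of codes with
`⌈2 ^ (n R₁)⌉` and `⌈2 ^ (n R₂)⌉` messages whose error probabilities tend to zero. -/
def Achievable (h₁₂ h₂₁ : ℂ) (P₁ P₂ : ℝ) (R : ℝ × ℝ) : Prop :=
  0 ≤ R.1 ∧ 0 ≤ R.2 ∧
  ∃ c : (n : ℕ) →
      Code P₁ P₂ n ⌈(2 : ℝ) ^ ((n : ℝ) * R.1)⌉₊ ⌈(2 : ℝ) ^ ((n : ℝ) * R.2)⌉₊,
    Tendsto (fun n => (c n).error₁ h₁₂) atTop (𝓝 0) ∧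
    Tendsto (fun n => (c n).error₂ h₂₁) atTop (𝓝 0)

/-- The capacity region of the two-user complex Gaussian interference channel. -/
def capacityRegion (h₁₂ h₂₁ : ℂ) (P₁ P₂ : ℝ) : Set (ℝ × ℝ) :=
  closure {R | Achievable h₁₂ h₂₁ P₁ P₂ R}

end

end GIC

/-! Each receiver is helped by a genie. At receiver 1 put N = Z₁ - W₁, A = X₁ + N, U = h₁₂X₂ + W₁,
so that the output is Y = A + U. Regression of W₁ on N gives W₁ = βN + V with V independent of N and
of variance v₁ = Var(W₁ | Z₁ - W₁). Fano's inequality is applied twice per user: to Y alone, which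
costs h(Y) - h(h₁₂X₂ + Z₁), and to (A, U), which costs h(A, U) - h(N) - h(h₁₂X₂ + V). The sum of the
two bounds twice the rate by h(Y) + [h(U) - h(h₁₂X₂ + Z₁)] + h(A | U) - h(N) - h(h₁₂X₂ + V).

Here h(Y) is largest for Gaussian inputs (`ent_mix_le`), and the bracket is bounded by the worst
additive noise inequality (`ent_mix_sub_le`), since Var W₁ ≤ Var Z₁. The negative entropy of a coded
signal, -h(h₁₂X₂ + V), cannot be bounded alone; it is paired with the term h(A₂ | U₂) of the other
user. The condition |h₁₂|²s₂ ≤ v₁ says that h₁₂X₂ + V has the law of h₁₂A₂ + T, with T an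
independent Gaussian noise of variance v₁ - |h₁₂|²s₂. The difference h(A₂ | U₂) - h(h₁₂A₂ + T) is at
most its value for Gaussian inputs (`ent_jointDensity_sub_le`). Adding both users, dividing by n and
passing to the limit and the closure gives the bound (`two_mul_rate_le`, `Code.rate_le`,
`sum_rate_le_of_forall_code`).

Every information inequality is the nonnegativity of some relative entropy, in the form E[F] ≤ 0
whenever E[exp F] ≤ 1 (`integral_le_of_lintegral_exp_le`).

On the Gaussian side, entropies are log(πe · variance) and a conditional variance is the second
moment of a regression residual. `IsGaussianModel.entropy_sum` evaluates the six entropies of one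
receiver in this way and finds the same logarithms as the converse, now in base 2. -/

namespace GIC

/-! ### Circular Gaussian laws and their densities on ℂⁿ. -/

lemma complexGaussian_eq_withDensity {v : ℝ} (hv : 0 < v) :
    complexGaussian v = volume.withDensity
      (fun z : ℂ => ENNReal.ofReal ((Real.pi * v)⁻¹ * Real.exp (-(‖z‖ ^ 2) / v))) := by
  have hv2 : (v / 2).toNNReal ≠ 0 := by
    simp only [ne_eq, Real.toNNReal_eq_zero, not_le]; positivity
  have hmp := Complex.volume_preserving_equiv_real_prod.symm
  have hfun : (fun p : ℝ × ℝ => (⟨p.1, p.2⟩ : ℂ)) = Complex.measurableEquivRealProd.symm := by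
    funext p; exact (Complex.measurableEquivRealProd_symm_apply p).symm
  unfold complexGaussian
  rw [gaussianReal_of_var_ne_zero _ hv2, prod_withDensity (measurable_gaussianPDF _ _)
    (measurable_gaussianPDF _ _), hfun]
  ext s hs
  rw [Measure.map_apply (MeasurableEquiv.measurable _) hs,
    withDensity_apply _ (MeasurableEquiv.measurable _ hs), withDensity_apply _ hs,
    ← hmp.setLIntegral_comp_preimage_emb (MeasurableEquiv.measurableEmbedding _)]
  refine lintegral_congr fun p => ?_
  have h2 : ((v / 2).toNNReal : ℝ) = v / 2 := Real.coe_toNNReal _ (by positivity)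
  simp only [gaussianPDF]
  rw [← ENNReal.ofReal_mul (gaussianPDFReal_nonneg _ _ _)]
  congr 1
  simp only [gaussianPDFReal, h2, sub_zero]
  have h3 : 2 * Real.pi * (v / 2) = Real.pi * v := by ring
  rw [h3, mul_mul_mul_comm, ← Real.exp_add, ← mul_inv, Real.mul_self_sqrt (by positivity),
    Complex.measurableEquivRealProd_symm_apply, ← Complex.normSq_eq_norm_sq, Complex.normSq_mk]
  congr 2
  field_simp
  ring

lemma measurable_complex_mk : Measurable (fun p : ℝ × ℝ => (⟨p.1, p.2⟩ : ℂ)) :=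
  Complex.measurableEquivRealProd.symm.measurable

instance (v : ℝ) : IsProbabilityMeasure (complexGaussian v) := by
  unfold complexGaussian
  exact Measure.isProbabilityMeasure_map measurable_complex_mk.aemeasurable

lemma integral_complexGaussian {F : Type*} [NormedAddCommGroup F] [NormedSpace ℝ F]
    (v : ℝ) (f : ℂ → F) :
    ∫ z, f z ∂complexGaussian v =
      ∫ p : ℝ × ℝ, f ⟨p.1, p.2⟩ ∂((gaussianReal 0 (v / 2).toNNReal).prod
        (gaussianReal 0 (v / 2).toNNReal)) := by
  unfold complexGaussian
  exact (Complex.measurableEquivRealProd.symm).measurableEmbedding.integral_map f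

lemma integrable_sq_gaussianReal (v : NNReal) :
    Integrable (fun x : ℝ => x ^ 2) (gaussianReal 0 v) :=
  (memLp_id_gaussianReal' (μ := 0) (v := v) 2 (by simp)).integrable_sq

lemma integral_sq_gaussianReal (v : NNReal) : ∫ x, x ^ 2 ∂gaussianReal 0 v = v := by
  have h := variance_fun_id_gaussianReal (μ := 0) (v := v)
  rwa [variance_of_integral_eq_zero (X := fun x : ℝ => x) measurable_id.aemeasurable (by simp)] at h

lemma memLp_complexGaussian (v : ℝ) : MemLp (fun z : ℂ => z) 2 (complexGaussian v) := by
  unfold complexGaussian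
  refine (memLp_map_measure_iff (g := fun z : ℂ => z) aestronglyMeasurable_id
    measurable_complex_mk.aemeasurable).2 ?_
  have h : MemLp (fun x : ℝ => x) 2 (gaussianReal 0 (v / 2).toNNReal) :=
    memLp_id_gaussianReal' 2 (by simp)
  have h1 := (h.comp_fst (gaussianReal 0 (v / 2).toNNReal)).ofReal (K := ℂ)
  have h2 := ((h.comp_snd (gaussianReal 0 (v / 2).toNNReal)).ofReal (K := ℂ)).mul_const Complex.I
  refine (h1.add h2).congr_norm ?_ ?_
  · exact measurable_complex_mk.aestronglyMeasurable
  · refine ae_of_all _ fun p => ?_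
    simp [Complex.mk_eq_add_mul_I]

lemma integral_id_complexGaussian (v : ℝ) : ∫ z, z ∂complexGaussian v = 0 := by
  have hint : Integrable (fun z : ℂ => z) (complexGaussian v) :=
    (memLp_complexGaussian v).integrable (by norm_num)
  have hre : ∫ z : ℂ, z.re ∂complexGaussian v = 0 := by
    rw [integral_complexGaussian, integral_fun_fst (fun x : ℝ => x)]; simp
  have him : ∫ z : ℂ, z.im ∂complexGaussian v = 0 := by
    rw [integral_complexGaussian, integral_fun_snd (fun x : ℝ => x)]; simp
  apply Complex.ext
  · rw [Complex.zero_re, ← hre]; exact (integral_re hint).symm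
  · rw [Complex.zero_im, ← him]; exact (integral_im hint).symm

lemma integral_norm_sq_complexGaussian {v : ℝ} (hv : 0 ≤ v) :
    ∫ z, ‖z‖ ^ 2 ∂complexGaussian v = v := by
  rw [integral_complexGaussian]
  have : ∀ p : ℝ × ℝ, ‖(⟨p.1, p.2⟩ : ℂ)‖ ^ 2 = p.1 ^ 2 + p.2 ^ 2 := fun p => by
    rw [← Complex.normSq_eq_norm_sq, Complex.normSq_mk]; ring
  simp_rw [this]
  have h := integrable_sq_gaussianReal (v / 2).toNNReal
  rw [integral_add (h.comp_fst _) (h.comp_snd _), integral_fun_fst (fun x : ℝ => x ^ 2),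
    integral_fun_snd (fun x : ℝ => x ^ 2), integral_sq_gaussianReal]
  simp [Real.coe_toNNReal _ (show 0 ≤ v / 2 by positivity)]

variable {n : ℕ}

/-- Squared Euclidean norm of a complex vector. -/
noncomputable def normSq (z : Fin n → ℂ) : ℝ := ∑ k, ‖z k‖ ^ 2

/-- Density of `n` independent `CN(0, v)` variables. -/
noncomputable def gaussDensity (v : ℝ) (z : Fin n → ℂ) : ℝ :=
  (Real.pi * v)⁻¹ ^ n * Real.exp (-(normSq z) / v)

lemma gaussDensity_eq_prod (v : ℝ) (z : Fin n → ℂ) :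
    gaussDensity v z = ∏ k, ((Real.pi * v)⁻¹ * Real.exp (-(‖z k‖ ^ 2) / v)) := by
  rw [Finset.prod_mul_distrib, ← Real.exp_sum]
  simp [gaussDensity, normSq, Finset.sum_div, Finset.sum_neg_distrib, neg_div]

lemma gaussDensity_pos {v : ℝ} (hv : 0 < v) (z : Fin n → ℂ) : 0 < gaussDensity v z := by
  unfold gaussDensity; positivity

lemma continuous_normSq : Continuous (normSq : (Fin n → ℂ) → ℝ) := by
  unfold normSq; fun_prop

lemma measurable_gaussDensity (v : ℝ) : Measurable (gaussDensity v : (Fin n → ℂ) → ℝ) := by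
  have := (continuous_normSq (n := n)).measurable
  unfold gaussDensity; fun_prop

/-- Law of `n` independent `CN(0, v)` variables. -/
noncomputable def gaussLaw (n : ℕ) (v : ℝ) : Measure (Fin n → ℂ) :=
  Measure.pi fun _ => complexGaussian v

instance (v : ℝ) : IsProbabilityMeasure (gaussLaw n v) := by unfold gaussLaw; infer_instance

lemma gaussLaw_eq_withDensity {v : ℝ} (hv : 0 < v) :
    gaussLaw n v = volume.withDensity (fun z => ENNReal.ofReal (gaussDensity v z)) := by
  unfold gaussLaw
  set ψ : ℂ → ℝ := fun z => (Real.pi * v)⁻¹ * Real.exp (-(‖z‖ ^ 2) / v) with hψ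
  have hψ0 : ∀ z, 0 ≤ ψ z := fun z => by simp only [hψ]; positivity
  have hψm : Measurable ψ := by simp only [hψ]; fun_prop
  have hψi : Integrable ψ := by
    refine ⟨hψm.aestronglyMeasurable, ?_⟩
    rw [hasFiniteIntegral_iff_ofReal (ae_of_all _ hψ0), ← setLIntegral_univ,
      ← withDensity_apply _ MeasurableSet.univ, ← complexGaussian_eq_withDensity hv]
    simp
  refine (Measure.pi_eq fun s hs => ?_)
  rw [withDensity_apply _ (MeasurableSet.univ_pi hs), volume_pi, Measure.restrict_pi_pi]
  have h1 : ∀ i, complexGaussian v (s i) = ENNReal.ofReal (∫ z in s i, ψ z) := fun i => by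
    rw [complexGaussian_eq_withDensity hv, withDensity_apply _ (hs i),
      ofReal_integral_eq_lintegral_ofReal hψi.integrableOn (ae_of_all _ hψ0)]
  simp_rw [h1]
  rw [← ENNReal.ofReal_prod_of_nonneg (fun i _ => integral_nonneg hψ0),
    ← integral_fintype_prod_eq_prod,
    ofReal_integral_eq_lintegral_ofReal]
  · exact lintegral_congr fun z => by rw [gaussDensity_eq_prod]
  · exact Integrable.fintype_prod fun i => hψi.integrableOn
  · exact ae_of_all _ fun z => Finset.prod_nonneg fun i _ => hψ0 _

lemma lintegral_gaussDensity {v : ℝ} (hv : 0 < v) :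
    ∫⁻ z : Fin n → ℂ, ENNReal.ofReal (gaussDensity v z) = 1 := by
  rw [← setLIntegral_univ, ← withDensity_apply _ MeasurableSet.univ,
    ← gaussLaw_eq_withDensity hv]
  simp

/-- The norm of `Fin n → ℂ` is the sup norm, while power is Euclidean; this bound and the next
transfer integrability and growth estimates between the two. -/
lemma norm_sq_le_normSq (z : Fin n → ℂ) : ‖z‖ ^ 2 ≤ normSq z := by
  have h0 : 0 ≤ normSq z := by unfold normSq; positivity
  rw [← Real.sqrt_le_sqrt_iff h0, Real.sqrt_sq (norm_nonneg _)]
  rw [pi_norm_le_iff_of_nonneg (Real.sqrt_nonneg _)]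
  intro k
  apply Real.le_sqrt_of_sq_le
  exact Finset.single_le_sum (f := fun k => ‖z k‖ ^ 2) (fun i _ => by positivity) (Finset.mem_univ k)

lemma normSq_le (z : Fin n → ℂ) : normSq z ≤ n * ‖z‖ ^ 2 := by
  unfold normSq
  calc ∑ k, ‖z k‖ ^ 2 ≤ ∑ _k : Fin n, ‖z‖ ^ 2 := by gcongr; exact norm_le_pi_norm _ _
    _ = _ := by simp

lemma integrable_norm_sq_add_complexGaussian (v : ℝ) (b : ℂ) :
    Integrable (fun z => ‖b + z‖ ^ 2) (complexGaussian v) :=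
  ((memLp_const b).add (memLp_complexGaussian v)).norm.integrable_sq

lemma integral_norm_sq_add_complexGaussian {v : ℝ} (hv : 0 ≤ v) (b : ℂ) :
    ∫ z, ‖b + z‖ ^ 2 ∂complexGaussian v = ‖b‖ ^ 2 + v := by
  have hint : Integrable (fun z : ℂ => z) (complexGaussian v) :=
    (memLp_complexGaussian v).integrable (by norm_num)
  have h : ∀ z : ℂ, ‖b + z‖ ^ 2 = ‖b‖ ^ 2 + 2 * inner ℝ b z + ‖z‖ ^ 2 := fun z => by
    rw [norm_add_sq_real]
  simp_rw [h]
  have hi : Integrable (fun z : ℂ => inner ℝ b z) (complexGaussian v) := hint.const_inner b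
  rw [integral_add (f := fun z => ‖b‖ ^ 2 + 2 * inner ℝ b z)
    ((integrable_const _).add (hi.const_mul 2)) (memLp_complexGaussian v).norm.integrable_sq,
    integral_add (integrable_const _) (hi.const_mul 2), integral_const_mul,
    integral_inner hint, integral_id_complexGaussian, integral_norm_sq_complexGaussian hv]
  simp

lemma integrable_normSq_add (v : ℝ) (b : Fin n → ℂ) :
    Integrable (fun z => normSq (b + z)) (gaussLaw n v) := by
  unfold normSq
  refine integrable_finsetSum _ fun k _ => ?_
  exact (measurePreserving_eval (fun _ : Fin n => complexGaussian v) k).integrable_comp_of_integrable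
    (integrable_norm_sq_add_complexGaussian v (b k))

lemma integral_normSq_add {v : ℝ} (hv : 0 ≤ v) (b : Fin n → ℂ) :
    ∫ z, normSq (b + z) ∂gaussLaw n v = normSq b + n * v := by
  have hk : ∀ k : Fin n, ∫ z, ‖b k + z k‖ ^ 2 ∂gaussLaw n v = ‖b k‖ ^ 2 + v := fun k => by
    have h := measurePreserving_eval (fun _ : Fin n => complexGaussian v) k
    have := h.map_eq
    rw [← integral_norm_sq_add_complexGaussian hv, ← this,
      integral_map h.measurable.aemeasurable (by fun_prop)]
    rfl
  unfold normSq
  rw [integral_finsetSum]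
  · simp only [Pi.add_apply, hk, Finset.sum_add_distrib]; simp
  · intro k _
    exact (measurePreserving_eval (fun _ : Fin n => complexGaussian v) k).integrable_comp_of_integrable
      (integrable_norm_sq_add_complexGaussian v (b k))

/-- Completing the square for a Gaussian channel `y = h x + noise`. -/
lemma gaussDensity_mul {a c : ℝ} (ha : 0 < a) (hc : 0 < c) (h : ℂ) (x y : Fin n → ℂ) :
    gaussDensity a x * gaussDensity c (y - h • x) =
      gaussDensity (‖h‖ ^ 2 * a + c) y *
        gaussDensity (a * c / (‖h‖ ^ 2 * a + c))
          (x - (a * (starRingEnd ℂ) h / (‖h‖ ^ 2 * a + c)) • y) := by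
  have hd : 0 < ‖h‖ ^ 2 * a + c := by positivity
  simp only [gaussDensity_eq_prod, ← Finset.prod_mul_distrib]
  refine Finset.prod_congr rfl fun k _ => ?_
  simp only [Pi.sub_apply, Pi.smul_apply, smul_eq_mul]
  generalize x k = p
  generalize y k = q
  rw [mul_mul_mul_comm, ← Real.exp_add, mul_mul_mul_comm, ← Real.exp_add]
  congr 1
  · field_simp
  · congr 1
    have e : (a * (starRingEnd ℂ) h / (‖h‖ ^ 2 * a + c) : ℂ)
      = ((a / (‖h‖ ^ 2 * a + c) : ℝ) : ℂ) * (starRingEnd ℂ) h := by push_cast; ring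
    rw [e]
    have hns : ‖h‖ ^ 2 = h.re ^ 2 + h.im ^ 2 := by
      rw [← Complex.normSq_eq_norm_sq, Complex.normSq_apply]; ring
    rw [hns] at hd ⊢
    set r : ℝ := a / ((h.re ^ 2 + h.im ^ 2) * a + c) with hr
    have hr' : r * ((h.re ^ 2 + h.im ^ 2) * a + c) = a := by rw [hr]; field_simp
    simp only [← Complex.normSq_eq_norm_sq, Complex.normSq_apply, Complex.sub_re, Complex.sub_im,
      Complex.mul_re, Complex.mul_im, Complex.conj_re, Complex.conj_im, Complex.ofReal_re,
      Complex.ofReal_im]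
    rw [hr]
    field_simp
    ring

lemma lintegral_gaussDensity_sub {v : ℝ} (hv : 0 < v) (b : Fin n → ℂ) :
    ∫⁻ z : Fin n → ℂ, ENNReal.ofReal (gaussDensity v (z - b)) = 1 := by
  rw [lintegral_sub_right_eq_self (fun z : Fin n → ℂ => ENNReal.ofReal (gaussDensity v z)) b]
  exact lintegral_gaussDensity hv

/-- After completing the square, the factor depending on x is a translated Gaussian posterior of
mass one, and the marginal of y remains. -/
lemma lintegral_gaussDensity_mul {a c : ℝ} (ha : 0 < a) (hc : 0 < c) (h : ℂ) (y : Fin n → ℂ) :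
    ∫⁻ x, ENNReal.ofReal (gaussDensity a x * gaussDensity c (y - h • x)) =
      ENNReal.ofReal (gaussDensity (‖h‖ ^ 2 * a + c) y) := by
  have hd : 0 < ‖h‖ ^ 2 * a + c := by positivity
  simp_rw [gaussDensity_mul ha hc, ENNReal.ofReal_mul (gaussDensity_pos hd y).le]
  rw [lintegral_const_mul _ (by have := measurable_gaussDensity (n := n); fun_prop),
    lintegral_gaussDensity_sub (by positivity), mul_one]

end GIC

/-! ### Relative entropy, tame densities and Fano's inequality. -/

namespace GIC

/-- Jensen's inequality for the exponential, in the form used for relative entropies. -/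
lemma integral_le_of_lintegral_exp_le {X : Type*} [MeasurableSpace X] {Q : Measure X}
    [IsProbabilityMeasure Q] {F : X → ℝ} (hF : Integrable F Q) {c : ℝ} (hc : 0 ≤ c)
    (h : ∫⁻ x, ENNReal.ofReal (Real.exp (F x)) ∂Q ≤ ENNReal.ofReal c) :
    ∫ x, F x ∂Q ≤ c - 1 := by
  have hexp0 : 0 ≤ᵐ[Q] fun x => Real.exp (F x) := ae_of_all _ fun x => (Real.exp_pos _).le
  have hm : AEStronglyMeasurable (fun x => Real.exp (F x)) Q :=
    Real.continuous_exp.comp_aestronglyMeasurable hF.1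
  have hi : Integrable (fun x => Real.exp (F x)) Q :=
    ⟨hm, by rw [hasFiniteIntegral_iff_ofReal hexp0]; exact h.trans_lt ENNReal.ofReal_lt_top⟩
  -- Only the tangent bound exp t ≥ t + 1 is needed; with c = 1 it says that a relative entropy is
  -- nonnegative.
  have h1 : ∫ x, F x ∂Q ≤ ∫ x, (Real.exp (F x) - 1) ∂Q :=
    integral_mono hF (hi.sub (integrable_const _)) fun x => by
      have := Real.add_one_le_exp (F x); simp only; linarith
  have h2 : ∫ x, Real.exp (F x) ∂Q ≤ c := by
    rw [integral_eq_lintegral_of_nonneg_ae hexp0 hm]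
    exact ENNReal.toReal_le_of_le_ofReal hc h
  rw [integral_sub hi (integrable_const _)] at h1
  simp at h1
  linarith

section Densities

set_option linter.unusedSectionVars false

variable {α : Type*} [NormedAddCommGroup α] [MeasureSpace α]

/-- The measure with Lebesgue density `ψ`. -/
noncomputable def law (ψ : α → ℝ) : Measure α :=
  volume.withDensity fun z => ENNReal.ofReal (ψ z)

/-- Differential entropy, in nats, of a density. -/
noncomputable def ent (ψ : α → ℝ) : ℝ := -∫ z, Real.log (ψ z) ∂law ψ

/-- A positive probability density with finite second moment whose logarithm grows at most
quadratically. -/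
structure IsTame (ψ : α → ℝ) : Prop where
  meas : Measurable ψ
  pos : ∀ z, 0 < ψ z
  lint : ∫⁻ z, ENNReal.ofReal (ψ z) = 1
  log_bound : ∃ C, ∀ z, |Real.log (ψ z)| ≤ C * (1 + ‖z‖ ^ 2)
  moment : Integrable (fun z => ‖z‖ ^ 2) (law ψ)

lemma lintegral_law {ψ : α → ℝ} (hψ : Measurable ψ) (G : α → ENNReal)
    (hG : Measurable G) :
    ∫⁻ z, G z ∂law ψ = ∫⁻ z, ENNReal.ofReal (ψ z) * G z := by
  unfold law
  rw [lintegral_withDensity_eq_lintegral_mul _ (by fun_prop) hG]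
  rfl

lemma IsTame.isProbabilityMeasure {ψ : α → ℝ} (hψ : IsTame ψ) : IsProbabilityMeasure (law ψ) :=
  ⟨by unfold law; rw [withDensity_apply _ MeasurableSet.univ, setLIntegral_univ, hψ.lint]⟩

lemma integrable_of_quadratic_bound {X : Type*} [MeasurableSpace X] {Q : Measure X}
    [IsFiniteMeasure Q] {F G : X → ℝ} (hF : AEStronglyMeasurable F Q) (hG : Integrable G Q)
    {C : ℝ} (h : ∀ x, |F x| ≤ C * (1 + G x)) : Integrable F Q :=
  (((integrable_const 1).add hG).const_mul C).mono' hF (ae_of_all _ fun x => h x)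

lemma IsTame.integrable_log {ψ : α → ℝ} (hψ : IsTame ψ) :
    Integrable (fun z => Real.log (ψ z)) (law ψ) := by
  have := hψ.isProbabilityMeasure
  obtain ⟨C, hC⟩ := hψ.log_bound
  exact integrable_of_quadratic_bound hψ.meas.log.aestronglyMeasurable hψ.moment hC

lemma IsTame.memLp [BorelSpace α] [SecondCountableTopology α] {ψ : α → ℝ} (hψ : IsTame ψ) :
    MemLp (fun z : α => z) 2 (law ψ) :=
  (memLp_two_iff_integrable_sq_norm aestronglyMeasurable_id).2 hψ.moment

/-- The logarithm of a tame density is integrable along any square integrable variable. -/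
lemma IsTame.integrable_log_comp {ψ : α → ℝ} (hψ : IsTame ψ) {X : Type*} [MeasurableSpace X]
    {Q : Measure X} [IsFiniteMeasure Q] {Y : X → α} (hYm : AEMeasurable Y Q) (hY : MemLp Y 2 Q) :
    Integrable (fun x => Real.log (ψ (Y x))) Q := by
  obtain ⟨C, hC⟩ := hψ.log_bound
  refine integrable_of_quadratic_bound ?_ hY.norm.integrable_sq fun x => hC (Y x)
  exact (hψ.meas.comp_aemeasurable hYm).log.aestronglyMeasurable

variable {ι : Type*} [Fintype ι]

/-- Density of a uniformly chosen shift `x i` plus noise with density `ψ`. -/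
noncomputable def mix (x : ι → α) (ψ : α → ℝ) (z : α) : ℝ :=
  (∑ i, ψ (z - x i)) / Fintype.card ι

variable [BorelSpace α] [SecondCountableTopology α] [(volume : Measure α).IsAddRightInvariant]
  [Nonempty ι]

lemma mix_def (x : ι → α) (ψ : α → ℝ) (z : α) :
    mix x ψ z = (∑ i, ψ (z - x i)) / Fintype.card ι := rfl

lemma measurable_mix {ψ : α → ℝ} (hψ : Measurable ψ) (x : ι → α) : Measurable (mix x ψ) := by
  unfold mix; fun_prop

lemma law_mix {ψ : α → ℝ} (hψ : Measurable ψ) (h0 : ∀ z, 0 ≤ ψ z) (x : ι → α) :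
    law (mix x ψ) = (Fintype.card ι : ENNReal)⁻¹ • ∑ i, (law ψ).map (fun z => x i + z) := by
  have hM : (0 : ℝ) < Fintype.card ι := by exact_mod_cast Fintype.card_pos
  refine Measure.ext_of_lintegral _ fun G hG => ?_
  rw [lintegral_law (measurable_mix hψ x) G hG, lintegral_smul_measure,
    lintegral_finsetSum_measure]
  have h1 : ∀ i, ∫⁻ z, G z ∂(law ψ).map (fun z => x i + z) =
      ∫⁻ z, ENNReal.ofReal (ψ (z - x i)) * G z := fun i => by
    rw [lintegral_map hG (by fun_prop), lintegral_law hψ _ (by fun_prop),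
      ← lintegral_sub_right_eq_self (fun z => ENNReal.ofReal (ψ z) * G (x i + z)) (x i)]
    simp
  simp_rw [h1]
  rw [← lintegral_finsetSum _ (by fun_prop), smul_eq_mul, ← lintegral_const_mul _ (by fun_prop)]
  refine lintegral_congr fun z => ?_
  rw [mix_def, ENNReal.ofReal_div_of_pos hM, ENNReal.ofReal_sum_of_nonneg fun i _ => h0 _,
    ENNReal.ofReal_natCast, div_eq_mul_inv, ← Finset.sum_mul, mul_comm _ (_ : ENNReal)⁻¹, mul_assoc]

lemma integral_law_mix {ψ : α → ℝ} (hψ : Measurable ψ) (h0 : ∀ z, 0 ≤ ψ z) (x : ι → α)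
    {F : α → ℝ} (hFm : Measurable F) (hF : ∀ i, Integrable (fun z => F (x i + z)) (law ψ)) :
    ∫ z, F z ∂law (mix x ψ) = (∑ i, ∫ z, F (x i + z) ∂law ψ) / Fintype.card ι := by
  rw [law_mix hψ h0, integral_smul_measure, integral_finsetSum_measure]
  · simp_rw [integral_map (measurable_const_add _).aemeasurable hFm.aestronglyMeasurable]
    simp [div_eq_inv_mul]
  · intro i _
    rw [integrable_map_measure hFm.aestronglyMeasurable (by fun_prop)]
    exact hF i

lemma integrable_law_mix {ψ : α → ℝ} (hψ : Measurable ψ) (h0 : ∀ z, 0 ≤ ψ z) (x : ι → α)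
    {F : α → ℝ} (hFm : Measurable F) (hF : ∀ i, Integrable (fun z => F (x i + z)) (law ψ)) :
    Integrable F (law (mix x ψ)) := by
  rw [law_mix hψ h0]
  refine Integrable.smul_measure ?_ (by simp)
  refine integrable_finsetSum_measure.2 fun i _ => ?_
  rw [integrable_map_measure hFm.aestronglyMeasurable (by fun_prop)]
  exact hF i

/-- A translation changes the quadratic bound on the logarithm only by a constant, and an average of
numbers in [exp(-K), exp K] stays in that interval. Hence all entropies of coded signals are finite.
-/
lemma IsTame.mix {ψ : α → ℝ} (hψ : IsTame ψ) (x : ι → α) : IsTame (mix x ψ) := by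
  have := hψ.isProbabilityMeasure
  have hM : (0 : ℝ) < Fintype.card ι := by exact_mod_cast Fintype.card_pos
  have h0 : ∀ z, 0 ≤ ψ z := fun z => (hψ.pos z).le
  refine ⟨measurable_mix hψ.meas x, fun z => ?_, ?_, ?_, ?_⟩
  · exact div_pos (Finset.sum_pos (fun i _ => hψ.pos _) Finset.univ_nonempty) hM
  · have h : law (GIC.mix x ψ) Set.univ = 1 := by
      rw [law_mix hψ.meas h0]
      simp only [Measure.smul_apply, Measure.finsetSum_apply, smul_eq_mul]
      have : ∀ i, (law ψ).map (fun z => x i + z) Set.univ = 1 := fun i => by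
        rw [Measure.map_apply (by fun_prop) MeasurableSet.univ]; simp
      simp only [this]
      simp [ENNReal.inv_mul_cancel]
    rwa [law, withDensity_apply _ MeasurableSet.univ, setLIntegral_univ] at h
  · obtain ⟨C, hC⟩ := hψ.log_bound
    have hC0 : 0 ≤ C := by
      have := (abs_nonneg _).trans (hC 0); simpa using this
    -- The constant comes from ‖z - x i‖² ≤ 2‖z‖² + 2‖x i‖², with the sum over i making it uniform
    -- in the codeword.
    refine ⟨C * (2 + 2 * ∑ i, ‖x i‖ ^ 2), fun z => ?_⟩
    have hb : ∀ i, |Real.log (ψ (z - x i))| ≤ C * (2 + 2 * ∑ i, ‖x i‖ ^ 2) * (1 + ‖z‖ ^ 2) := by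
      intro i
      have h1 : ‖z - x i‖ ^ 2 ≤ 2 * ‖z‖ ^ 2 + 2 * ‖x i‖ ^ 2 := by
        have := norm_sub_le z (x i)
        have := norm_nonneg (z - x i)
        nlinarith [sq_nonneg (‖z‖ - ‖x i‖)]
      have h2 : ‖x i‖ ^ 2 ≤ ∑ i, ‖x i‖ ^ 2 :=
        Finset.single_le_sum (f := fun i => ‖x i‖ ^ 2) (fun i _ => by positivity) (Finset.mem_univ i)
      refine (hC _).trans ?_
      rw [mul_assoc]
      gcongr
      nlinarith [sq_nonneg ‖z‖, sq_nonneg ‖x i‖]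
    set K := C * (2 + 2 * ∑ i, ‖x i‖ ^ 2) * (1 + ‖z‖ ^ 2)
    have hup : GIC.mix x ψ z ≤ Real.exp K := by
      rw [mix_def, div_le_iff₀ hM]
      calc ∑ i, ψ (z - x i) ≤ ∑ _i : ι, Real.exp K := by
            gcongr with i
            rw [← Real.log_le_iff_le_exp (hψ.pos _)]
            exact (abs_le.1 (hb i)).2
        _ = _ := by simp [mul_comm]
    have hlo : Real.exp (-K) ≤ GIC.mix x ψ z := by
      rw [mix_def, le_div_iff₀ hM]
      calc Real.exp (-K) * Fintype.card ι = ∑ _i : ι, Real.exp (-K) := by simp [mul_comm]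
        _ ≤ _ := by
            gcongr with i
            rw [← Real.le_log_iff_exp_le (hψ.pos _)]
            exact (abs_le.1 (hb i)).1
    have hp : 0 < GIC.mix x ψ z := (Real.exp_pos _).trans_le hlo
    exact abs_le.2 ⟨(Real.le_log_iff_exp_le hp).2 hlo, (Real.log_le_iff_le_exp hp).2 hup⟩
  · refine integrable_law_mix hψ.meas h0 x (by fun_prop) fun i => ?_
    exact ((memLp_const (x i)).add hψ.memLp).norm.integrable_sq

/-- Fano's inequality for uniformly distributed messages `i`, signals `a i` and additive noise of
density `ψ`. -/
lemma fano [DecidableEq ι] [MeasurableSpace ι] [MeasurableSingletonClass ι]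
    {ψ : α → ℝ} (hψ : IsTame ψ) (a : ι → α) {dec : α → ι} (hdec : Measurable dec) :
    (1 - (∑ i, (law ψ).real {z | dec (a i + z) ≠ i}) / Fintype.card ι) * Real.log (Fintype.card ι)
      - Real.log 2 ≤ ent (mix a ψ) - ent ψ := by
  have := hψ.isProbabilityMeasure
  have hf := hψ.mix a
  have := hf.isProbabilityMeasure
  have hM : (0 : ℝ) < Fintype.card ι := by exact_mod_cast Fintype.card_pos
  set M : ℝ := (Fintype.card ι : ℝ) with hMdef
  have h0 : ∀ z, 0 ≤ ψ z := fun z => (hψ.pos z).le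
  -- reverse channel used as the reference measure
  let q : ι → α → ℝ := fun i z => if dec z = i then M / 2 else 1 / 2
  have hq : ∀ i, Measurable (q i) := fun i =>
    Measurable.ite (hdec (measurableSet_singleton i)) measurable_const measurable_const
  have hq0 : ∀ i z, 0 < q i z := fun i z => by simp only [q]; split_ifs <;> positivity
  have hqi : ∀ i, Integrable (q i) (law (mix a ψ)) := fun i =>
    Integrable.of_bound (hq i).aestronglyMeasurable (M / 2 + 1 / 2) (ae_of_all _ fun z => by
      rw [Real.norm_of_nonneg (hq0 i z).le]; simp only [q]; split_ifs <;> linarith)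
  have hlogq : ∀ i z, Real.log (q i z) =
      Real.log M - Real.log 2 - Set.indicator {z | dec z ≠ i} (fun _ => Real.log M) z := by
    intro i z
    by_cases h : dec z = i
    · simp [q, h, Real.log_div hM.ne']
    · simp [q, h]
  have hset : ∀ i, MeasurableSet {z | dec (a i + z) ≠ i} := fun i =>
    (hdec.comp (measurable_const_add (a i))) (measurableSet_singleton i).compl
  let F : ι → α → ℝ := fun i z =>
    Real.log (q i (a i + z)) + Real.log (mix a ψ (a i + z)) - Real.log (ψ z)
  have hlogf : ∀ i, Integrable (fun z => Real.log (mix a ψ (a i + z))) (law ψ) := fun i =>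
    hf.integrable_log_comp (by fun_prop) ((memLp_const (a i)).add hψ.memLp)
  have hind : ∀ i, Integrable (fun z => Set.indicator {z | dec (a i + z) ≠ i}
      (fun _ => Real.log M) z) (law ψ) := fun i => (integrable_const _).indicator (hset i)
  have hlogqi : ∀ i, (fun z => Real.log (q i (a i + z))) = fun z =>
      Real.log M - Real.log 2 - Set.indicator {z | dec (a i + z) ≠ i} (fun _ => Real.log M) z :=
    fun i => by funext z; rw [hlogq]; rfl
  have hlq : ∀ i, Integrable (fun z => Real.log (q i (a i + z))) (law ψ) := fun i => by
    rw [hlogqi]; exact (integrable_const _).sub (hind i)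
  have hF : ∀ i, Integrable (F i) (law ψ) := fun i =>
    ((hlq i).add (hlogf i)).sub hψ.integrable_log
  -- Weighting by `ψ` cancels the term -log ψ in `F i`; translation by `a i` then leaves the
  -- integral of `q i` against the mixture.
  have hexp : ∀ i, ∫⁻ z, ENNReal.ofReal (Real.exp (F i z)) ∂law ψ =
      ENNReal.ofReal (∫ z, q i z ∂law (mix a ψ)) := by
    intro i
    have hFm : Measurable (F i) := by
      have := hψ.meas; have := hf.meas; have := hq i
      simp only [F]; fun_prop
    rw [lintegral_law hψ.meas _ (by fun_prop),
      ofReal_integral_eq_lintegral_ofReal (hqi i) (ae_of_all _ fun z => (hq0 i z).le),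
      lintegral_law hf.meas _ (by have := hq i; fun_prop),
      ← lintegral_sub_right_eq_self _ (a i)]
    refine lintegral_congr fun z => ?_
    rw [← ENNReal.ofReal_mul (h0 _), ← ENNReal.ofReal_mul (hf.pos _).le]
    congr 1
    simp only [F, add_sub_cancel]
    rw [Real.exp_sub, Real.exp_add, Real.exp_log (hq0 _ _), Real.exp_log (hf.pos _),
      Real.exp_log (hψ.pos _), mul_div_cancel₀ _ (hψ.pos _).ne', mul_comm]
  have hJ : ∀ i, ∫ z, F i z ∂law ψ ≤ ∫ z, q i z ∂law (mix a ψ) - 1 := fun i =>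
    integral_le_of_lintegral_exp_le (hF i) (integral_nonneg fun z => (hq0 i z).le) (hexp i).le
  -- Divided by M, the weights are 1/2 on the decoded message and 1/(2M) on each other one, so they
  -- form a subprobability in i. Summed over i, the right-hand sides of `hJ` are therefore at most M
  -- - M = 0.
  have hsumq : ∑ i, ∫ z, q i z ∂law (mix a ψ) ≤ M := by
    rw [← integral_finsetSum _ fun i _ => hqi i]
    have : ∀ z, ∑ i, q i z ≤ M := fun z => by
      have : ∀ i, q i z = 1 / 2 + if dec z = i then (M - 1) / 2 else 0 := fun i => by
        simp only [q]; split_ifs <;> ring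
      simp_rw [this, Finset.sum_add_distrib]
      simp [← hMdef]
      linarith
    calc _ ≤ ∫ _z, M ∂law (mix a ψ) :=
          integral_mono (integrable_finsetSum _ fun i _ => hqi i) (integrable_const _) this
      _ = M := by simp
  have hsum := Finset.sum_le_sum fun i (_ : i ∈ Finset.univ) => hJ i
  have hFval : ∀ i, ∫ z, F i z ∂law ψ = (Real.log M - Real.log 2
      - (law ψ).real {z | dec (a i + z) ≠ i} * Real.log M)
      + ∫ z, Real.log (mix a ψ (a i + z)) ∂law ψ + ent ψ := by
    intro i
    simp only [F]
    rw [integral_sub (f := fun z => Real.log (q i (a i + z)) + Real.log (mix a ψ (a i + z)))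
      ((hlq i).add (hlogf i)) hψ.integrable_log, integral_add (hlq i) (hlogf i),
      hlogqi, integral_sub (integrable_const _) (hind i), integral_indicator (hset i)]
    simp [ent, sub_eq_add_neg]
  have hentf : ent (mix a ψ) = -((∑ i, ∫ z, Real.log (mix a ψ (a i + z)) ∂law ψ) / M) := by
    unfold ent
    rw [integral_law_mix hψ.meas h0 a (hf.meas.log) hlogf]
  simp_rw [hFval] at hsum
  simp only [Finset.sum_sub_distrib, Finset.sum_add_distrib, ← Finset.sum_mul, Finset.sum_const,
    Finset.card_univ, nsmul_eq_mul, ← hMdef, mul_one] at hsum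
  rw [hentf]
  set T := ∑ i, ∫ z, Real.log (mix a ψ (a i + z)) ∂law ψ
  set S := ∑ i, (law ψ).real {z | dec (a i + z) ≠ i}
  have : M * ((1 - S / M) * Real.log M - Real.log 2 + T / M + ent ψ) ≤ 0 := by
    have e : M * ((1 - S / M) * Real.log M - Real.log 2 + T / M + ent ψ)
      = M * Real.log M - M * Real.log 2 - S * Real.log M + T + M * ent ψ := by
      field_simp
      ring
    rw [e]; linarith
  have := nonpos_of_mul_nonpos_right this hM
  linarith

end Densities

end GIC

/-! ### Entropy of Gaussian mixtures and worst additive noise. -/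

namespace GIC

lemma charFun_complexGaussian {v : ℝ} (hv : 0 ≤ v) (t : ℂ) :
    charFun (complexGaussian v) t = Complex.exp (-(v * ‖t‖ ^ 2 / 4 : ℝ)) := by
  rw [charFun_apply, integral_complexGaussian]
  have h : ∀ p : ℝ × ℝ, Complex.exp (((inner ℝ (⟨p.1, p.2⟩ : ℂ) t : ℝ) : ℂ) * Complex.I) =
      Complex.exp (t.re * p.1 * Complex.I) * Complex.exp (t.im * p.2 * Complex.I) := fun p => by
    rw [← Complex.exp_add, Complex.inner]
    congr 1
    simp
    ring
  simp_rw [h]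
  rw [integral_prod_mul (fun x : ℝ => Complex.exp (t.re * x * Complex.I))
    (fun x : ℝ => Complex.exp (t.im * x * Complex.I)), ← charFun_apply_real, ← charFun_apply_real,
    charFun_gaussianReal, charFun_gaussianReal, ← Complex.exp_add,
    ← Complex.normSq_eq_norm_sq, Complex.normSq_apply]
  have h2 : ((v / 2).toNNReal : ℝ) = v / 2 := Real.coe_toNNReal _ (by positivity)
  congr 1
  rw [h2]
  push_cast
  ring

/-- Characteristic functions also cover the degenerate cases `h = 0` and `v = 0`, where there is no
density. -/
lemma map_mul_complexGaussian {v : ℝ} (hv : 0 ≤ v) (h : ℂ) :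
    (complexGaussian v).map (fun z => h * z) = complexGaussian (‖h‖ ^ 2 * v) := by
  have : IsProbabilityMeasure ((complexGaussian v).map (fun z => h * z)) :=
    Measure.isProbabilityMeasure_map (by fun_prop)
  refine Measure.ext_of_charFun ?_
  funext t
  rw [charFun_complexGaussian (by positivity), charFun_apply,
    integral_map (by fun_prop) (by fun_prop)]
  have e : ∀ z : ℂ, inner ℝ (h * z) t = inner ℝ z ((starRingEnd ℂ) h * t) := fun z => by
    simp only [Complex.inner, Complex.mul_re, Complex.mul_im, Complex.conj_re, Complex.conj_im]; ring
  simp_rw [e]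
  rw [← charFun_apply, charFun_complexGaussian hv]
  simp only [norm_mul, RCLike.norm_conj]
  congr 3
  ring

variable {n : ℕ}

lemma map_smul_gaussLaw {v : ℝ} (hv : 0 ≤ v) (h : ℂ) :
    (gaussLaw n v).map (fun z => h • z) = gaussLaw n (‖h‖ ^ 2 * v) := by
  unfold gaussLaw
  rw [← map_mul_complexGaussian hv h,
    ← Measure.pi_map_pi (f := fun _ z => h * z) fun _ => (measurable_const_mul h).aemeasurable]
  rfl

lemma normSq_nonneg (z : Fin n → ℂ) : 0 ≤ normSq z := by unfold normSq; positivity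

lemma normSq_smul (h : ℂ) (z : Fin n → ℂ) : normSq (h • z) = ‖h‖ ^ 2 * normSq z := by
  simp [normSq, Finset.mul_sum, mul_pow]

lemma log_gaussDensity {v : ℝ} (hv : 0 < v) (z : Fin n → ℂ) :
    Real.log (gaussDensity v z) = -(n * Real.log (Real.pi * v)) - normSq z / v := by
  have : 0 < Real.pi * v := by positivity
  rw [gaussDensity, Real.log_mul (by positivity) (Real.exp_pos _).ne', Real.log_exp, Real.log_pow,
    Real.log_inv]
  ring

lemma law_gaussDensity {v : ℝ} (hv : 0 < v) :
    law (gaussDensity v : (Fin n → ℂ) → ℝ) = gaussLaw n v := (gaussLaw_eq_withDensity hv).symm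

lemma isTame_gaussDensity {v : ℝ} (hv : 0 < v) : IsTame (gaussDensity v : (Fin n → ℂ) → ℝ) where
  meas := measurable_gaussDensity v
  pos := gaussDensity_pos hv
  lint := lintegral_gaussDensity hv
  log_bound := by
    refine ⟨|n * Real.log (Real.pi * v)| + n / v, fun z => ?_⟩
    rw [log_gaussDensity hv]
    have h1 : |normSq z / v| ≤ n / v * ‖z‖ ^ 2 := by
      rw [abs_of_nonneg (div_nonneg (normSq_nonneg z) hv.le), div_mul_eq_mul_div]
      gcongr
      exact normSq_le z
    have h2 : (0 : ℝ) ≤ n / v := by positivity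
    calc |-(n * Real.log (Real.pi * v)) - normSq z / v|
        ≤ |-(n * Real.log (Real.pi * v))| + |normSq z / v| := abs_sub _ _
      _ ≤ |n * Real.log (Real.pi * v)| + n / v * ‖z‖ ^ 2 := by rw [abs_neg]; gcongr
      _ ≤ _ := by nlinarith [mul_nonneg (abs_nonneg (n * Real.log (Real.pi * v))) (sq_nonneg ‖z‖)]
  moment := by
    rw [law_gaussDensity hv]
    refine (integrable_normSq_add v 0).mono' (by fun_prop) (ae_of_all _ fun z => ?_)
    rw [Real.norm_of_nonneg (by positivity), zero_add]
    exact norm_sq_le_normSq z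

lemma ent_gaussDensity {v : ℝ} (hv : 0 < v) :
    ent (gaussDensity v : (Fin n → ℂ) → ℝ) = n * Real.log (Real.pi * v) + n := by
  unfold ent
  simp_rw [log_gaussDensity hv]
  have h := integrable_normSq_add v (0 : Fin n → ℂ)
  have h' := integral_normSq_add hv.le (0 : Fin n → ℂ)
  simp only [zero_add] at h h'
  rw [law_gaussDensity hv, integral_sub (integrable_const _) (h.div_const _), integral_div, h']
  simp [normSq]
  field_simp
  ring

section Mixture

set_option linter.unusedSectionVars false

variable {ι : Type*} [Fintype ι] [Nonempty ι]

lemma integrable_normSq_sub_mix {v : ℝ} (hv : 0 < v) (x : ι → Fin n → ℂ) (m : Fin n → ℂ) :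
    Integrable (fun z => normSq (z - m)) (law (mix x (gaussDensity v))) := by
  refine integrable_law_mix (measurable_gaussDensity v) (fun z => (gaussDensity_pos hv z).le) x
    (by have := (continuous_normSq (n := n)).measurable; fun_prop) fun i => ?_
  rw [law_gaussDensity hv]
  refine (integrable_normSq_add v (x i - m)).congr (ae_of_all _ fun z => ?_)
  simp only [sub_add_eq_add_sub]

lemma integral_normSq_sub_mix {v : ℝ} (hv : 0 < v) (x : ι → Fin n → ℂ) (m : Fin n → ℂ) :
    ∫ z, normSq (z - m) ∂law (mix x (gaussDensity v)) =
      (∑ i, normSq (x i - m)) / Fintype.card ι + n * v := by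
  have hM : (0 : ℝ) < Fintype.card ι := by exact_mod_cast Fintype.card_pos
  rw [integral_law_mix (measurable_gaussDensity v) (fun z => (gaussDensity_pos hv z).le) x
    (by have := (continuous_normSq (n := n)).measurable; fun_prop), law_gaussDensity hv]
  · simp_rw [fun (i : ι) z => (sub_add_eq_add_sub (x i) m z).symm, integral_normSq_add hv.le,
      Finset.sum_add_distrib]
    simp
    field_simp
  · intro i
    rw [law_gaussDensity hv]
    refine (integrable_normSq_add v (x i - m)).congr (ae_of_all _ fun z => ?_)
    simp only [sub_add_eq_add_sub]

lemma integrable_log_gaussDensity_mix {v S : ℝ} (hv : 0 < v) (hS : 0 < S) (x : ι → Fin n → ℂ)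
    (m : Fin n → ℂ) :
    Integrable (fun z => Real.log (gaussDensity S (z - m))) (law (mix x (gaussDensity v))) := by
  have := ((isTame_gaussDensity (n := n) hv).mix x).isProbabilityMeasure
  simp_rw [log_gaussDensity hS]
  exact (integrable_const _).sub ((integrable_normSq_sub_mix hv x m).div_const _)

lemma integral_log_gaussDensity_mix {v S : ℝ} (hv : 0 < v) (hS : 0 < S) (x : ι → Fin n → ℂ)
    (m : Fin n → ℂ) :
    ∫ z, Real.log (gaussDensity S (z - m)) ∂law (mix x (gaussDensity v)) =
      -(n * Real.log (Real.pi * S)) -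
        ((∑ i, normSq (x i - m)) / Fintype.card ι + n * v) / S := by
  have := ((isTame_gaussDensity (n := n) hv).mix x).isProbabilityMeasure
  simp_rw [log_gaussDensity hS]
  rw [integral_sub (integrable_const _) ((integrable_normSq_sub_mix hv x m).div_const _),
    integral_div, integral_normSq_sub_mix hv]
  simp

/-- Gaussian densities maximise entropy under a second moment constraint. -/
lemma ent_mix_le {v S : ℝ} (hv : 0 < v) (hS : 0 < S) (x : ι → Fin n → ℂ) (m : Fin n → ℂ)
    (h : (∑ i, normSq (x i - m)) / Fintype.card ι + n * v ≤ n * S) :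
    ent (mix x (gaussDensity v)) ≤ n * Real.log (Real.pi * S) + n := by
  have hf := (isTame_gaussDensity (n := n) hv).mix x
  set f := mix x (gaussDensity v)
  have := hf.isProbabilityMeasure
  have hgi := integrable_log_gaussDensity_mix hv hS x m
  -- The relative entropy of f with respect to the Gaussian centred at m is nonnegative: weighting
  -- the exponential by f leaves a Gaussian density, of mass one.
  have hJ := integral_le_of_lintegral_exp_le (hgi.sub hf.integrable_log) zero_le_one (by
    have e : ∀ z, ENNReal.ofReal (f z) * ENNReal.ofReal
        (Real.exp (Real.log (gaussDensity S (z - m)) - Real.log (f z))) =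
        ENNReal.ofReal (gaussDensity S (z - m)) := fun z => by
      rw [← ENNReal.ofReal_mul (hf.pos z).le, Real.exp_sub, Real.exp_log (gaussDensity_pos hS _),
        Real.exp_log (hf.pos z), mul_div_cancel₀ _ (hf.pos z).ne']
    have := hf.meas
    have := measurable_gaussDensity (n := n) S
    simp only [Pi.sub_apply]
    rw [lintegral_law hf.meas _ (by fun_prop)]
    simp_rw [e]
    rw [lintegral_gaussDensity_sub hS]; simp)
  simp only [Pi.sub_apply] at hJ
  rw [integral_sub hgi hf.integrable_log] at hJ
  rw [integral_log_gaussDensity_mix hv hS] at hJ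
  have h3 : ((∑ i, normSq (x i - m)) / Fintype.card ι + n * v) / S ≤ n := by
    rw [div_le_iff₀ hS]; exact h
  unfold ent
  linarith

/-- The output of the channel `y = h a + t` with independent noise `t`. -/
lemma map_prod_law {f g f' : (Fin n → ℂ) → ℝ} (h : ℂ) (hf : IsTame f) (hg : IsTame g)
    (hf' : Measurable f')
    (H : ∀ y, ∫⁻ a, ENNReal.ofReal (f a * g (y - h • a)) = ENNReal.ofReal (f' y)) :
    ((law f).prod (law g)).map (fun p => h • p.1 + p.2) = law f' := by
  have := hf.isProbabilityMeasure
  have := hg.isProbabilityMeasure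
  have hfm := hf.meas
  have hgm := hg.meas
  refine Measure.ext_of_lintegral _ fun G hG => ?_
  rw [lintegral_map hG (by fun_prop), lintegral_prod _ (by fun_prop),
    lintegral_law hfm _ (Measurable.lintegral_prod_right' (f := fun p => G (h • p.1 + p.2))
      (by fun_prop)), lintegral_law hf' _ hG]
  have e1 : ∀ a, ENNReal.ofReal (f a) * ∫⁻ t, G (h • a + t) ∂law g =
      ∫⁻ y, ENNReal.ofReal (f a * g (y - h • a)) * G y := fun a => by
    rw [lintegral_law hgm _ (by fun_prop),
      ← lintegral_sub_right_eq_self _ (h • a), ← lintegral_const_mul _ (by fun_prop)]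
    refine lintegral_congr fun y => ?_
    rw [add_sub_cancel, ENNReal.ofReal_mul (hf.pos a).le, mul_assoc]
  simp_rw [e1]
  rw [lintegral_lintegral_swap (by fun_prop)]
  refine lintegral_congr fun y => ?_
  rw [lintegral_mul_const _ (by fun_prop), H]

/-- Each codeword contributes a translate of `lintegral_gaussDensity_mul`, the shift by `x i` coming
out as a shift by `h • x i`. A codebook indexed by `Unit` gives the case of one Gaussian with
arbitrary centre. -/
lemma lintegral_mix_mul {a c : ℝ} (ha : 0 < a) (hc : 0 < c) (h : ℂ) (x : ι → Fin n → ℂ)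
    (y : Fin n → ℂ) :
    ∫⁻ z, ENNReal.ofReal (mix x (gaussDensity a) z * gaussDensity c (y - h • z)) =
      ENNReal.ofReal (mix (fun i => h • x i) (gaussDensity (‖h‖ ^ 2 * a + c)) y) := by
  have hM : (0 : ℝ) < Fintype.card ι := by exact_mod_cast Fintype.card_pos
  have hd : 0 < ‖h‖ ^ 2 * a + c := by positivity
  have hga := measurable_gaussDensity (n := n) a
  have hgc := measurable_gaussDensity (n := n) c
  have e : ∀ z, ENNReal.ofReal (mix x (gaussDensity a) z * gaussDensity c (y - h • z)) =
      (∑ i, ENNReal.ofReal (gaussDensity a (z - x i) *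
        gaussDensity c (y - h • x i - h • (z - x i)))) * ENNReal.ofReal (1 / Fintype.card ι) :=
    fun z => by
    have hp : ∀ i, 0 ≤ gaussDensity a (z - x i) * gaussDensity c (y - h • x i - h • (z - x i)) :=
      fun i => mul_nonneg (gaussDensity_pos ha _).le (gaussDensity_pos hc _).le
    rw [← ENNReal.ofReal_sum_of_nonneg fun i _ => hp i,
      ← ENNReal.ofReal_mul (Finset.sum_nonneg fun i _ => hp i), mix_def]
    congr 1
    have : ∀ i, y - h • x i - h • (z - x i) = y - h • z := fun i => by rw [smul_sub]; abel
    simp_rw [this, ← Finset.sum_mul]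
    ring
  simp_rw [e]
  rw [lintegral_mul_const _ (by fun_prop), lintegral_finsetSum _ (by fun_prop)]
  have e2 : ∀ i, ∫⁻ z, ENNReal.ofReal (gaussDensity a (z - x i) *
        gaussDensity c (y - h • x i - h • (z - x i))) =
      ENNReal.ofReal (gaussDensity (‖h‖ ^ 2 * a + c) (y - h • x i)) := fun i => by
    rw [lintegral_sub_right_eq_self (fun z => ENNReal.ofReal (gaussDensity a z *
        gaussDensity c (y - h • x i - h • z))) (x i), lintegral_gaussDensity_mul ha hc]
  simp_rw [e2]
  rw [← ENNReal.ofReal_sum_of_nonneg fun i _ => (gaussDensity_pos hd _).le,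
    ← ENNReal.ofReal_mul (Finset.sum_nonneg fun i _ => (gaussDensity_pos hd _).le), mix_def]
  congr 1
  ring

lemma map_prod_mix {a c : ℝ} (ha : 0 < a) (hc : 0 < c) (h : ℂ) (x : ι → Fin n → ℂ) :
    ((law (mix x (gaussDensity a))).prod (gaussLaw n c)).map (fun p => h • p.1 + p.2) =
      law (mix (fun i => h • x i) (gaussDensity (‖h‖ ^ 2 * a + c))) := by
  rw [← law_gaussDensity hc]
  exact map_prod_law h ((isTame_gaussDensity ha).mix x) (isTame_gaussDensity hc)
    (measurable_mix (measurable_gaussDensity _) _) (lintegral_mix_mul ha hc h x)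

/-- The mirror case of `lintegral_mix_mul`: the codebook sits in the added term, so its shifts are
not multiplied by h. -/
lemma lintegral_mul_mix {a c : ℝ} (ha : 0 < a) (hc : 0 < c) (h : ℂ) (x : ι → Fin n → ℂ)
    (y : Fin n → ℂ) :
    ∫⁻ z, ENNReal.ofReal (gaussDensity a z * mix x (gaussDensity c) (y - h • z)) =
      ENNReal.ofReal (mix x (gaussDensity (‖h‖ ^ 2 * a + c)) y) := by
  have hd : 0 < ‖h‖ ^ 2 * a + c := by positivity
  have hga := measurable_gaussDensity (n := n) a
  have hgc := measurable_gaussDensity (n := n) c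
  have e : ∀ z, ENNReal.ofReal (gaussDensity a z * mix x (gaussDensity c) (y - h • z)) =
      (∑ i, ENNReal.ofReal (gaussDensity a z * gaussDensity c (y - x i - h • z))) *
        ENNReal.ofReal (1 / Fintype.card ι) := fun z => by
    have hp : ∀ i, 0 ≤ gaussDensity a z * gaussDensity c (y - x i - h • z) :=
      fun i => mul_nonneg (gaussDensity_pos ha _).le (gaussDensity_pos hc _).le
    rw [← ENNReal.ofReal_sum_of_nonneg fun i _ => hp i,
      ← ENNReal.ofReal_mul (Finset.sum_nonneg fun i _ => hp i), mix_def]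
    congr 1
    simp_rw [← Finset.mul_sum, sub_right_comm y]
    ring
  simp_rw [e]
  rw [lintegral_mul_const _ (by fun_prop), lintegral_finsetSum _ (by fun_prop)]
  simp_rw [lintegral_gaussDensity_mul ha hc]
  rw [← ENNReal.ofReal_sum_of_nonneg fun i _ => (gaussDensity_pos hd _).le,
    ← ENNReal.ofReal_mul (Finset.sum_nonneg fun i _ => (gaussDensity_pos hd _).le), mix_def]
  congr 1
  ring

/-- Scaling of the entropy of a Gaussian mixture. -/
lemma mix_smul (a : ℝ) {h : ℂ} (hh : h ≠ 0) (x : ι → Fin n → ℂ) (z : Fin n → ℂ) :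
    mix (fun i => h • x i) (gaussDensity (‖h‖ ^ 2 * a)) (h • z) =
      (‖h‖ ^ 2)⁻¹ ^ n * mix x (gaussDensity a) z := by
  have hn : 0 < ‖h‖ := norm_pos_iff.2 hh
  simp only [mix_def, ← smul_sub, gaussDensity, normSq_smul, ← mul_div_assoc, Finset.mul_sum]
  congr 1
  refine Finset.sum_congr rfl fun i _ => ?_
  rw [← mul_assoc ((‖h‖ ^ 2)⁻¹ ^ n), ← mul_pow, ← mul_inv]
  congr 2
  · ring_nf
  · rw [← mul_neg, mul_div_mul_left _ _ (by positivity)]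

lemma map_smul_law_mix {a : ℝ} (ha : 0 < a) {h : ℂ} (hh : h ≠ 0) (x : ι → Fin n → ℂ) :
    (law (mix x (gaussDensity a))).map (fun z => h • z) =
      law (mix (fun i => h • x i) (gaussDensity (‖h‖ ^ 2 * a))) := by
  have hn : 0 < ‖h‖ := norm_pos_iff.2 hh
  have ha' : 0 < ‖h‖ ^ 2 * a := by positivity
  have hm : Measurable fun z : Fin n → ℂ => h • z := by fun_prop
  rw [law_mix (measurable_gaussDensity a) (fun z => (gaussDensity_pos ha z).le),
    law_mix (measurable_gaussDensity _) (fun z => (gaussDensity_pos ha' z).le),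
    law_gaussDensity ha, law_gaussDensity ha', Measure.map_smul, Measure.map_finset_sum hm.aemeasurable,
    ← map_smul_gaussLaw ha.le]
  congr 1
  refine Finset.sum_congr rfl fun i _ => ?_
  rw [Measure.map_map hm (by fun_prop), Measure.map_map (by fun_prop) hm]
  congr 1
  funext z
  simp [smul_add]

/-- Multiplication by h on ℂⁿ has real Jacobian ‖h‖^(2n), whose logarithm is the added term. -/
lemma ent_mix_smul {a : ℝ} (ha : 0 < a) {h : ℂ} (hh : h ≠ 0) (x : ι → Fin n → ℂ) :
    ent (mix (fun i => h • x i) (gaussDensity (‖h‖ ^ 2 * a))) =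
      ent (mix x (gaussDensity a)) + n * Real.log (‖h‖ ^ 2) := by
  have hn : 0 < ‖h‖ := norm_pos_iff.2 hh
  have hf := (isTame_gaussDensity (n := n) ha).mix x
  have := hf.isProbabilityMeasure
  have hf' := (isTame_gaussDensity (n := n) (show 0 < ‖h‖ ^ 2 * a by positivity)).mix
    (fun i => h • x i)
  unfold ent
  rw [← map_smul_law_mix ha hh, integral_map (by fun_prop) hf'.meas.log.aestronglyMeasurable]
  simp_rw [mix_smul a hh]
  have : ∀ z, Real.log ((‖h‖ ^ 2)⁻¹ ^ n * mix x (gaussDensity a) z) =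
      -(n * Real.log (‖h‖ ^ 2)) + Real.log (mix x (gaussDensity a) z) := fun z => by
    rw [Real.log_mul (by positivity) (hf.pos z).ne', Real.log_pow, Real.log_inv]; ring
  simp_rw [this]
  rw [integral_add (integrable_const _) hf.integrable_log]
  simp

/-- Worst additive noise: extra Gaussian noise on a power constrained signal raises the entropy
at least as much as it does for the Gaussian signal. -/
lemma ent_mix_sub_le {a b D D' : ℝ} (ha : 0 < a) (hab : a ≤ b) (hD : 0 < D) (hDD : D' = D + (b - a))
    (x : ι → Fin n → ℂ) (m : Fin n → ℂ)
    (h : (∑ i, normSq (x i - m)) / Fintype.card ι + n * a ≤ n * D) :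
    ent (mix x (gaussDensity a)) - ent (mix x (gaussDensity b)) ≤ n * Real.log (D / D') := by
  -- For equal variances the added noise vanishes and has no density, but both sides are zero.
  rcases hab.eq_or_lt with rfl | hlt
  · have : D' = D := by rw [hDD]; ring
    rw [this]; simp [hD.ne']
  obtain ⟨c, hc, rfl⟩ : ∃ c, 0 < c ∧ b = a + c := ⟨b - a, by linarith, by ring⟩
  have hD' : D' = D + c := by rw [hDD]; ring
  have hD'0 : 0 < D' := by rw [hD']; positivity
  have hb : 0 < a + c := by positivity
  have hfa := (isTame_gaussDensity (n := n) ha).mix x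
  have hfb := (isTame_gaussDensity (n := n) hb).mix x
  set fa := mix x (gaussDensity a)
  set fb := mix x (gaussDensity (a + c)) with hfbdef
  have := hfa.isProbabilityMeasure
  have := hfb.isProbabilityMeasure
  have hga := measurable_gaussDensity (n := n) D
  have hgb := measurable_gaussDensity (n := n) D'
  have hgc := measurable_gaussDensity (n := n) c
  have hmap : ((law fa).prod (gaussLaw n c)).map (fun p => p.1 + p.2) = law fb := by
    have := map_prod_mix (n := n) ha hc 1 x
    simpa using this
  have hadd : Measurable fun p : (Fin n → ℂ) × (Fin n → ℂ) => p.1 + p.2 := by fun_prop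
  set Q := (law fa).prod (gaussLaw n c)
  have hmp1 : MeasurePreserving (fun p : (Fin n → ℂ) × (Fin n → ℂ) => p.1 + p.2) Q (law fb) :=
    ⟨hadd, hmap⟩
  have hmp2 : MeasurePreserving (Prod.fst : (Fin n → ℂ) × (Fin n → ℂ) → _) Q (law fa) :=
    measurePreserving_fst
  have hi1 := integrable_log_gaussDensity_mix ha hD x m
  have hi2 := integrable_log_gaussDensity_mix hb hD'0 x m
  -- The expectation of `Fa` is minus the relative entropy of `fa` to a Gaussian of variance D, and
  -- that of `Fb` is the relative entropy after the noise is added to both. That their sum is at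
  -- most 0 is the data processing inequality.
  let Fa : (Fin n → ℂ) → ℝ := fun z => Real.log (gaussDensity D (z - m)) - Real.log (fa z)
  let Fb : (Fin n → ℂ) → ℝ := fun z => Real.log (fb z) - Real.log (gaussDensity D' (z - m))
  have hFam : Measurable Fa := by have := hfa.meas; fun_prop
  have hFbm : Measurable Fb := by have := hfb.meas; fun_prop
  have hFa : Integrable Fa (law fa) := hi1.sub hfa.integrable_log
  have hFb : Integrable Fb (law fb) := hfb.integrable_log.sub hi2
  have hFa' := hmp2.integrable_comp_of_integrable hFa
  have hFb' := hmp1.integrable_comp_of_integrable hFb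
  have hJ := integral_le_of_lintegral_exp_le (hFa'.add hFb') zero_le_one (by
    simp only [Pi.add_apply, Function.comp]
    rw [lintegral_prod _ (by fun_prop), lintegral_law hfa.meas _
      (Measurable.lintegral_prod_right' (f := fun p : (Fin n → ℂ) × (Fin n → ℂ) =>
        ENNReal.ofReal (Real.exp (Fa p.1 + Fb (p.1 + p.2)))) (by fun_prop))]
    have e1 : ∀ z, ENNReal.ofReal (fa z) *
        ∫⁻ t, ENNReal.ofReal (Real.exp (Fa z + Fb (z + t))) ∂gaussLaw n c =
        ∫⁻ y, ENNReal.ofReal (gaussDensity D (z - m) * gaussDensity c (y - z)) *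
          ENNReal.ofReal (Real.exp (Fb y)) := fun z => by
      rw [← law_gaussDensity hc, lintegral_law hgc _ (by fun_prop),
        ← lintegral_sub_right_eq_self _ z, ← lintegral_const_mul _ (by fun_prop)]
      refine lintegral_congr fun y => ?_
      rw [← ENNReal.ofReal_mul (gaussDensity_pos hc _).le, ← ENNReal.ofReal_mul (hfa.pos z).le,
        ← ENNReal.ofReal_mul (mul_nonneg (gaussDensity_pos hD _).le (gaussDensity_pos hc _).le)]
      congr 1
      rw [add_sub_cancel, Real.exp_add]
      simp only [Fa]
      rw [Real.exp_sub, Real.exp_log (gaussDensity_pos hD _), Real.exp_log (hfa.pos z)]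
      have := (hfa.pos z).ne'
      field_simp
    simp_rw [e1]
    rw [lintegral_lintegral_swap (by fun_prop)]
    -- Integrating out the input of the Gaussian channel yields the Gaussian output density, which
    -- cancels the denominator in exp(Fb).
    have e2 : ∀ y, ∫⁻ z, ENNReal.ofReal (gaussDensity D (z - m) * gaussDensity c (y - z)) *
          ENNReal.ofReal (Real.exp (Fb y)) = ENNReal.ofReal (fb y) := fun y => by
      rw [lintegral_mul_const _ (by fun_prop)]
      have := lintegral_mix_mul hD hc 1 (fun _ : Unit => m) y
      simp only [mix_def, one_smul, norm_one, one_pow, one_mul, Finset.univ_unique,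
        Finset.sum_singleton, Fintype.card_unit, Nat.cast_one, div_one] at this
      rw [this, ← ENNReal.ofReal_mul (gaussDensity_pos (by positivity) _).le, ← hD']
      congr 1
      simp only [Fb]
      rw [Real.exp_sub, Real.exp_log (gaussDensity_pos hD'0 _), Real.exp_log (hfb.pos y),
        mul_div_cancel₀ _ (gaussDensity_pos hD'0 _).ne']
    simp_rw [e2]
    rw [hfb.lint]; simp)
  simp only [Pi.add_apply] at hJ
  rw [integral_add hFa' hFb'] at hJ
  have t1 : ∫ p, (Fa ∘ Prod.fst) p ∂Q = ∫ z, Fa z ∂law fa := by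
    rw [← hmp2.map_eq, integral_map (by fun_prop) hFam.aestronglyMeasurable]; rfl
  have t2 : ∫ p, (Fb ∘ fun p : (Fin n → ℂ) × (Fin n → ℂ) => p.1 + p.2) p ∂Q = ∫ z, Fb z ∂law fb := by
    rw [← hmp1.map_eq, integral_map (by fun_prop) hFbm.aestronglyMeasurable]; rfl
  rw [t1, t2] at hJ
  simp only [Fa, Fb] at hJ
  rw [integral_sub hi1 hfa.integrable_log, integral_sub hfb.integrable_log hi2,
    integral_log_gaussDensity_mix ha hD, integral_log_gaussDensity_mix hb hD'0] at hJ
  set E := (∑ i, normSq (x i - m)) / Fintype.card ι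
  -- Since E + na ≤ nD, adding nc to the numerator and c to the denominator can only move the
  -- quotient up towards n.
  have h3 : (E + n * (a + c)) / D' - (E + n * a) / D ≥ 0 := by
    have : (E + n * (a + c)) / D' - (E + n * a) / D = (c * (n * D - (E + n * a))) / (D' * D) := by
      rw [hD']; field_simp; ring
    rw [this]
    have : 0 ≤ n * D - (E + n * a) := by linarith
    positivity
  rw [Real.log_mul (by positivity) hD.ne', Real.log_mul (by positivity) hD'0.ne'] at hJ
  rw [Real.log_div hD.ne' hD'0.ne']
  unfold ent
  linarith

end Mixture

end GIC

/-! ### The joint law of the noisy signal and the genie signal. -/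

namespace GIC

variable {n : ℕ}

instance : ((volume : Measure ((Fin n → ℂ) × (Fin n → ℂ)))).IsAddRightInvariant := by
  exact Measure.prod.instIsAddRightInvariant

/-- Joint density of `(A, β A + B)` for independent `A`, `B` with densities `p`, `q`. -/
noncomputable def shear (β : ℂ) (p q : (Fin n → ℂ) → ℝ) (z : (Fin n → ℂ) × (Fin n → ℂ)) : ℝ :=
  p z.1 * q (z.2 - β • z.1)

lemma measurable_shear (β : ℂ) {p q : (Fin n → ℂ) → ℝ} (hp : Measurable p) (hq : Measurable q) :
    Measurable (shear β p q) := by unfold shear; fun_prop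

lemma law_shear (β : ℂ) {p q : (Fin n → ℂ) → ℝ} (hp : IsTame p) (hq : IsTame q) :
    law (shear β p q) = ((law p).prod (law q)).map (fun z => (z.1, β • z.1 + z.2)) := by
  have := hp.isProbabilityMeasure
  have := hq.isProbabilityMeasure
  have hpm := hp.meas
  have hqm := hq.meas
  have hm := measurable_shear β hpm hqm
  refine Measure.ext_of_lintegral _ fun G hG => ?_
  rw [lintegral_map hG (by fun_prop), lintegral_prod _ (by fun_prop),
    lintegral_law hpm _ (Measurable.lintegral_prod_right'
      (f := fun z : (Fin n → ℂ) × (Fin n → ℂ) => G (z.1, β • z.1 + z.2)) (by fun_prop)),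
    lintegral_law hm _ hG, Measure.volume_eq_prod, lintegral_prod _ (by fun_prop)]
  refine lintegral_congr fun a => ?_
  rw [lintegral_law hqm _ (by fun_prop), ← lintegral_const_mul _ (by fun_prop),
    ← lintegral_sub_right_eq_self (fun u => ENNReal.ofReal (p a) *
      (ENNReal.ofReal (q u) * G (a, β • a + u))) (β • a)]
  refine lintegral_congr fun u => ?_
  rw [shear, ENNReal.ofReal_mul (hp.pos a).le, mul_assoc, add_sub_cancel]

lemma memLp_prodMk {X F G : Type*} [MeasurableSpace X] [NormedAddCommGroup F]
    [NormedAddCommGroup G] {Q : Measure X} {f : X → F} {g : X → G}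
    (hf : MemLp f 2 Q) (hg : MemLp g 2 Q) : MemLp (fun x => (f x, g x)) 2 Q := by
  refine (hf.norm.add hg.norm).mono (hf.1.prodMk hg.1) (ae_of_all _ fun x => ?_)
  simp only [Pi.add_apply]
  rw [Real.norm_of_nonneg (by positivity), Prod.norm_def]
  exact max_le (by simp) (by simp)

lemma isTame_shear (β : ℂ) {p q : (Fin n → ℂ) → ℝ} (hp : IsTame p) (hq : IsTame q) :
    IsTame (shear β p q) := by
  have := hp.isProbabilityMeasure
  have := hq.isProbabilityMeasure
  have hm := measurable_shear β hp.meas hq.meas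
  have hT : Measurable fun z : (Fin n → ℂ) × (Fin n → ℂ) => (z.1, β • z.1 + z.2) := by fun_prop
  refine ⟨hm, fun z => mul_pos (hp.pos _) (hq.pos _), ?_, ?_, ?_⟩
  · have h : law (shear β p q) Set.univ = 1 := by
      rw [law_shear β hp hq, Measure.map_apply hT MeasurableSet.univ]; simp
    rwa [law, withDensity_apply _ MeasurableSet.univ, setLIntegral_univ] at h
  · obtain ⟨C, hC⟩ := hp.log_bound
    obtain ⟨C', hC'⟩ := hq.log_bound
    have hC0 : 0 ≤ C := by simpa using (abs_nonneg _).trans (hC 0)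
    have hC0' : 0 ≤ C' := by simpa using (abs_nonneg _).trans (hC' 0)
    refine ⟨C + C' * (1 + ‖β‖) ^ 2, fun z => ?_⟩
    have h1 : ‖z.2 - β • z.1‖ ≤ (1 + ‖β‖) * ‖z‖ := by
      refine (norm_sub_le _ _).trans ?_
      rw [norm_smul, add_mul, one_mul]
      gcongr
      · exact norm_snd_le z
      · exact norm_fst_le z
    have h2 : ‖z.2 - β • z.1‖ ^ 2 ≤ (1 + ‖β‖) ^ 2 * ‖z‖ ^ 2 := by
      rw [← mul_pow]; gcongr
    have h3 : (1 : ℝ) ≤ (1 + ‖β‖) ^ 2 := one_le_pow₀ (by simp)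
    have h4 : ‖z.1‖ ^ 2 ≤ ‖z‖ ^ 2 := by gcongr; exact norm_fst_le z
    rw [shear, Real.log_mul (hp.pos _).ne' (hq.pos _).ne']
    calc _ ≤ |Real.log (p z.1)| + |Real.log (q (z.2 - β • z.1))| := abs_add_le _ _
      _ ≤ C * (1 + ‖z.1‖ ^ 2) + C' * (1 + ‖z.2 - β • z.1‖ ^ 2) := add_le_add (hC _) (hC' _)
      _ ≤ C * (1 + ‖z‖ ^ 2) + C' * ((1 + ‖β‖) ^ 2 + (1 + ‖β‖) ^ 2 * ‖z‖ ^ 2) := by gcongr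
      _ = _ := by ring
  · rw [law_shear β hp hq, integrable_map_measure (by fun_prop) (by fun_prop)]
    have h1 := hp.memLp.comp_fst (law q)
    have h2 := hq.memLp.comp_snd (law p)
    exact (memLp_prodMk h1 ((h1.const_smul β).add h2)).norm.integrable_sq

/-- The map (A, B) ↦ (A, βA + B) has Jacobian one. For the genie this reads h(N, Y' + βN + V) = h(N)
+ h(Y' + V), where correlated noise has been replaced by independent terms. -/
lemma ent_shear (β : ℂ) {p q : (Fin n → ℂ) → ℝ} (hp : IsTame p) (hq : IsTame q) :
    ent (shear β p q) = ent p + ent q := by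
  have := hp.isProbabilityMeasure
  have := hq.isProbabilityMeasure
  have hm := measurable_shear β hp.meas hq.meas
  unfold ent
  rw [law_shear β hp hq, integral_map (by fun_prop) hm.log.aestronglyMeasurable]
  simp only [shear, add_sub_cancel_left]
  simp_rw [Real.log_mul (hp.pos _).ne' (hq.pos _).ne']
  rw [integral_add (hp.integrable_log.comp_fst _) (hq.integrable_log.comp_snd _),
    integral_fun_fst (fun z => Real.log (p z)), integral_fun_snd (fun z => Real.log (q z))]
  simp
  ring

lemma integral_normSq_add_smul {v : ℝ} (hv : 0 ≤ v) (q : ℂ) (w : Fin n → ℂ) :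
    Integrable (fun b => normSq (w + q • b)) (gaussLaw n v) ∧
    ∫ b, normSq (w + q • b) ∂gaussLaw n v = normSq w + n * (‖q‖ ^ 2 * v) := by
  have hm : Measurable (fun b : Fin n → ℂ => normSq (w + b)) := by
    have := (continuous_normSq (n := n)).measurable; fun_prop
  have hq : Measurable (fun b : Fin n → ℂ => q • b) := by fun_prop
  constructor
  · have := integrable_normSq_add (‖q‖ ^ 2 * v) w
    rw [← map_smul_gaussLaw hv q, integrable_map_measure hm.aestronglyMeasurable (by fun_prop)]
      at this
    exact this
  · rw [← integral_normSq_add (by positivity) w, ← map_smul_gaussLaw hv q,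
      integral_map (by fun_prop) hm.aestronglyMeasurable]

lemma memLp_gaussLaw (v : ℝ) : MemLp (fun z : Fin n → ℂ => z) 2 (gaussLaw n v) := by
  refine (memLp_two_iff_integrable_sq_norm aestronglyMeasurable_id).2 ?_
  refine (integrable_normSq_add v 0).mono' (by fun_prop) (ae_of_all _ fun z => ?_)
  rw [Real.norm_of_nonneg (by positivity), zero_add]
  exact norm_sq_le_normSq z

lemma integrable_normSq_of_memLp {X : Type*} [MeasurableSpace X] {Q : Measure X}
    {f : X → Fin n → ℂ} (hf : MemLp f 2 Q) : Integrable (fun x => normSq (f x)) Q := by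
  refine (hf.norm.integrable_sq.const_mul n).mono'
    (continuous_normSq.comp_aestronglyMeasurable hf.1) (ae_of_all _ fun x => ?_)
  rw [Real.norm_of_nonneg (normSq_nonneg _)]
  exact normSq_le _

lemma integrable_normSq_linear {X : Type*} [MeasurableSpace X] {Q : Measure X}
    [IsFiniteMeasure Q] {Z : X → (Fin n → ℂ) × (Fin n → ℂ)} (hZ : MemLp Z 2 Q) (θ : ℂ)
    (m : Fin n → ℂ) : Integrable (fun x => normSq ((Z x).1 - θ • (Z x).2 - m)) Q :=
  integrable_normSq_of_memLp ((hZ.fst.sub (hZ.snd.const_smul θ)).sub (memLp_const m))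

section Joint

set_option linter.unusedSectionVars false

variable {ι κ : Type*} [Fintype ι] [Fintype κ] [Nonempty ι] [Nonempty κ]

/-- Joint density of `(X + N, Y + β N + V)` for signals `X`, `Y` uniform over the codebooks `x`, `y`
and independent Gaussian noises `N`, `V` of variances `s`, `v`. -/
noncomputable def jointDensity (x : ι → Fin n → ℂ) (y : κ → Fin n → ℂ) (s v : ℝ) (β : ℂ) :
    (Fin n → ℂ) × (Fin n → ℂ) → ℝ :=
  mix (fun i => (x i, 0)) (shear β (gaussDensity s) (mix y (gaussDensity v)))

variable {x : ι → Fin n → ℂ} {y : κ → Fin n → ℂ} {s v : ℝ} {β : ℂ}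

lemma isTame_jointDensity (hs : 0 < s) (hv : 0 < v) : IsTame (jointDensity x y s v β) :=
  (isTame_shear β (isTame_gaussDensity hs) ((isTame_gaussDensity hv).mix y)).mix _

lemma law_jointDensity (hs : 0 < s) (hv : 0 < v) :
    law (jointDensity x y s v β) = (Fintype.card ι : ENNReal)⁻¹ • ∑ i,
      ((gaussLaw n s).prod (law (mix y (gaussDensity v)))).map
        (fun z => (x i + z.1, β • z.1 + z.2)) := by
  have hgs := isTame_gaussDensity (n := n) hs
  have hgv := (isTame_gaussDensity (n := n) hv).mix y
  have hsh := isTame_shear β hgs hgv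
  rw [jointDensity, law_mix hsh.meas (fun z => (hsh.pos z).le), law_shear β hgs hgv,
    law_gaussDensity hs]
  congr 1
  refine Finset.sum_congr rfl fun i _ => ?_
  rw [Measure.map_map (by fun_prop) (by fun_prop)]
  congr 1
  funext z
  simp

lemma map_fst_jointDensity (hs : 0 < s) (hv : 0 < v) :
    (law (jointDensity x y s v β)).map Prod.fst = law (mix x (gaussDensity s)) := by
  have := ((isTame_gaussDensity (n := n) hv).mix y).isProbabilityMeasure
  rw [law_jointDensity hs hv, law_mix (measurable_gaussDensity s)
    (fun z => (gaussDensity_pos hs z).le), Measure.map_smul,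
    Measure.map_finset_sum measurable_fst.aemeasurable, law_gaussDensity hs]
  congr 1
  refine Finset.sum_congr rfl fun i _ => ?_
  rw [Measure.map_map measurable_fst (by fun_prop)]
  have : (Prod.fst ∘ fun z : (Fin n → ℂ) × (Fin n → ℂ) => (x i + z.1, β • z.1 + z.2)) =
    (fun a => x i + a) ∘ Prod.fst := rfl
  rw [this, ← Measure.map_map (by fun_prop) measurable_fst, measurePreserving_fst.map_eq]

/-- The second coordinate does not involve the codeword `x i`, so all terms of the average over i
coincide. -/
lemma map_snd_jointDensity (hs : 0 < s) (hv : 0 < v) :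
    (law (jointDensity x y s v β)).map Prod.snd =
      law (mix y (gaussDensity (‖β‖ ^ 2 * s + v))) := by
  have hgv := (isTame_gaussDensity (n := n) hv).mix y
  rw [law_jointDensity hs hv, Measure.map_smul, Measure.map_finset_sum measurable_snd.aemeasurable,
    ← map_prod_law β (isTame_gaussDensity hs) hgv (measurable_mix (measurable_gaussDensity _) _)
      (lintegral_mul_mix hs hv β y), law_gaussDensity hs]
  have : ∀ i, (((gaussLaw n s).prod (law (mix y (gaussDensity v)))).map
        (fun z => (x i + z.1, β • z.1 + z.2))).map Prod.snd =
      ((gaussLaw n s).prod (law (mix y (gaussDensity v)))).map (fun z => β • z.1 + z.2) :=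
    fun i => by rw [Measure.map_map measurable_snd (by fun_prop)]; rfl
  simp_rw [this]
  rw [Finset.sum_const, Finset.card_univ, ← Nat.cast_smul_eq_nsmul ENNReal, smul_smul,
    ENNReal.inv_mul_cancel (by simp) (by simp), one_smul]

/-- For a fixed codeword the error is (w - θ y j) + (1 - θβ)N - θV, with independent centred noises,
so the second moments add. The noise N is integrated first, then the mixture. -/
lemma integral_normSq_shear (hs : 0 < s) (hv : 0 < v) (θ : ℂ) (w : Fin n → ℂ) :
    ∫ z, normSq (w + (z.1 - θ • z.2)) ∂law (shear β (gaussDensity s) (mix y (gaussDensity v))) =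
      (∑ j, normSq (w - θ • y j)) / Fintype.card κ +
        n * (‖1 - θ * β‖ ^ 2 * s + ‖θ‖ ^ 2 * v) := by
  have hM : (0 : ℝ) < Fintype.card κ := by exact_mod_cast Fintype.card_pos
  have hgs := isTame_gaussDensity (n := n) hs
  have hgv := (isTame_gaussDensity (n := n) hv)
  have hgy := hgv.mix y
  have hsh := isTame_shear β hgs hgy
  have := hsh.isProbabilityMeasure
  have := hgs.isProbabilityMeasure
  have := hgy.isProbabilityMeasure
  have hc := (continuous_normSq (n := n)).measurable
  have hm : Measurable fun z : (Fin n → ℂ) × (Fin n → ℂ) => normSq (w + (z.1 - θ • z.2)) := by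
    fun_prop
  have hT : Measurable fun z : (Fin n → ℂ) × (Fin n → ℂ) => (z.1, β • z.1 + z.2) := by fun_prop
  have hint : Integrable (fun z : (Fin n → ℂ) × (Fin n → ℂ) => normSq (w + (z.1 - θ • z.2)))
      (law (shear β (gaussDensity s) (mix y (gaussDensity v)))) :=
    integrable_normSq_of_memLp ((memLp_const w).add (hsh.memLp.fst.sub (hsh.memLp.snd.const_smul θ)))
  rw [law_shear β hgs hgy, integrable_map_measure hm.aestronglyMeasurable hT.aemeasurable] at hint
  rw [law_shear β hgs hgy, integral_map hT.aemeasurable hm.aestronglyMeasurable]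
  have e : ∀ a b : Fin n → ℂ, normSq (w + (a - θ • (β • a + b))) =
        normSq ((w - θ • b) + (1 - θ * β) • a) := fun a b => by
    congr 1; simp only [sub_smul, mul_smul, smul_add, one_smul]; abel
  have e2 : ∀ j (b : Fin n → ℂ), normSq (w - θ • (y j + b)) =
      normSq ((w - θ • y j) + (-θ) • b) := fun j b => by
    congr 1; simp only [smul_add, neg_smul]; abel
  have hb : ∀ j, Integrable (fun b => normSq (w - θ • (y j + b))) (law (gaussDensity v)) :=
    fun j => by
    simp_rw [e2, law_gaussDensity hv]; exact (integral_normSq_add_smul hv.le _ _).1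
  have hmb : Measurable fun b : Fin n → ℂ => normSq (w - θ • b) := by fun_prop
  have h1 := integral_prod_symm _ hint
  simp only [Function.comp_def] at h1
  rw [h1]
  simp_rw [e, law_gaussDensity hs, (integral_normSq_add_smul hs.le _ _).2]
  rw [integral_add (integrable_law_mix hgv.meas (fun z => (hgv.pos z).le) y hmb hb)
    (integrable_const _), integral_law_mix hgv.meas (fun z => (hgv.pos z).le) y hmb hb]
  simp_rw [e2, law_gaussDensity hv, (integral_normSq_add_smul hv.le _ _).2, norm_neg]
  simp only [Finset.sum_add_distrib, Finset.sum_const, Finset.card_univ, nsmul_eq_mul,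
    integral_const, probReal_univ, smul_eq_mul, one_mul]
  field_simp
  ring

/-- Second moment of a linear prediction error of the first from the second coordinate. -/
lemma integral_normSq_jointDensity (hs : 0 < s) (hv : 0 < v) (θ : ℂ) (m : Fin n → ℂ) :
    ∫ z, normSq (z.1 - θ • z.2 - m) ∂law (jointDensity x y s v β) =
      (∑ i, ∑ j, normSq (x i - θ • y j - m)) / (Fintype.card ι * Fintype.card κ) +
        n * (‖1 - θ * β‖ ^ 2 * s + ‖θ‖ ^ 2 * v) := by
  have hM : (0 : ℝ) < Fintype.card ι := by exact_mod_cast Fintype.card_pos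
  have hM' : (0 : ℝ) < Fintype.card κ := by exact_mod_cast Fintype.card_pos
  have hsh := isTame_shear β (isTame_gaussDensity (n := n) hs) ((isTame_gaussDensity hv).mix y)
  have := hsh.isProbabilityMeasure
  have hc := (continuous_normSq (n := n)).measurable
  have hm : Measurable fun z : (Fin n → ℂ) × (Fin n → ℂ) => normSq (z.1 - θ • z.2 - m) := by
    fun_prop
  have hint : ∀ i, Integrable (fun z : (Fin n → ℂ) × (Fin n → ℂ) =>
      normSq (((x i, 0) + z).1 - θ • ((x i, 0) + z).2 - m))
      (law (shear β (gaussDensity s) (mix y (gaussDensity v)))) := fun i =>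
    integrable_normSq_linear ((memLp_const (x i, (0 : Fin n → ℂ))).add hsh.memLp) θ m
  have e : ∀ i (z : (Fin n → ℂ) × (Fin n → ℂ)),
      normSq (((x i, 0) + z).1 - θ • ((x i, 0) + z).2 - m) =
        normSq ((x i - m) + (z.1 - θ • z.2)) := fun i z => by
    congr 1; simp only [Prod.fst_add, Prod.snd_add, zero_add]; abel
  rw [jointDensity, integral_law_mix hsh.meas (fun z => (hsh.pos z).le) _ hm hint]
  simp_rw [e, integral_normSq_shear hs hv, sub_right_comm]
  rw [Finset.sum_add_distrib, ← Finset.sum_div]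
  simp only [Finset.sum_const, Finset.card_univ, nsmul_eq_mul]
  field_simp

end Joint

end GIC

/-! ### Conditional worst additive noise. -/

namespace GIC

variable {n : ℕ}

section Joint

variable {ι κ : Type*} [Fintype ι] [Fintype κ] [Nonempty ι] [Nonempty κ]
  {x : ι → Fin n → ℂ} {y : κ → Fin n → ℂ} {s v : ℝ} {β : ℂ}

lemma measurePreserving_snd_jointDensity (hs : 0 < s) (hv : 0 < v) :
    MeasurePreserving Prod.snd (law (jointDensity x y s v β))
      (law (mix y (gaussDensity (‖β‖ ^ 2 * s + v)))) :=
  ⟨measurable_snd, map_snd_jointDensity hs hv⟩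

lemma measurePreserving_fst_jointDensity (hs : 0 < s) (hv : 0 < v) :
    MeasurePreserving Prod.fst (law (jointDensity x y s v β)) (law (mix x (gaussDensity s))) :=
  ⟨measurable_fst, map_fst_jointDensity hs hv⟩

lemma ent_eq_of_measurePreserving {α X : Type*} [NormedAddCommGroup α] [MeasureSpace α]
    [MeasurableSpace X] {Q : Measure X} {ψ : α → ℝ} (hψ : IsTame ψ) {T : X → α}
    (hT : MeasurePreserving T Q (law ψ)) :
    Integrable (fun z => Real.log (ψ (T z))) Q ∧ ∫ z, Real.log (ψ (T z)) ∂Q = -ent ψ := by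
  refine ⟨hT.integrable_comp_of_integrable hψ.integrable_log, ?_⟩
  rw [ent, neg_neg, ← hT.map_eq, integral_map hT.measurable.aemeasurable
    hψ.meas.log.aestronglyMeasurable]

/-- Subadditivity of the entropy of `(A, U)`. -/
lemma ent_jointDensity_le (hs : 0 < s) (hv : 0 < v) :
    ent (jointDensity x y s v β) ≤
      ent (mix x (gaussDensity s)) + ent (mix y (gaussDensity (‖β‖ ^ 2 * s + v))) := by
  have hf := isTame_jointDensity (x := x) (y := y) (β := β) hs hv
  have ha := (isTame_gaussDensity (n := n) hs).mix x
  have hu := (isTame_gaussDensity (n := n) (show 0 < ‖β‖ ^ 2 * s + v by positivity)).mix y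
  obtain ⟨ia, ea⟩ := ent_eq_of_measurePreserving ha
    (measurePreserving_fst_jointDensity (x := x) (y := y) (β := β) hs hv)
  obtain ⟨iu, eu⟩ := ent_eq_of_measurePreserving hu
    (measurePreserving_snd_jointDensity (x := x) (y := y) (β := β) hs hv)
  set f := jointDensity x y s v β
  set fa := mix x (gaussDensity s)
  set fu := mix y (gaussDensity (‖β‖ ^ 2 * s + v))
  have := hf.isProbabilityMeasure
  have hfm := hf.meas
  have ham := ha.meas
  have hum := hu.meas
  -- Nonnegativity of the mutual information of the two coordinates: the weighted exponential is the
  -- product of the marginal densities.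
  have hJ := integral_le_of_lintegral_exp_le ((ia.add iu).sub hf.integrable_log) zero_le_one (by
    simp only [Pi.add_apply, Pi.sub_apply]
    rw [lintegral_law hfm _ (by fun_prop)]
    have e : ∀ z, ENNReal.ofReal (f z) * ENNReal.ofReal
        (Real.exp (Real.log (fa z.1) + Real.log (fu z.2) - Real.log (f z))) =
        ENNReal.ofReal (fa z.1) * ENNReal.ofReal (fu z.2) := fun z => by
      rw [← ENNReal.ofReal_mul (hf.pos z).le, ← ENNReal.ofReal_mul (ha.pos _).le, Real.exp_sub,
        Real.exp_add, Real.exp_log (ha.pos _), Real.exp_log (hu.pos _), Real.exp_log (hf.pos z),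
        mul_div_cancel₀ _ (hf.pos z).ne']
    simp_rw [e]
    rw [Measure.volume_eq_prod, lintegral_prod_mul (f := fun a => ENNReal.ofReal (fa a))
      (g := fun u => ENNReal.ofReal (fu u)) (by fun_prop) (by fun_prop), ha.lint, hu.lint]
    simp)
  rw [integral_sub' (ia.add iu) hf.integrable_log, integral_add' ia iu, ea, eu] at hJ
  rw [ent]
  linarith

/-- Conditional worst additive noise: for `C = h A + T` with Gaussian noise `T` of variance `c`,
the difference `h(A | U) - h(C)` is at most its value for Gaussian signals. -/
lemma ent_jointDensity_sub_le {c S : ℝ} (hs : 0 < s) (hv : 0 < v) (hc : 0 < c) (hS : 0 < S)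
    (h θ : ℂ) (m : Fin n → ℂ)
    (hmom : (∑ i, ∑ j, normSq (x i - θ • y j - m)) / (Fintype.card ι * Fintype.card κ) +
        n * (‖1 - θ * β‖ ^ 2 * s + ‖θ‖ ^ 2 * v) ≤ n * S) :
    ent (jointDensity x y s v β) - ent (mix y (gaussDensity (‖β‖ ^ 2 * s + v))) -
      ent (mix (fun i => h • x i) (gaussDensity (‖h‖ ^ 2 * s + c))) ≤
      n * Real.log (S / (‖h‖ ^ 2 * S + c)) := by
  have hf := isTame_jointDensity (x := x) (y := y) (β := β) hs hv
  have hu := (isTame_gaussDensity (n := n) (show 0 < ‖β‖ ^ 2 * s + v by positivity)).mix y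
  have hw := (isTame_gaussDensity (n := n) (show 0 < ‖h‖ ^ 2 * s + c by positivity)).mix
    (fun i => h • x i)
  have hgc := isTame_gaussDensity (n := n) hc
  have hS' : 0 < ‖h‖ ^ 2 * S + c := by positivity
  have hpS : ∀ z : Fin n → ℂ, 0 < gaussDensity S z := gaussDensity_pos hS
  have hpS' : ∀ z : Fin n → ℂ, 0 < gaussDensity (‖h‖ ^ 2 * S + c) z := gaussDensity_pos hS'
  have hmS := measurable_gaussDensity (n := n) S
  have hmS' := measurable_gaussDensity (n := n) (‖h‖ ^ 2 * S + c)
  set f := jointDensity x y s v β with hfdef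
  set fu := mix y (gaussDensity (‖β‖ ^ 2 * s + v)) with hfu
  set fw := mix (fun i => h • x i) (gaussDensity (‖h‖ ^ 2 * s + c)) with hfw
  have := hf.isProbabilityMeasure
  have hfm := hf.meas
  have hum := hu.meas
  have hwm := hw.meas
  have hcm := hgc.meas
  have hnm := (continuous_normSq (n := n)).measurable
  let Q := (law f).prod (gaussLaw n c)
  have hQ1 : MeasurePreserving Prod.fst Q (law f) := measurePreserving_fst
  -- Under Q, a point is ((A, U), T) with T independent of (A, U); the marginals needed are those of
  -- U and of hA + T.
  have hQu : MeasurePreserving (fun z : ((Fin n → ℂ) × (Fin n → ℂ)) × (Fin n → ℂ) => z.1.2) Q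
      (law fu) := (measurePreserving_snd_jointDensity hs hv).comp hQ1
  have hQw : MeasurePreserving
      (fun z : ((Fin n → ℂ) × (Fin n → ℂ)) × (Fin n → ℂ) => h • z.1.1 + z.2) Q (law fw) := by
    have h1 : MeasurePreserving (Prod.map Prod.fst id) Q
        ((law (mix x (gaussDensity s))).prod (gaussLaw n c)) :=
      (measurePreserving_fst_jointDensity hs hv).prod (MeasurePreserving.id _)
    exact (show MeasurePreserving (fun p : (Fin n → ℂ) × (Fin n → ℂ) => h • p.1 + p.2)
      ((law (mix x (gaussDensity s))).prod (gaussLaw n c)) (law fw) from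
      ⟨by fun_prop, map_prod_mix hs hc h x⟩).comp h1
  obtain ⟨i1, e1⟩ := ent_eq_of_measurePreserving hf hQ1
  obtain ⟨iu, eu⟩ := ent_eq_of_measurePreserving hu hQu
  obtain ⟨iw, ew⟩ := ent_eq_of_measurePreserving hw hQw
  -- second moments of the prediction errors
  have hZ : MemLp (fun z : ((Fin n → ℂ) × (Fin n → ℂ)) × (Fin n → ℂ) => z.1) 2 Q :=
    hf.memLp.comp_fst _
  have hT : MemLp (fun z : ((Fin n → ℂ) × (Fin n → ℂ)) × (Fin n → ℂ) => z.2) 2 Q :=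
    (memLp_gaussLaw c).comp_snd _
  let d : ((Fin n → ℂ) × (Fin n → ℂ)) × (Fin n → ℂ) → Fin n → ℂ :=
    fun z => z.1.1 - θ • z.1.2 - m
  have hd : MemLp d 2 Q := (hZ.fst.sub (hZ.snd.const_smul θ)).sub (memLp_const m)
  have hdm : Measurable d := by fun_prop
  have id1 : Integrable (fun z => normSq (d z)) Q := integrable_normSq_of_memLp hd
  have id2 : Integrable (fun z => normSq (h • d z + z.2)) Q :=
    integrable_normSq_of_memLp ((hd.const_smul h).add hT)
  set E := ∫ z, normSq (d z) ∂Q with hE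
  have hE1 : E ≤ n * S := by
    have : E = ∫ z, normSq (z.1 - θ • z.2 - m) ∂law f := by
      rw [hE, ← hQ1.map_eq, integral_map hQ1.measurable.aemeasurable
        (by exact Measurable.aestronglyMeasurable (by fun_prop))]
    rw [this, hfdef, integral_normSq_jointDensity hs hv]
    exact hmom
  -- The noise T is centred and independent of the prediction error, so there is no cross term.
  have hE2 : ∫ z, normSq (h • d z + z.2) ∂Q = ‖h‖ ^ 2 * E + n * c := by
    have hd0 : ∀ p t, d (p, t) = p.1 - θ • p.2 - m := fun _ _ => rfl
    have id1' : Integrable (fun p => normSq (p.1 - θ • p.2 - m)) (law f) :=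
      integrable_normSq_linear hf.memLp θ m
    have hE' : E = ∫ p, normSq (p.1 - θ • p.2 - m) ∂law f := by
      rw [hE, integral_prod _ id1]
      simp [hd0]
    rw [integral_prod _ id2]
    simp only [hd0]
    simp_rw [integral_normSq_add hc.le, normSq_smul]
    rw [integral_add (id1'.const_mul _) (integrable_const _), integral_const_mul, ← hE']
    simp
  have hl1 : ∀ z : Fin n → ℂ, Real.log (gaussDensity S z) =
      -(n * Real.log (Real.pi * S)) - normSq z / S := fun z => log_gaussDensity hS z
  have hl2 : ∀ z : Fin n → ℂ, Real.log (gaussDensity (‖h‖ ^ 2 * S + c) z) =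
      -(n * Real.log (Real.pi * (‖h‖ ^ 2 * S + c))) - normSq z / (‖h‖ ^ 2 * S + c) :=
    fun z => log_gaussDensity hS' z
  have ig1 : Integrable (fun z => Real.log (gaussDensity S (d z))) Q := by
    simp_rw [hl1]; exact (integrable_const _).sub (id1.div_const _)
  have ig2 : Integrable (fun z => Real.log (gaussDensity (‖h‖ ^ 2 * S + c) (h • d z + z.2))) Q := by
    simp_rw [hl2]; exact (integrable_const _).sub (id2.div_const _)
  have eg1 : ∫ z, Real.log (gaussDensity S (d z)) ∂Q = -(n * Real.log (Real.pi * S)) - E / S := by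
    simp_rw [hl1]
    rw [integral_sub (integrable_const _) (id1.div_const _), integral_div]
    simp [hE]
  have eg2 : ∫ z, Real.log (gaussDensity (‖h‖ ^ 2 * S + c) (h • d z + z.2)) ∂Q =
      -(n * Real.log (Real.pi * (‖h‖ ^ 2 * S + c))) -
        (‖h‖ ^ 2 * E + n * c) / (‖h‖ ^ 2 * S + c) := by
    simp_rw [hl2]
    rw [integral_sub (integrable_const _) (id2.div_const _), integral_div, hE2]
    simp
  -- The true law of (A, U, C), with C = hA + T, is compared with a reference law in which U and C
  -- are independent with their true marginals and A given (U, C) is the posterior of the Gaussian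
  -- model. The exponent is the log-likelihood ratio, with the common density of T cancelled.
  have hJ := integral_le_of_lintegral_exp_le ((((iu.add iw).add ig1).sub i1).sub ig2) zero_le_one (by
    simp only [Pi.add_apply, Pi.sub_apply]
    have hexp : ∀ z : ((Fin n → ℂ) × (Fin n → ℂ)) × (Fin n → ℂ),
        Real.exp (Real.log (fu z.1.2) + Real.log (fw (h • z.1.1 + z.2)) +
          Real.log (gaussDensity S (d z)) - Real.log (f z.1) -
          Real.log (gaussDensity (‖h‖ ^ 2 * S + c) (h • d z + z.2))) =
        fu z.1.2 * fw (h • z.1.1 + z.2) * gaussDensity S (d z) / f z.1 /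
          gaussDensity (‖h‖ ^ 2 * S + c) (h • d z + z.2) := fun z => by
      rw [Real.exp_sub, Real.exp_sub, Real.exp_add, Real.exp_add, Real.exp_log (hu.pos _),
        Real.exp_log (hw.pos _), Real.exp_log (hpS _), Real.exp_log (hf.pos _),
        Real.exp_log (hpS' _)]
    simp_rw [hexp]
    rw [lintegral_prod _ (by fun_prop), lintegral_law hfm _ (Measurable.lintegral_prod_right'
      (f := fun z : ((Fin n → ℂ) × (Fin n → ℂ)) × (Fin n → ℂ) =>
        ENNReal.ofReal (fu z.1.2 * fw (h • z.1.1 + z.2) * gaussDensity S (d z) / f z.1 /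
          gaussDensity (‖h‖ ^ 2 * S + c) (h • d z + z.2))) (by fun_prop))]
    -- The kernel `k` is the unnormalised Gaussian posterior of A given U = u and C = w; its
    -- normaliser is the denominator in `r`. Integrating over a therefore leaves only the product of
    -- the marginals of U and C.
    let k : (Fin n → ℂ) → (Fin n → ℂ) → (Fin n → ℂ) → ℝ := fun u w a =>
      gaussDensity S (a - (θ • u + m)) * gaussDensity c (w - h • a)
    have hk0 : ∀ u w a, 0 ≤ k u w a := fun u w a => mul_nonneg (hpS _).le (hgc.pos _).le
    let r : (Fin n → ℂ) → (Fin n → ℂ) → ℝ := fun u w =>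
      fu u * fw w / gaussDensity (‖h‖ ^ 2 * S + c) (w - h • (θ • u + m))
    have hr0 : ∀ u w, 0 ≤ r u w := fun u w =>
      div_nonneg (mul_nonneg (hu.pos _).le (hw.pos _).le) (hpS' _).le
    have s1 : ∀ p : (Fin n → ℂ) × (Fin n → ℂ), ENNReal.ofReal (f p) *
        ∫⁻ t, ENNReal.ofReal (fu p.2 * fw (h • p.1 + t) * gaussDensity S (d (p, t)) / f p /
          gaussDensity (‖h‖ ^ 2 * S + c) (h • d (p, t) + t)) ∂gaussLaw n c =
        ∫⁻ w, ENNReal.ofReal (r p.2 w) * ENNReal.ofReal (k p.2 w p.1) := fun p => by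
      rw [← law_gaussDensity hc, lintegral_law hcm _ (by fun_prop),
        ← lintegral_sub_right_eq_self _ (h • p.1), ← lintegral_const_mul _ (by fun_prop)]
      refine lintegral_congr fun w => ?_
      rw [← ENNReal.ofReal_mul (hgc.pos _).le, ← ENNReal.ofReal_mul (hf.pos p).le,
        ← ENNReal.ofReal_mul (hr0 _ _)]
      congr 1
      have hd' : d (p, w - h • p.1) = p.1 - (θ • p.2 + m) := by simp only [d]; abel
      have hd'' : h • (p.1 - (θ • p.2 + m)) + (w - h • p.1) = w - h • (θ • p.2 + m) := by
        rw [smul_sub]; abel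
      rw [hd', hd'', add_sub_cancel]
      simp only [r, k]
      have := (hf.pos p).ne'
      field_simp
    have s2 : ∀ u w, ∫⁻ a, ENNReal.ofReal (k u w a) =
        ENNReal.ofReal (gaussDensity (‖h‖ ^ 2 * S + c) (w - h • (θ • u + m))) := fun u w => by
      have := lintegral_mix_mul hS hc h (fun _ : Unit => θ • u + m) w
      simpa only [mix_def, Finset.univ_unique, Finset.sum_singleton, Fintype.card_unit,
        Nat.cast_one, div_one] using this
    simp_rw [s1]
    rw [Measure.volume_eq_prod, lintegral_prod_symm _ (by fun_prop)]
    have s3 : ∀ u : Fin n → ℂ, ∫⁻ a, ∫⁻ w, ENNReal.ofReal (r u w) * ENNReal.ofReal (k u w a) =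
        ENNReal.ofReal (fu u) := fun u => by
      rw [lintegral_lintegral_swap (by fun_prop)]
      have : ∀ w, ∫⁻ a, ENNReal.ofReal (r u w) * ENNReal.ofReal (k u w a) =
          ENNReal.ofReal (fu u) * ENNReal.ofReal (fw w) := fun w => by
        rw [lintegral_const_mul _ (by fun_prop), s2, ← ENNReal.ofReal_mul (hr0 _ _),
          ← ENNReal.ofReal_mul (hu.pos _).le]
        congr 1
        exact div_mul_cancel₀ _ (hpS' _).ne'
      simp_rw [this]
      rw [lintegral_const_mul _ (by fun_prop), hw.lint, mul_one]
    simp_rw [s3]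
    rw [hu.lint]; simp)
  rw [integral_sub' (((iu.add iw).add ig1).sub i1) ig2, integral_sub' ((iu.add iw).add ig1) i1,
    integral_add' (iu.add iw) ig1, integral_add' iu iw, e1, eu, ew, eg1, eg2] at hJ
  -- After clearing denominators this is c E ≤ c n S: the excess noise makes the bound monotone in
  -- the prediction error.
  have h3 : E / S ≤ (‖h‖ ^ 2 * E + n * c) / (‖h‖ ^ 2 * S + c) := by
    rw [div_le_div_iff₀ hS hS']
    nlinarith [mul_le_mul_of_nonneg_left hE1 hc.le]
  rw [Real.log_mul (by positivity) hS.ne', Real.log_mul (by positivity) hS'.ne'] at hJ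
  rw [Real.log_div hS.ne' hS'.ne']
  linarith

/-- The bound `ent_jointDensity_sub_le` without excess noise. -/
lemma ent_jointDensity_sub_le_of_eq {S : ℝ} (hs : 0 < s) (hv : 0 < v) (hS : 0 < S)
    {h : ℂ} (hh : h ≠ 0) :
    ent (jointDensity x y s v β) - ent (mix y (gaussDensity (‖β‖ ^ 2 * s + v))) -
      ent (mix (fun i => h • x i) (gaussDensity (‖h‖ ^ 2 * s))) ≤
      n * Real.log (S / (‖h‖ ^ 2 * S)) := by
  have hn : 0 < ‖h‖ := norm_pos_iff.2 hh
  have h1 := ent_jointDensity_le (x := x) (y := y) (β := β) hs hv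
  rw [ent_mix_smul hs hh]
  have : S / (‖h‖ ^ 2 * S) = (‖h‖ ^ 2)⁻¹ := by field_simp
  rw [this, Real.log_inv]
  linarith

end Joint

end GIC

/-! ### Codebook moments and the genie bound for one user. -/

namespace GIC

variable {n : ℕ}

section Moments

set_option linter.unusedSectionVars false

variable {ι κ : Type*} [Fintype ι] [Fintype κ] [Nonempty ι] [Nonempty κ]

lemma normSq_add (a b : Fin n → ℂ) :
    normSq (a + b) = normSq a + 2 * ∑ k, inner ℝ (a k) (b k) + normSq b := by
  simp only [normSq, Pi.add_apply, norm_add_sq_real, Finset.sum_add_distrib, Finset.mul_sum]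

lemma sum_normSq_add (a : Fin n → ℂ) (b : κ → Fin n → ℂ) (hb : ∑ j, b j = 0) :
    ∑ j, normSq (a + b j) = Fintype.card κ * normSq a + ∑ j, normSq (b j) := by
  simp_rw [normSq_add, Finset.sum_add_distrib, ← Finset.mul_sum]
  rw [Finset.sum_comm]
  simp_rw [← inner_sum, ← Finset.sum_apply, hb]
  simp

/-- Average of a codebook. -/
noncomputable def centroid (x : ι → Fin n → ℂ) : Fin n → ℂ :=
  (Fintype.card ι : ℂ)⁻¹ • ∑ i, x i

lemma sum_sub_centroid (x : ι → Fin n → ℂ) : ∑ i, (x i - centroid x) = 0 := by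
  rw [Finset.sum_sub_distrib, Finset.sum_const, Finset.card_univ, centroid,
    ← Nat.cast_smul_eq_nsmul ℂ, smul_smul, mul_inv_cancel₀ (by simp), one_smul, sub_self]

/-- Codewords need not average to zero. Subtracting the mean only lowers the power, and it makes
independent signals uncorrelated, which removes the cross terms in second moments of sums. -/
lemma sum_normSq_sub_centroid_le {x : ι → Fin n → ℂ} {p : ℝ} (hx : ∀ i, normSq (x i) ≤ p) :
    ∑ i, normSq (x i - centroid x) ≤ Fintype.card ι * p := by
  have h := sum_normSq_add (centroid x) (fun i => x i - centroid x) (sum_sub_centroid x)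
  simp only [add_sub_cancel] at h
  have h1 : ∑ i, normSq (x i) ≤ Fintype.card ι * p :=
    (Finset.sum_le_sum fun i _ => hx i).trans (by simp)
  have h2 := normSq_nonneg (centroid x)
  have h3 : (0 : ℝ) ≤ Fintype.card ι * normSq (centroid x) := by positivity
  linarith

/-- Second moment of `X + q Y` about its mean, for independent power constrained signals. -/
lemma sum_normSq_centered_le {x : ι → Fin n → ℂ} {y : κ → Fin n → ℂ} {p r : ℝ}
    (hx : ∀ i, normSq (x i) ≤ p) (hy : ∀ j, normSq (y j) ≤ r) (q : ℂ) :
    (∑ i, ∑ j, normSq (x i + q • y j - (centroid x + q • centroid y))) /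
      (Fintype.card ι * Fintype.card κ) ≤ p + ‖q‖ ^ 2 * r := by
  have hM : (0 : ℝ) < Fintype.card ι := by exact_mod_cast Fintype.card_pos
  have hM' : (0 : ℝ) < Fintype.card κ := by exact_mod_cast Fintype.card_pos
  rw [div_le_iff₀ (by positivity)]
  have e : ∀ i j, x i + q • y j - (centroid x + q • centroid y) =
      (x i - centroid x) + q • (y j - centroid y) := fun i j => by rw [smul_sub]; abel
  simp_rw [e]
  have h0 : ∑ j, q • (y j - centroid y) = 0 := by
    rw [← Finset.smul_sum, sum_sub_centroid, smul_zero]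
  simp_rw [fun i => sum_normSq_add (x i - centroid x) (fun j => q • (y j - centroid y)) h0,
    normSq_smul, Finset.sum_add_distrib, ← Finset.mul_sum]
  have h1 := sum_normSq_sub_centroid_le hx
  have h2 := sum_normSq_sub_centroid_le hy
  simp only [Finset.sum_const, Finset.card_univ, nsmul_eq_mul]
  have m1 := mul_le_mul_of_nonneg_left h1 hM'.le
  have m2 := mul_le_mul_of_nonneg_left h2 (mul_nonneg hM.le (sq_nonneg ‖q‖))
  linarith

/-- Two independent codebooks act as one codebook of sums, so bounds stated for one codebook apply
to the whole channel output. -/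
lemma mix_mix (x : ι → Fin n → ℂ) (y : κ → Fin n → ℂ) (ψ : (Fin n → ℂ) → ℝ) :
    mix x (mix y ψ) = mix (fun p : ι × κ => x p.1 + y p.2) ψ := by
  funext z
  simp only [mix_def, Fintype.sum_prod_type, Fintype.card_prod, Nat.cast_mul, ← Finset.sum_div,
    sub_sub]
  rw [div_div, mul_comm (Fintype.card κ : ℝ)]

lemma real_law_mix {ψ : (Fin n → ℂ) → ℝ} (hψ : IsTame ψ) (y : κ → Fin n → ℂ)
    {t : Set (Fin n → ℂ)} (ht : MeasurableSet t) :
    (law (mix y ψ)).real t = (∑ j, (law ψ).real {z | y j + z ∈ t}) / Fintype.card κ := by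
  have := hψ.isProbabilityMeasure
  have h : ∀ j, (law ψ).map (fun z => y j + z) t = law ψ {z | y j + z ∈ t} := fun j =>
    Measure.map_apply (by fun_prop) ht
  rw [law_mix hψ.meas fun z => (hψ.pos z).le, measureReal_def, Measure.smul_apply,
    Measure.finsetSum_apply]
  simp_rw [h]
  rw [smul_eq_mul, ENNReal.toReal_mul, ENNReal.toReal_sum fun j _ => measure_ne_top _ _]
  simp [measureReal_def, div_eq_inv_mul]

end Moments

section User

variable {ι κ : Type*} [Fintype ι] [Fintype κ] [Nonempty ι] [Nonempty κ] [DecidableEq ι]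
  [MeasurableSpace ι] [MeasurableSingletonClass ι]

/-- Genie-aided bound on twice the rate of one user: the channel output is `Y = A + U` where
`A = X + N` and `U = Y' + β N + V` for the interference `Y'` and independent Gaussian noises. -/
lemma two_mul_rate_le {x : ι → Fin n → ℂ} {y : κ → Fin n → ℂ} {P Q s v c D S : ℝ} {β h : ℂ}
    (hP : 0 ≤ P) (hQ : 0 ≤ Q) (hs : 0 < s) (hv : 0 < v) (hc : 0 ≤ c) (hhc : 0 < ‖h‖ ^ 2 * s + c)
    (h1 : ‖1 + β‖ ^ 2 * s + v = 1) (hle : ‖β‖ ^ 2 * s + v ≤ 1)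
    (hD : D = Q + (‖β‖ ^ 2 * s + v)) (hS : S = P + s - ‖β‖ ^ 2 * s ^ 2 / D)
    (hx : ∀ i, normSq (x i) ≤ n * P) (hy : ∀ j, normSq (y j) ≤ n * Q)
    {dec : (Fin n → ℂ) → ι} (hdec : Measurable dec) :
    2 * ((1 - (∑ i, ∑ j, (gaussLaw n 1).real {z | dec (x i + y j + z) ≠ i}) /
      (Fintype.card ι * Fintype.card κ)) * Real.log (Fintype.card ι) - Real.log 2) ≤
    n * (Real.log ((P + Q + 1) / (Q + 1)) + Real.log (D / s) + Real.log (S / (‖h‖ ^ 2 * S + c))) +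
      ent (mix (fun i => h • x i) (gaussDensity (‖h‖ ^ 2 * s + c))) -
      ent (mix y (gaussDensity v)) := by
  have hσ : 0 < ‖β‖ ^ 2 * s + v := by positivity
  have hD0 : 0 < D := by rw [hD]; positivity
  -- S is the variance of A given U for Gaussian inputs; the rewritten form shows its sign.
  have hS0 : 0 < S := by
    have : S = P + s * (Q + v) / D := by rw [hS, hD]; field_simp; ring
    rw [this]; positivity
  have hM : (0 : ℝ) < Fintype.card ι := by exact_mod_cast Fintype.card_pos
  have hM' : (0 : ℝ) < Fintype.card κ := by exact_mod_cast Fintype.card_pos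
  have hg1 := isTame_gaussDensity (n := n) one_pos
  have hgs := isTame_gaussDensity (n := n) hs
  have hgv := isTame_gaussDensity (n := n) hv
  have hy1 := hg1.mix y
  have hyv := hgv.mix y
  have hsh := isTame_shear β hgs hyv
  set ε := (∑ i, ∑ j, (gaussLaw n 1).real {z | dec (x i + y j + z) ≠ i}) /
      (Fintype.card ι * Fintype.card κ) with hε
  have hset : ∀ i, MeasurableSet {z | dec (x i + z) ≠ i} := fun i =>
    (hdec.comp (measurable_const_add (x i))) (measurableSet_singleton i).compl
  have hεi : (∑ i, (law (mix y (gaussDensity 1))).real {z | dec (x i + z) ≠ i}) /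
      Fintype.card ι = ε := by
    simp_rw [fun i => real_law_mix hg1 y (hset i), law_gaussDensity one_pos, ← Finset.sum_div]
    rw [hε, div_div, mul_comm (Fintype.card κ : ℝ)]
    simp only [Set.mem_ofPred_eq, add_assoc]
  -- With the genie, the decoder adds the two coordinates and ignores the rest, so its error
  -- probability is unchanged.
  have hεi' : (∑ i, (law (shear β (gaussDensity s) (mix y (gaussDensity v)))).real
      {z | dec (((x i, 0) + z).1 + ((x i, 0) + z).2) ≠ i}) / Fintype.card ι = ε := by
    rw [← hεi]
    congr 1
    refine Finset.sum_congr rfl fun i _ => ?_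
    -- The sum of the coordinates has noise (1 + β)N + V, which by `h1` has the unit variance of the
    -- channel noise.
    have hm : (law (shear β (gaussDensity s) (mix y (gaussDensity v)))).map
        (fun z => z.1 + z.2) = law (mix y (gaussDensity 1)) := by
      rw [law_shear β hgs hyv, Measure.map_map (by fun_prop) (by fun_prop), ← h1,
        ← map_prod_law (1 + β) hgs hyv (measurable_mix (measurable_gaussDensity _) _)
          (lintegral_mul_mix hs hv (1 + β) y)]
      congr 1
      funext z
      simp only [Function.comp_apply, add_smul, one_smul, add_assoc]
    rw [← hm, map_measureReal_apply (by fun_prop) (hset i)]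
    congr 1
    ext z
    simp only [Set.mem_preimage, Set.mem_ofPred_eq, Prod.fst_add, Prod.snd_add, zero_add, add_assoc]
  -- Fano's inequality without and with the genie
  have fa := fano hy1 x hdec
  have fb := fano hsh (fun i => (x i, (0 : Fin n → ℂ)))
    (dec := fun z => dec (z.1 + z.2)) (hdec.comp (by fun_prop))
  rw [hεi] at fa
  rw [hεi', ent_shear β hgs hyv, ent_gaussDensity hs] at fb
  -- entropy bounds
  have b3 : ent (mix x (mix y (gaussDensity 1))) ≤
      n * Real.log (Real.pi * (P + Q + 1)) + n := by
    rw [mix_mix]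
    refine ent_mix_le one_pos (by positivity) _ (centroid x + (1 : ℂ) • centroid y) ?_
    have := sum_normSq_centered_le hx hy 1
    simp only [one_smul, norm_one, one_pow, one_mul] at this
    simp only [Fintype.sum_prod_type, Fintype.card_prod, Nat.cast_mul, one_smul]
    linarith
  have b4 : ent (mix y (gaussDensity (‖β‖ ^ 2 * s + v))) - ent (mix y (gaussDensity 1)) ≤
      n * Real.log (D / (Q + 1)) := by
    refine ent_mix_sub_le hσ hle hD0 (by rw [hD]; ring) y (centroid y) ?_
    have h2 := sum_normSq_sub_centroid_le hy
    have h3 : (∑ j, normSq (y j - centroid y)) / Fintype.card κ ≤ n * Q := by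
      rw [div_le_iff₀ hM']; linarith
    rw [hD]
    linarith
  have b5 : ent (jointDensity x y s v β) - ent (mix y (gaussDensity (‖β‖ ^ 2 * s + v))) -
      ent (mix (fun i => h • x i) (gaussDensity (‖h‖ ^ 2 * s + c))) ≤
      n * Real.log (S / (‖h‖ ^ 2 * S + c)) := by
    -- Without excess noise C = hA, and the bound reduces to h(A | U) ≤ h(A) together with scaling.
    rcases hc.eq_or_lt with rfl | hc
    · simp only [add_zero] at hhc ⊢
      have hh : h ≠ 0 := by rintro rfl; simp at hhc
      exact ent_jointDensity_sub_le_of_eq hs hv hS0 hh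
    -- This is the linear minimum mean square error coefficient of A on U in the Gaussian model: E[A
    -- U*] = s β* and E|U|² = D. With it the prediction error is exactly S, as `t3` verifies.
    · set θ : ℂ := (s / D : ℝ) * (starRingEnd ℂ) β with hθ
      refine ent_jointDensity_sub_le hs hv hc hS0 h θ (centroid x + (-θ) • centroid y) ?_
      have h2 := sum_normSq_centered_le hx hy (-θ)
      simp only [neg_smul, ← sub_eq_add_neg, norm_neg] at h2
      simp only [neg_smul, ← sub_eq_add_neg]
      have hb : ‖β‖ ^ 2 = β.re ^ 2 + β.im ^ 2 := by
        rw [← Complex.normSq_eq_norm_sq, Complex.normSq_apply]; ring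
      have t1 : ‖θ‖ ^ 2 = (s / D) ^ 2 * ‖β‖ ^ 2 := by
        rw [hθ, norm_mul, mul_pow, RCLike.norm_conj, Complex.norm_real, Real.norm_eq_abs, sq_abs]
      have t2 : ‖1 - θ * β‖ ^ 2 = (1 - s / D * ‖β‖ ^ 2) ^ 2 := by
        have : 1 - θ * β = ((1 - s / D * ‖β‖ ^ 2 : ℝ) : ℂ) := by
          rw [hθ, mul_assoc, ← Complex.normSq_eq_conj_mul_self, Complex.normSq_eq_norm_sq]
          push_cast; ring
        rw [this, Complex.norm_real, Real.norm_eq_abs, sq_abs]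
      have t3 : P + ‖θ‖ ^ 2 * Q + (‖1 - θ * β‖ ^ 2 * s + ‖θ‖ ^ 2 * v) = S := by
        have hq : Q = D - (‖β‖ ^ 2 * s + v) := by rw [hD]; ring
        rw [t1, t2, hS, hq]
        field_simp
        ring
      have t4 : n * S = n * P + ‖θ‖ ^ 2 * (n * Q) + n * (‖1 - θ * β‖ ^ 2 * s + ‖θ‖ ^ 2 * v) := by
        rw [← t3]; ring
      linarith
  rw [jointDensity] at b5
  have q1 : Real.log ((P + Q + 1) / (Q + 1)) =
      Real.log (P + Q + 1) - Real.log (Q + 1) := Real.log_div (by positivity) (by positivity)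
  have q2 : Real.log (D / s) = Real.log D - Real.log s := Real.log_div hD0.ne' hs.ne'
  rw [Real.log_div hD0.ne' (by positivity)] at b4
  rw [Real.log_mul (by positivity) (by positivity)] at b3 fb
  rw [q1, q2]
  -- On adding the two Fano bounds, `b3` controls h(Y), `b4` absorbs -h(Y' + Z), and h(U) cancels
  -- between `b4` and `b5`. The entropies left over are those displayed in the statement.
  linarith

end User

end GIC

/-! ### From finite codes to the capacity region. -/

namespace GIC

/-- The genie-aided bound on the sum rate for a code of finite length. -/
lemma Code.rate_le {h₁₂ h₂₁ : ℂ} {P₁ P₂ : ℝ} {n M₁ M₂ : ℕ} (C : Code P₁ P₂ n M₁ M₂)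
    (hM₁ : 0 < M₁) (hM₂ : 0 < M₂) (hP₁ : 0 ≤ P₁) (hP₂ : 0 ≤ P₂)
    {s₁ s₂ v₁ v₂ D₁ D₂ S₁ S₂ : ℝ} {β₁ β₂ : ℂ}
    (hs₁ : 0 < s₁) (hs₂ : 0 < s₂) (hv₁ : 0 < v₁) (hv₂ : 0 < v₂)
    (h1₁ : ‖1 + β₁‖ ^ 2 * s₁ + v₁ = 1) (h1₂ : ‖1 + β₂‖ ^ 2 * s₂ + v₂ = 1)
    (hle₁ : ‖β₁‖ ^ 2 * s₁ + v₁ ≤ 1) (hle₂ : ‖β₂‖ ^ 2 * s₂ + v₂ ≤ 1)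
    (hc₁ : ‖h₁₂‖ ^ 2 * s₂ ≤ v₁) (hc₂ : ‖h₂₁‖ ^ 2 * s₁ ≤ v₂)
    (hD₁ : D₁ = ‖h₁₂‖ ^ 2 * P₂ + (‖β₁‖ ^ 2 * s₁ + v₁))
    (hD₂ : D₂ = ‖h₂₁‖ ^ 2 * P₁ + (‖β₂‖ ^ 2 * s₂ + v₂))
    (hS₁ : S₁ = P₁ + s₁ - ‖β₁‖ ^ 2 * s₁ ^ 2 / D₁)
    (hS₂ : S₂ = P₂ + s₂ - ‖β₂‖ ^ 2 * s₂ ^ 2 / D₂) :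
    2 * ((1 - C.error₁ h₁₂) * Real.log M₁ - Real.log 2) +
      2 * ((1 - C.error₂ h₂₁) * Real.log M₂ - Real.log 2) ≤
    n * ((Real.log ((P₁ + ‖h₁₂‖ ^ 2 * P₂ + 1) / (‖h₁₂‖ ^ 2 * P₂ + 1)) + Real.log (D₁ / s₁) +
        Real.log (S₁ / (‖h₂₁‖ ^ 2 * S₁ + (v₂ - ‖h₂₁‖ ^ 2 * s₁)))) +
      (Real.log ((P₂ + ‖h₂₁‖ ^ 2 * P₁ + 1) / (‖h₂₁‖ ^ 2 * P₁ + 1)) + Real.log (D₂ / s₂) +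
        Real.log (S₂ / (‖h₁₂‖ ^ 2 * S₂ + (v₁ - ‖h₁₂‖ ^ 2 * s₂))))) := by
  have : Nonempty (Fin M₁) := ⟨⟨0, hM₁⟩⟩
  have : Nonempty (Fin M₂) := ⟨⟨0, hM₂⟩⟩
  have px : ∀ m, normSq (C.enc₁ m) ≤ n * P₁ := C.power₁
  have py : ∀ m, normSq (C.enc₂ m) ≤ n * P₂ := C.power₂
  have px' : ∀ m, normSq (h₂₁ • C.enc₁ m) ≤ n * (‖h₂₁‖ ^ 2 * P₁) := fun m => by
    rw [normSq_smul]; nlinarith [mul_le_mul_of_nonneg_left (px m) (sq_nonneg ‖h₂₁‖)]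
  have py' : ∀ m, normSq (h₁₂ • C.enc₂ m) ≤ n * (‖h₁₂‖ ^ 2 * P₂) := fun m => by
    rw [normSq_smul]; nlinarith [mul_le_mul_of_nonneg_left (py m) (sq_nonneg ‖h₁₂‖)]
  have b1 := two_mul_rate_le (h := h₂₁) (c := v₂ - ‖h₂₁‖ ^ 2 * s₁) hP₁ (by positivity) hs₁ hv₁
    (by linarith) (by linarith) h1₁ hle₁ hD₁ hS₁ px py' C.measurable_dec₁
  have b2 := two_mul_rate_le (h := h₁₂) (c := v₁ - ‖h₁₂‖ ^ 2 * s₂) hP₂ (by positivity) hs₂ hv₂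
    (by linarith) (by linarith) h1₂ hle₂ hD₂ hS₂ py px' C.measurable_dec₂
  have e1 : (∑ i, ∑ j, (gaussLaw n 1).real {z | C.dec₁ (C.enc₁ i + h₁₂ • C.enc₂ j + z) ≠ i}) /
      (Fintype.card (Fin M₁) * Fintype.card (Fin M₂)) = C.error₁ h₁₂ := by
    simp only [Fintype.card_fin]; rfl
  have e2 : (∑ i, ∑ j, (gaussLaw n 1).real {z | C.dec₂ (C.enc₂ i + h₂₁ • C.enc₁ j + z) ≠ i}) /
      (Fintype.card (Fin M₂) * Fintype.card (Fin M₁)) = C.error₂ h₂₁ := by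
    rw [Finset.sum_comm]
    simp only [Fintype.card_fin, add_comm (C.enc₂ _)]
    rw [mul_comm (M₂ : ℝ)]; rfl
  rw [e1] at b1
  rw [e2] at b2
  -- With the excess noise included, the entropy left over with a plus sign for one user is the one
  -- with a minus sign for the other; the two pairs cancel in the sum.
  have a1 : ‖h₂₁‖ ^ 2 * s₁ + (v₂ - ‖h₂₁‖ ^ 2 * s₁) = v₂ := by ring
  have a2 : ‖h₁₂‖ ^ 2 * s₂ + (v₁ - ‖h₁₂‖ ^ 2 * s₂) = v₁ := by ring
  rw [a1] at b1
  rw [a2] at b2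
  simp only [Fintype.card_fin] at b1 b2
  linarith

/-- Asymptotic form of a finite length bound on the sum rate. -/
lemma sum_rate_le_of_forall_code {h₁₂ h₂₁ : ℂ} {P₁ P₂ K : ℝ}
    (H : ∀ (n M₁ M₂ : ℕ) (C : Code P₁ P₂ n M₁ M₂), 0 < M₁ → 0 < M₂ →
      2 * ((1 - C.error₁ h₁₂) * Real.log M₁ - Real.log 2) +
        2 * ((1 - C.error₂ h₂₁) * Real.log M₂ - Real.log 2) ≤ n * K)
    {R : ℝ × ℝ} (hR : R ∈ capacityRegion h₁₂ h₂₁ P₁ P₂) :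
    R.1 + R.2 ≤ 1 / 2 * (K / Real.log 2) := by
  have hl : 0 < Real.log 2 := Real.log_pos one_lt_two
  -- The bound is a closed condition on the rate pair, so it suffices to prove it for achievable
  -- pairs.
  have hclosed : IsClosed {R : ℝ × ℝ | R.1 + R.2 ≤ 1 / 2 * (K / Real.log 2)} :=
    isClosed_le (by fun_prop) (by fun_prop)
  refine closure_minimal ?_ hclosed hR
  rintro ⟨R₁, R₂⟩ ⟨hR₁, hR₂, C, hC₁, hC₂⟩
  simp only at hR₁ hR₂ C hC₁ hC₂
  -- The term 4 log 2 / n collects the constant log 2 of Fano's inequality, used twice for each of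
  -- two users.
  have hlim : Tendsto (fun n : ℕ => 2 * ((1 - (C n).error₁ h₁₂) * (R₁ * Real.log 2)) +
      2 * ((1 - (C n).error₂ h₂₁) * (R₂ * Real.log 2)) - 4 * Real.log 2 / (n : ℝ)) atTop
      (𝓝 (2 * ((1 - 0) * (R₁ * Real.log 2)) + 2 * ((1 - 0) * (R₂ * Real.log 2)) - 0)) := by
    refine Tendsto.sub (Tendsto.add ?_ ?_) (tendsto_const_div_atTop_nhds_zero_nat _)
    · exact ((tendsto_const_nhds.sub hC₁).mul_const _).const_mul _
    · exact ((tendsto_const_nhds.sub hC₂).mul_const _).const_mul _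
  have hpos : ∀ (n : ℕ) (r : ℝ), 0 < ⌈(2 : ℝ) ^ ((n : ℝ) * r)⌉₊ := fun n r =>
    Nat.ceil_pos.2 (by positivity)
  have hlog : ∀ (n : ℕ) (r : ℝ), n * (r * Real.log 2) ≤ Real.log ⌈(2 : ℝ) ^ ((n : ℝ) * r)⌉₊ :=
    fun n r => by
    rw [← mul_assoc, ← Real.log_rpow two_pos]
    exact Real.log_le_log (by positivity) (Nat.le_ceil _)
  have hev : ∀ᶠ n : ℕ in atTop, 2 * ((1 - (C n).error₁ h₁₂) * (R₁ * Real.log 2)) +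
      2 * ((1 - (C n).error₂ h₂₁) * (R₂ * Real.log 2)) - 4 * Real.log 2 / (n : ℝ) ≤ K := by
    -- Error probabilities below one make the factors 1 - error nonnegative, so that log M may be
    -- replaced by its lower bound n R log 2.
    filter_upwards [hC₁.eventually_lt_const one_pos, hC₂.eventually_lt_const one_pos,
      eventually_gt_atTop 0] with n h1 h2 hn
    have hn' : (0 : ℝ) < n := by exact_mod_cast hn
    have h := H n _ _ (C n) (hpos n R₁) (hpos n R₂)
    have g1 := mul_le_mul_of_nonneg_left (hlog n R₁) (sub_nonneg.2 h1.le)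
    have g2 := mul_le_mul_of_nonneg_left (hlog n R₂) (sub_nonneg.2 h2.le)
    have e : 4 * Real.log 2 / (n : ℝ) * n = 4 * Real.log 2 := by field_simp
    refine le_of_mul_le_mul_right ?_ hn'
    rw [sub_mul, e]
    linarith
  have := le_of_tendsto hlim hev
  simp only [Set.mem_ofPred_eq]
  have e : 1 / 2 * (K / Real.log 2) = K / (2 * Real.log 2) := by field_simp
  rw [e, le_div_iff₀ (by positivity)]
  linarith

end GIC

/-! ### Circular Gaussian variables: independence, entropy, conditional laws. -/

namespace GIC

variable {Ω : Type*} [MeasurableSpace Ω] {μ : Measure Ω}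

/-- A jointly Gaussian random vector whose law is invariant under multiplication by phases. -/
structure IsCircularGaussian {F : Type*} [NormedAddCommGroup F] [NormedSpace ℝ F] [NormedSpace ℂ F]
    [MeasurableSpace F] (μ : Measure Ω) (T : Ω → F) : Prop where
  meas : Measurable T
  gauss : HasGaussianLaw T μ
  rot : ∀ c : ℂ, ‖c‖ = 1 → μ.map (fun ω => c • T ω) = μ.map T

section General

variable {F G : Type*} [NormedAddCommGroup F] [NormedSpace ℝ F] [NormedSpace ℂ F]
  [IsScalarTower ℝ ℂ F] [MeasurableSpace F] [BorelSpace F] [SecondCountableTopology F]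
  [CompleteSpace F]
  [NormedAddCommGroup G] [NormedSpace ℝ G] [NormedSpace ℂ G]
  [IsScalarTower ℝ ℂ G] [MeasurableSpace G] [BorelSpace G] [SecondCountableTopology G]
  [CompleteSpace G]

set_option linter.unusedSectionVars false

lemma IsCircularGaussian.map {T : Ω → F} (hT : IsCircularGaussian μ T) (L : F →L[ℂ] G) :
    IsCircularGaussian μ (fun ω => L (T ω)) where
  meas := L.continuous.measurable.comp hT.meas
  gauss := hT.gauss.map_fun (L.restrictScalars ℝ)
  rot c hc := by
    have hL : Measurable L := L.continuous.measurable
    have h1 : (fun ω => c • L (T ω)) = L ∘ fun ω => c • T ω := by funext ω; simp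
    have h2 : (fun ω => L (T ω)) = L ∘ T := rfl
    have h3 : Measurable fun ω => c • T ω := hT.meas.const_smul c
    rw [h1, h2, ← Measure.map_map hL h3, hT.rot c hc,
      Measure.map_map hL hT.meas]

lemma IsCircularGaussian.prodMk {T : Ω → F} {S : Ω → G} (hT : IsCircularGaussian μ T)
    (hS : IsCircularGaussian μ S) (h : IndepFun T S μ) :
    IsCircularGaussian μ (fun ω => (T ω, S ω)) where
  meas := hT.meas.prodMk hS.meas
  gauss := h.hasGaussianLaw hT.gauss hS.gauss
  rot c hc := by
    have := hT.gauss.isProbabilityMeasure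
    have h' : IndepFun (fun ω => c • T ω) (fun ω => c • S ω) μ :=
      h.comp (measurable_const_smul c) (measurable_const_smul c)
    have e1 := (indepFun_iff_map_prod_eq_prod_map_map hT.meas.aemeasurable
      hS.meas.aemeasurable).1 h
    have e2 : μ.map (fun ω => (c • T ω, c • S ω)) =
        (μ.map fun ω => c • T ω).prod (μ.map fun ω => c • S ω) :=
      (indepFun_iff_map_prod_eq_prod_map_map (hT.meas.const_smul c).aemeasurable
        (hS.meas.const_smul c).aemeasurable).1 h'
    rw [hT.rot c hc, hS.rot c hc] at e2
    exact e2.trans e1.symm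

end General

lemma isGaussian_complexGaussian (v : ℝ) : IsGaussian (complexGaussian v) := by
  have h : complexGaussian v = ((gaussianReal 0 (v / 2).toNNReal).prod
      (gaussianReal 0 (v / 2).toNNReal)).map Complex.equivRealProdCLM.symm := rfl
  rw [h]
  infer_instance

lemma isCircularGaussian_of_map_eq {A : Ω → ℂ} (hA : Measurable A) {v : ℝ} (hv : 0 ≤ v)
    (h : μ.map A = complexGaussian v) : IsCircularGaussian μ A where
  meas := hA
  gauss := ⟨by rw [h]; exact isGaussian_complexGaussian v⟩
  rot c hc := by
    have : (fun ω => c • A ω) = (fun z => c * z) ∘ A := rfl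
    rw [this, ← Measure.map_map (by fun_prop) hA, h, map_mul_complexGaussian hv, hc]
    simp

lemma isCircularGaussian_of_pair {A B : Ω → ℂ} (hA : Measurable A) (hB : Measurable B)
    (h : IsCircularGaussianPair (μ.map fun ω => (A ω, B ω))) :
    IsCircularGaussian μ (fun ω => (A ω, B ω)) where
  meas := hA.prodMk hB
  gauss := ⟨h.1⟩
  rot c hc := by
    have e : (fun ω => c • (A ω, B ω)) = (fun p : ℂ × ℂ => (c * p.1, c * p.2)) ∘
        fun ω => (A ω, B ω) := rfl
    rw [e, ← Measure.map_map (by fun_prop) (hA.prodMk hB), h.2 c hc]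

lemma IsCircularGaussian.fst {A B : Ω → ℂ} (h : IsCircularGaussian μ (fun ω => (A ω, B ω))) :
    IsCircularGaussian μ A := h.map (ContinuousLinearMap.fst ℂ ℂ ℂ)

lemma IsCircularGaussian.snd {A B : Ω → ℂ} (h : IsCircularGaussian μ (fun ω => (A ω, B ω))) :
    IsCircularGaussian μ B := h.map (ContinuousLinearMap.snd ℂ ℂ ℂ)

/-- Invariance under the phase -1 makes the mean equal to its own negative. -/
lemma IsCircularGaussian.integral_eq_zero {A : Ω → ℂ} (h : IsCircularGaussian μ A) :
    ∫ ω, A ω ∂μ = 0 := by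
  have h1 : ∫ z, z ∂μ.map (fun ω => (-1 : ℂ) • A ω) = ∫ z, z ∂μ.map A := by
    rw [h.rot (-1) (by simp)]
  have hm : Measurable fun ω => (-1 : ℂ) • A ω := h.meas.const_smul (-1 : ℂ)
  rw [integral_map hm.aemeasurable (by fun_prop),
    integral_map h.meas.aemeasurable (by fun_prop)] at h1
  simp only [neg_smul, one_smul, integral_neg] at h1
  exact self_eq_neg.1 h1.symm

/-- The phase i multiplies the product AB by -1. With the pseudo-covariance gone, E[A B*] carries
all second-order information. -/
lemma IsCircularGaussian.integral_mul_eq_zero {A B : Ω → ℂ}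
    (h : IsCircularGaussian μ (fun ω => (A ω, B ω))) : ∫ ω, A ω * B ω ∂μ = 0 := by
  have h1 : ∫ z : ℂ × ℂ, z.1 * z.2 ∂μ.map (fun ω => Complex.I • (A ω, B ω)) =
      ∫ z : ℂ × ℂ, z.1 * z.2 ∂μ.map (fun ω => (A ω, B ω)) := by
    rw [h.rot Complex.I (by simp)]
  have hm : Measurable fun ω => Complex.I • (A ω, B ω) := h.meas.const_smul Complex.I
  rw [integral_map hm.aemeasurable (by fun_prop),
    integral_map h.meas.aemeasurable (by fun_prop)] at h1
  have e : ∀ ω, Complex.I * A ω * (Complex.I * B ω) = -(A ω * B ω) := fun ω => by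
    linear_combination A ω * B ω * Complex.I_mul_I
  simp only [Prod.smul_mk, smul_eq_mul, e, integral_neg] at h1
  exact self_eq_neg.1 h1.symm

lemma IsCircularGaussian.memLp {A : Ω → ℂ} (h : IsCircularGaussian μ A) : MemLp A 2 μ :=
  h.gauss.memLp_two

lemma memLp_conj {A : Ω → ℂ} (h : MemLp A 2 μ) :
    MemLp (fun ω => (starRingEnd ℂ) (A ω)) 2 μ :=
  h.congr_norm (Complex.continuous_conj.comp_aestronglyMeasurable h.1)
    (ae_of_all _ fun ω => by simp)

/-- The real and imaginary correlations of a circular pair are determined by `E[A B*]`. -/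
lemma IsCircularGaussian.integral_inner_mul_inner {A B : Ω → ℂ}
    (h : IsCircularGaussian μ (fun ω => (A ω, B ω))) (x y : ℂ) :
    ∫ ω, inner ℝ x (A ω) * inner ℝ y (B ω) ∂μ =
      ((starRingEnd ℂ) x * y * ∫ ω, A ω * (starRingEnd ℂ) (B ω) ∂μ).re / 2 := by
  have i1 : Integrable (fun ω => (starRingEnd ℂ) x * y * (A ω * (starRingEnd ℂ) (B ω))) μ :=
    (h.fst.memLp.integrable_mul (memLp_conj h.snd.memLp)).const_mul _
  have i2 : Integrable (fun ω => (starRingEnd ℂ) x * (starRingEnd ℂ) y * (A ω * B ω)) μ :=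
    (h.fst.memLp.integrable_mul h.snd.memLp).const_mul _
  have e : ∀ ω, inner ℝ x (A ω) * inner ℝ y (B ω) =
      (((starRingEnd ℂ) x * y * (A ω * (starRingEnd ℂ) (B ω))).re +
        ((starRingEnd ℂ) x * (starRingEnd ℂ) y * (A ω * B ω)).re) / 2 := fun ω => by
    simp only [Complex.inner, Complex.mul_re, Complex.mul_im, Complex.conj_re, Complex.conj_im]
    ring
  simp_rw [e]
  have j1 : Integrable (fun ω =>
      ((starRingEnd ℂ) x * y * (A ω * (starRingEnd ℂ) (B ω))).re) μ := i1.re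
  have j2 : Integrable (fun ω =>
      ((starRingEnd ℂ) x * (starRingEnd ℂ) y * (A ω * B ω)).re) μ := i2.re
  rw [integral_div, integral_add j1 j2]
  have r1 := integral_re i1
  have r2 := integral_re i2
  simp only [RCLike.re_eq_complex_re] at r1 r2
  rw [r1, r2, integral_const_mul, integral_const_mul, h.integral_mul_eq_zero]
  simp

lemma IsCircularGaussian.integral_inner_eq_zero {A : Ω → ℂ} (h : IsCircularGaussian μ A) (x : ℂ) :
    ∫ ω, inner ℝ x (A ω) ∂μ = 0 := by
  rw [integral_inner h.gauss.integrable, h.integral_eq_zero, inner_zero_right]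

lemma IsCircularGaussian.memLp_inner {A : Ω → ℂ} (h : IsCircularGaussian μ A) (x : ℂ) :
    MemLp (fun ω => inner ℝ x (A ω)) 2 μ := h.memLp.const_inner x

/-- Uncorrelated jointly circular Gaussian variables are independent. -/
lemma IsCircularGaussian.indepFun {A B : Ω → ℂ} (h : IsCircularGaussian μ (fun ω => (A ω, B ω)))
    (h0 : ∫ ω, A ω * (starRingEnd ℂ) (B ω) ∂μ = 0) : IndepFun A B μ := by
  have := h.gauss.isProbabilityMeasure
  refine h.gauss.indepFun_of_covariance_inner fun x y => ?_
  rw [covariance_eq_sub (h.fst.memLp_inner x) (h.snd.memLp_inner y),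
    h.fst.integral_inner_eq_zero, zero_mul, sub_zero]
  have := h.integral_inner_mul_inner x y
  rw [h0] at this
  simpa using this

/-- A circular Gaussian variable is `CN(0, v)`. -/
lemma IsCircularGaussian.map_eq {A : Ω → ℂ} (h : IsCircularGaussian μ A) {v : ℝ} (hv : 0 ≤ v)
    (hA : ∫ ω, A ω * (starRingEnd ℂ) (A ω) ∂μ = v) : μ.map A = complexGaussian v := by
  have := h.gauss.isProbabilityMeasure
  have : IsProbabilityMeasure (μ.map A) := Measure.isProbabilityMeasure_map h.meas.aemeasurable
  have hAA : IsCircularGaussian μ (fun ω => (A ω, A ω)) :=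
    h.map ((ContinuousLinearMap.id ℂ ℂ).prod (ContinuousLinearMap.id ℂ ℂ))
  refine Measure.ext_of_charFun ?_
  funext t
  have h2 := hAA.integral_inner_mul_inner t t
  rw [hA] at h2
  rw [charFun_complexGaussian hv, h.gauss.charFun_map_eq,
    variance_eq_sub (h.memLp_inner t), h.integral_inner_eq_zero]
  have e : ∫ ω, ((fun ω => inner ℝ t (A ω)) ^ 2) ω ∂μ = v * ‖t‖ ^ 2 / 2 := by
    rw [← Complex.normSq_eq_conj_mul_self, Complex.normSq_eq_norm_sq, ← Complex.ofReal_mul,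
      Complex.ofReal_re, mul_comm] at h2
    rw [← h2]
    simp only [Pi.pow_apply, pow_two]
  rw [e]
  congr 1
  push_cast
  ring

/-- The logarithm of the density is quadratic, so the second moment v gives one extra nat, the
factor e. The translation c is kept because conditional laws are translated Gaussians. -/
lemma entropyOfLaw_complexGaussian_map {v : ℝ} (hv : 0 < v) (c : ℂ) :
    entropyOfLaw ((complexGaussian v).map (fun z => c + z)) =
      Real.logb 2 (Real.pi * Real.exp 1 * v) := by
  set φ : ℂ → ℝ := fun z => (Real.pi * v)⁻¹ * Real.exp (-(‖z‖ ^ 2) / v) with hφ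
  have hφ0 : ∀ z, 0 < φ z := fun z => by simp only [hφ]; positivity
  have hφm : Measurable φ := by simp only [hφ]; fun_prop
  have hmap : (complexGaussian v).map (fun z => c + z) =
      volume.withDensity (fun z => ENNReal.ofReal (φ (z - c))) := by
    refine Measure.ext_of_lintegral _ fun G hG => ?_
    rw [lintegral_map hG (by fun_prop), complexGaussian_eq_withDensity hv,
      lintegral_withDensity_eq_lintegral_mul _ (by fun_prop) (by fun_prop),
      lintegral_withDensity_eq_lintegral_mul _ (by fun_prop) hG,
      ← lintegral_sub_right_eq_self _ c]
    simp [hφ]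
  unfold entropyOfLaw
  rw [hmap]
  have hae := Measure.rnDeriv_withDensity (volume : Measure ℂ)
    (f := fun z => ENNReal.ofReal (φ (z - c))) (by fun_prop)
  have h1 : ∫ z, ((volume.withDensity (fun z => ENNReal.ofReal (φ (z - c)))).rnDeriv volume
      z).toReal * Real.logb 2 ((volume.withDensity (fun z => ENNReal.ofReal (φ (z - c)))).rnDeriv
      volume z).toReal = ∫ z, φ (z - c) * Real.logb 2 (φ (z - c)) := by
    refine integral_congr_ae ?_
    filter_upwards [hae] with z hz
    rw [hz, ENNReal.toReal_ofReal (hφ0 _).le]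
  rw [h1, integral_sub_right_eq_self (fun z => φ z * Real.logb 2 (φ z)) c]
  have h2 : ∫ z, φ z * Real.logb 2 (φ z) = ∫ z, Real.logb 2 (φ z) ∂complexGaussian v := by
    rw [complexGaussian_eq_withDensity hv, integral_withDensity_eq_integral_toReal_smul
      (by fun_prop) (ae_of_all _ fun z => ENNReal.ofReal_lt_top)]
    refine integral_congr_ae (ae_of_all _ fun z => ?_)
    simp only [smul_eq_mul]
    rw [ENNReal.toReal_ofReal (by positivity)]
  rw [h2]
  have h3 : ∀ z, Real.logb 2 (φ z) =
      -(Real.log (Real.pi * v) / Real.log 2) - ‖z‖ ^ 2 / (v * Real.log 2) := fun z => by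
    have hpv : 0 < Real.pi * v := by positivity
    simp only [hφ, Real.logb]
    rw [Real.log_mul (inv_pos.2 hpv).ne' (Real.exp_pos _).ne', Real.log_exp, Real.log_inv]
    field_simp
    ring
  simp_rw [h3]
  rw [integral_sub (integrable_const _) ((memLp_complexGaussian v).norm.integrable_sq.div_const _),
    integral_div, integral_norm_sq_complexGaussian hv.le, Real.logb,
    mul_right_comm, Real.log_mul (by positivity) (Real.exp_pos _).ne', Real.log_exp]
  have : Real.log 2 ≠ 0 := (Real.log_pos one_lt_two).ne'
  simp
  field_simp
  ring

lemma varianceOfLaw_complexGaussian_map {v : ℝ} (hv : 0 ≤ v) (c : ℂ) :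
    varianceOfLaw ((complexGaussian v).map (fun z => c + z)) = v := by
  have hint : Integrable (fun z : ℂ => z) (complexGaussian v) :=
    (memLp_complexGaussian v).integrable (by norm_num)
  have hm : ∫ w, w ∂(complexGaussian v).map (fun z => c + z) = c := by
    rw [integral_map (by fun_prop) (by fun_prop), integral_add (integrable_const _) hint,
      integral_id_complexGaussian]
    simp
  unfold varianceOfLaw
  rw [hm, integral_map (by fun_prop) (by fun_prop)]
  simp only [add_sub_cancel_left]
  exact integral_norm_sq_complexGaussian hv

lemma IsCircularGaussian.entropy_eq {A : Ω → ℂ} (h : IsCircularGaussian μ A) {v : ℝ} (hv : 0 < v)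
    (hA : ∫ ω, A ω * (starRingEnd ℂ) (A ω) ∂μ = v) :
    entropy μ A = Real.logb 2 (Real.pi * Real.exp 1 * v) := by
  rw [entropy, h.map_eq hv.le hA, ← entropyOfLaw_complexGaussian_map hv 0]
  simp

lemma IsCircularGaussian.variance_eq {A : Ω → ℂ} (h : IsCircularGaussian μ A) {v : ℝ} (hv : 0 ≤ v)
    (hA : ∫ ω, A ω * (starRingEnd ℂ) (A ω) ∂μ = v) : GIC.variance μ A = v := by
  rw [GIC.variance, h.map_eq hv hA]
  have := varianceOfLaw_complexGaussian_map hv 0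
  simpa using this

/-- The conditional law of `A = κ B + R` given `B`, for a Gaussian `R` independent of `B`. -/
lemma condDistrib_ae_eq [IsProbabilityMeasure μ] {A B : Ω → ℂ} (hA : Measurable A)
    (hB : Measurable B) (κ : ℂ) {v : ℝ} (hi : IndepFun (fun ω => A ω - κ * B ω) B μ)
    (hl : μ.map (fun ω => A ω - κ * B ω) = complexGaussian v) :
    ∀ᵐ b ∂μ.map B, condDistrib A B μ b = (complexGaussian v).map (fun z => κ * b + z) := by
  have hf : Measurable fun p : ℂ × ℂ => κ * p.1 + p.2 := by fun_prop
  let k : Kernel ℂ ℂ := (Kernel.id ×ₖ Kernel.const ℂ (complexGaussian v)).map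
    (fun p : ℂ × ℂ => κ * p.1 + p.2)
  have hk : ∀ b, k b = (complexGaussian v).map (fun z => κ * b + z) := fun b => by
    simp only [k]
    rw [Kernel.map_apply _ hf, Kernel.prod_apply, Kernel.id_apply, Kernel.const_apply,
      Measure.dirac_prod, Measure.map_map hf (by fun_prop)]
    rfl
  have : IsMarkovKernel k := Kernel.IsMarkovKernel.map _ hf
  have hR : Measurable fun ω => A ω - κ * B ω := by fun_prop
  have hprod : μ.map (fun ω => (B ω, A ω - κ * B ω)) = (μ.map B).prod (complexGaussian v) := by
    rw [(indepFun_iff_map_prod_eq_prod_map_map hB.aemeasurable hR.aemeasurable).1 hi.symm, hl]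
  have key : μ.map (fun ω => (B ω, A ω)) = μ.map B ⊗ₘ k := by
    have : IsProbabilityMeasure (μ.map B) := Measure.isProbabilityMeasure_map hB.aemeasurable
    refine Measure.ext_of_lintegral _ fun G hG => ?_
    rw [Measure.lintegral_compProd hG]
    have e1 : (fun ω => (B ω, A ω)) =
        (fun p : ℂ × ℂ => (p.1, κ * p.1 + p.2)) ∘ fun ω => (B ω, A ω - κ * B ω) := by
      funext ω; simp
    rw [e1, ← Measure.map_map (by fun_prop) (hB.prodMk hR), hprod, lintegral_map hG (by fun_prop),
      lintegral_prod _ (by fun_prop)]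
    refine lintegral_congr fun b => ?_
    rw [hk, lintegral_map (by fun_prop) (by fun_prop)]
  filter_upwards [condDistrib_ae_eq_of_measure_eq_compProd_of_measurable hB hA key] with b hb
  rw [hb, hk]

/-- The residual A - κB is uncorrelated with B, hence independent of it. All conditional laws are
then translates of one Gaussian, and the average over B is that of a constant. -/
lemma condEntropy_eq [IsProbabilityMeasure μ] {A B : Ω → ℂ} (hA : Measurable A) (κ : ℂ)
    (h : IsCircularGaussian μ (fun ω => (A ω - κ * B ω, B ω)))
    (h0 : ∫ ω, (A ω - κ * B ω) * (starRingEnd ℂ) (B ω) ∂μ = 0) {v : ℝ} (hv : 0 < v)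
    (hR : ∫ ω, (A ω - κ * B ω) * (starRingEnd ℂ) (A ω - κ * B ω) ∂μ = v) :
    condEntropy μ A B = Real.logb 2 (Real.pi * Real.exp 1 * v) := by
  have hB : Measurable B := h.snd.meas
  have : IsProbabilityMeasure (μ.map B) := Measure.isProbabilityMeasure_map hB.aemeasurable
  have hae := condDistrib_ae_eq hA hB κ (h.indepFun h0) (h.fst.map_eq hv.le hR)
  have e : ∫ t, entropyOfLaw (condDistrib A B μ t) ∂(μ.map B) =
      ∫ _t, Real.logb 2 (Real.pi * Real.exp 1 * v) ∂(μ.map B) := by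
    refine integral_congr_ae ?_
    filter_upwards [hae] with b hb
    rw [hb, entropyOfLaw_complexGaussian_map hv]
  rw [condEntropy, e]
  simp

lemma condVariance_eq [IsProbabilityMeasure μ] {A B : Ω → ℂ} (hA : Measurable A) (κ : ℂ)
    (h : IsCircularGaussian μ (fun ω => (A ω - κ * B ω, B ω)))
    (h0 : ∫ ω, (A ω - κ * B ω) * (starRingEnd ℂ) (B ω) ∂μ = 0) {v : ℝ} (hv : 0 ≤ v)
    (hR : ∫ ω, (A ω - κ * B ω) * (starRingEnd ℂ) (A ω - κ * B ω) ∂μ = v) :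
    condVariance μ A B = v := by
  have hB : Measurable B := h.snd.meas
  have : IsProbabilityMeasure (μ.map B) := Measure.isProbabilityMeasure_map hB.aemeasurable
  have hae := condDistrib_ae_eq hA hB κ (h.indepFun h0) (h.fst.map_eq hv hR)
  have e : ∫ t, varianceOfLaw (condDistrib A B μ t) ∂(μ.map B) = ∫ _t, v ∂(μ.map B) := by
    refine integral_congr_ae ?_
    filter_upwards [hae] with b hb
    rw [hb, varianceOfLaw_complexGaussian_map hv]
  rw [condVariance, e]
  simp

end GIC

/-! ### Linear combinations of a circular Gaussian vector, and independence. -/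

namespace GIC

section LinearCombinations

set_option linter.unusedSectionVars false

variable {Ω ι : Type*} [MeasurableSpace Ω] {μ : Measure Ω} [Fintype ι]

/-- The linear combination of the components of a random vector with coefficients `a`. -/
def linComb (G : ι → Ω → ℂ) (a : ι → ℂ) (ω : Ω) : ℂ := ∑ i, a i * G i ω

lemma linComb_sub (G : ι → Ω → ℂ) (a b : ι → ℂ) (κ : ℂ) (ω : Ω) :
    linComb G a ω - κ * linComb G b ω = linComb G (a - κ • b) ω := by
  simp [linComb, Finset.mul_sum, ← Finset.sum_sub_distrib, sub_mul, mul_assoc]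

variable {G : ι → Ω → ℂ}

lemma IsCircularGaussian.linComb_pair (hG : IsCircularGaussian μ fun ω i => G i ω)
    (a b : ι → ℂ) : IsCircularGaussian μ fun ω => (linComb G a ω, linComb G b ω) := by
  have h := hG.map ((∑ i, a i • ContinuousLinearMap.proj (R := ℂ) (φ := fun _ : ι => ℂ) i).prod
    (∑ i, b i • ContinuousLinearMap.proj (R := ℂ) (φ := fun _ : ι => ℂ) i))
  simpa [linComb] using h

lemma IsCircularGaussian.component (hG : IsCircularGaussian μ fun ω i => G i ω) (i : ι) :
    IsCircularGaussian μ (G i) :=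
  hG.map (ContinuousLinearMap.proj (R := ℂ) (φ := fun _ : ι => ℂ) i)

/-- The second-order form attached to the covariance matrix `M`. -/
def covForm (M : ι → ι → ℂ) (a b : ι → ℂ) : ℂ :=
  ∑ i, ∑ j, a i * (starRingEnd ℂ) (b j) * M i j

variable {M : ι → ι → ℂ}

lemma integral_linComb_mul_conj (hG : IsCircularGaussian μ fun ω i => G i ω)
    (hM : ∀ i j, ∫ ω, G i ω * (starRingEnd ℂ) (G j ω) ∂μ = M i j) (a b : ι → ℂ) :
    ∫ ω, linComb G a ω * (starRingEnd ℂ) (linComb G b ω) ∂μ = covForm M a b := by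
  have e : ∀ ω, linComb G a ω * (starRingEnd ℂ) (linComb G b ω) =
      ∑ i, ∑ j, a i * (starRingEnd ℂ) (b j) * (G i ω * (starRingEnd ℂ) (G j ω)) := fun ω => by
    simp only [linComb, map_sum, map_mul, Finset.sum_mul_sum]
    exact Finset.sum_congr rfl fun i _ => Finset.sum_congr rfl fun j _ => by ring
  have hi : ∀ i j, Integrable (fun ω =>
      a i * (starRingEnd ℂ) (b j) * (G i ω * (starRingEnd ℂ) (G j ω))) μ := fun i j =>
    ((hG.component i).memLp.integrable_mul (memLp_conj (hG.component j).memLp)).const_mul _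
  simp_rw [e]
  rw [integral_finsetSum _ fun i _ => integrable_finsetSum _ fun j _ => hi i j, covForm]
  refine Finset.sum_congr rfl fun i _ => ?_
  rw [integral_finsetSum _ fun j _ => hi i j]
  refine Finset.sum_congr rfl fun j _ => ?_
  rw [integral_const_mul, hM]

lemma covForm_sub_left (a b c : ι → ℂ) (κ : ℂ) :
    covForm M (a - κ • b) c = covForm M a c - κ * covForm M b c := by
  simp only [covForm, Finset.mul_sum, ← Finset.sum_sub_distrib]
  refine Finset.sum_congr rfl fun i _ => Finset.sum_congr rfl fun j _ => ?_
  simp only [Pi.sub_apply, Pi.smul_apply, smul_eq_mul]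
  ring

lemma covForm_sub_right (a b c : ι → ℂ) (κ : ℂ) :
    covForm M c (a - κ • b) = covForm M c a - (starRingEnd ℂ) κ * covForm M c b := by
  simp only [covForm, Finset.mul_sum, ← Finset.sum_sub_distrib]
  refine Finset.sum_congr rfl fun i _ => Finset.sum_congr rfl fun j _ => ?_
  simp only [Pi.sub_apply, Pi.smul_apply, smul_eq_mul, map_sub, map_mul]
  ring

/-- The residual of the linear regression of `a` on `b` has second moment `A - |κ|² D`. -/
lemma covForm_residual {a b : ι → ℂ} {κ : ℂ} {A D : ℝ} (haa : covForm M a a = A)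
    (hab : covForm M a b = κ * D) (hba : covForm M b a = (starRingEnd ℂ) κ * D)
    (hbb : covForm M b b = D) :
    covForm M (a - κ • b) b = 0 ∧
      covForm M (a - κ • b) (a - κ • b) = ((A - ‖κ‖ ^ 2 * D : ℝ) : ℂ) := by
  have h0 : covForm M (a - κ • b) b = 0 := by rw [covForm_sub_left, hab, hbb, sub_self]
  refine ⟨h0, ?_⟩
  rw [covForm_sub_right, h0, covForm_sub_left, haa, hba]
  push_cast
  rw [← Complex.mul_conj']
  ring

lemma covForm_self_nonneg (hG : IsCircularGaussian μ fun ω i => G i ω)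
    (hM : ∀ i j, ∫ ω, G i ω * (starRingEnd ℂ) (G j ω) ∂μ = M i j) {a : ι → ℂ} {A : ℝ}
    (haa : covForm M a a = A) : 0 ≤ A := by
  have hint := integral_linComb_mul_conj hG hM a a
  have e : ∀ ω, linComb G a ω * (starRingEnd ℂ) (linComb G a ω) =
      ((‖linComb G a ω‖ ^ 2 : ℝ) : ℂ) := fun ω => by
    rw [Complex.mul_conj']; push_cast; rfl
  simp_rw [e] at hint
  rw [haa, integral_complex_ofReal, Complex.ofReal_inj] at hint
  rw [← hint]
  exact integral_nonneg fun ω => by positivity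

lemma entropy_linComb (hG : IsCircularGaussian μ fun ω i => G i ω)
    (hM : ∀ i j, ∫ ω, G i ω * (starRingEnd ℂ) (G j ω) ∂μ = M i j) {a : ι → ℂ} {A : ℝ}
    (hA : 0 < A) (haa : covForm M a a = A) {T : Ω → ℂ} (hT : T = linComb G a) :
    entropy μ T = Real.logb 2 (Real.pi * Real.exp 1 * A) :=
  hT ▸ (hG.linComb_pair a a).fst.entropy_eq hA ((integral_linComb_mul_conj hG hM a a).trans haa)

lemma variance_linComb (hG : IsCircularGaussian μ fun ω i => G i ω)
    (hM : ∀ i j, ∫ ω, G i ω * (starRingEnd ℂ) (G j ω) ∂μ = M i j) {a : ι → ℂ} {A : ℝ}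
    (haa : covForm M a a = A) {T : Ω → ℂ} (hT : T = linComb G a) : GIC.variance μ T = A :=
  hT ▸ (hG.linComb_pair a a).fst.variance_eq (covForm_self_nonneg hG hM haa) ((integral_linComb_mul_conj hG hM a a).trans haa)

lemma condEntropy_linComb [IsProbabilityMeasure μ] (hG : IsCircularGaussian μ fun ω i => G i ω)
    (hM : ∀ i j, ∫ ω, G i ω * (starRingEnd ℂ) (G j ω) ∂μ = M i j) {a b : ι → ℂ} {κ : ℂ}
    {A D : ℝ} (haa : covForm M a a = A) (hab : covForm M a b = κ * D)
    (hba : covForm M b a = (starRingEnd ℂ) κ * D) (hbb : covForm M b b = D)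
    (hpos : 0 < A - ‖κ‖ ^ 2 * D) {T S : Ω → ℂ} (hT : T = linComb G a) (hS : S = linComb G b) :
    condEntropy μ T S = Real.logb 2 (Real.pi * Real.exp 1 * (A - ‖κ‖ ^ 2 * D)) := by
  rw [hT, hS]
  obtain ⟨h0, h1⟩ := covForm_residual haa hab hba hbb
  refine condEntropy_eq (hG.linComb_pair a a).fst.meas κ ?_ ?_ hpos ?_
  · simp only [linComb_sub]
    exact hG.linComb_pair _ _
  · simp only [linComb_sub]
    rw [integral_linComb_mul_conj hG hM, h0]
  · simp only [linComb_sub]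
    rw [integral_linComb_mul_conj hG hM, h1]

lemma condVariance_linComb [IsProbabilityMeasure μ] (hG : IsCircularGaussian μ fun ω i => G i ω)
    (hM : ∀ i j, ∫ ω, G i ω * (starRingEnd ℂ) (G j ω) ∂μ = M i j) {a b : ι → ℂ} {κ : ℂ}
    {A D : ℝ} (haa : covForm M a a = A) (hab : covForm M a b = κ * D)
    (hba : covForm M b a = (starRingEnd ℂ) κ * D) (hbb : covForm M b b = D)
    {T S : Ω → ℂ} (hT : T = linComb G a) (hS : S = linComb G b) :
    condVariance μ T S = A - ‖κ‖ ^ 2 * D := by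
  rw [hT, hS]
  obtain ⟨h0, h1⟩ := covForm_residual haa hab hba hbb
  refine condVariance_eq (hG.linComb_pair a a).fst.meas κ ?_ ?_ (covForm_self_nonneg hG hM h1) ?_
  · simp only [linComb_sub]
    exact hG.linComb_pair _ _
  · simp only [linComb_sub]
    rw [integral_linComb_mul_conj hG hM, h0]
  · simp only [linComb_sub]
    rw [integral_linComb_mul_conj hG hM, h1]

end LinearCombinations

section Independence

variable {Ω : Type*} [mΩ : MeasurableSpace Ω] {μ : Measure Ω}

/-- Mutual independence is unfolded into a chain, each variable being independent of the tuple of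
later ones; this is the form in which a joint Gaussian vector is built up one block at a time. -/
lemma indepFun_chain_of_iIndep {X X' V : Ω → ℂ} {N : Ω → ℂ × ℂ} (hX : Measurable X)
    (hX' : Measurable X') (hN : Measurable N) (hV : Measurable V)
    (h : iIndep ![MeasurableSpace.comap X inferInstance, MeasurableSpace.comap X' inferInstance,
      MeasurableSpace.comap N inferInstance, MeasurableSpace.comap V inferInstance] μ) :
    IndepFun X (fun ω => (X' ω, N ω, V ω)) μ ∧ IndepFun X' (fun ω => (N ω, V ω)) μ ∧
      IndepFun N V μ := by
  set m := ![MeasurableSpace.comap X inferInstance, MeasurableSpace.comap X' inferInstance,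
      MeasurableSpace.comap N inferInstance, MeasurableSpace.comap V inferInstance] with hm
  have hle : ∀ i, m i ≤ mΩ := by
    intro i
    fin_cases i
    exacts [hX.comap_le, hX'.comap_le, hN.comap_le, hV.comap_le]
  have key : ∀ (i : Fin 4) (T : Set (Fin 4)), i ∉ T → Indep (m i) (⨆ j ∈ T, m j) μ := by
    intro i T hi
    have := indep_iSup_of_disjoint hle h (Set.disjoint_singleton_left.2 hi)
    simpa using this
  have hmem : ∀ (j : Fin 4) (T : Set (Fin 4)), j ∈ T → m j ≤ ⨆ j ∈ T, m j := fun j T hj =>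
    le_iSup₂_of_le j hj le_rfl
  refine ⟨?_, ?_, ?_⟩
  · refine indep_of_indep_of_le_right (key 0 {1, 2, 3} (by simp)) ?_
    have h1 := hmem 1 {1, 2, 3} (by simp)
    have h2 := hmem 2 {1, 2, 3} (by simp)
    have h3 := hmem 3 {1, 2, 3} (by simp)
    exact (MeasurableSpace.comap_prodMk _ _).trans_le
      (sup_le h1 ((MeasurableSpace.comap_prodMk _ _).trans_le (sup_le h2 h3)))
  · refine indep_of_indep_of_le_right (key 1 {2, 3} (by simp)) ?_
    have h2 := hmem 2 {2, 3} (by simp)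
    have h3 := hmem 3 {2, 3} (by simp)
    exact (MeasurableSpace.comap_prodMk _ _).trans_le (sup_le h2 h3)
  · exact indep_of_indep_of_le_right (key 2 {3} (by simp)) (hmem 3 {3} (by simp))

lemma iIndep_swap_zero_one {m₀ m₁ m₂ m₃ : MeasurableSpace Ω} (h : iIndep ![m₀, m₁, m₂, m₃] μ) :
    iIndep ![m₁, m₀, m₂, m₃] μ := by
  have := h.precomp (Equiv.swap (0 : Fin 4) 1).injective
  convert this using 1
  funext i
  fin_cases i <;> rfl

lemma IsCircularGaussian.integral_mul_conj_eq_zero {A B : Ω → ℂ} (hA : IsCircularGaussian μ A)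
    (hB : IsCircularGaussian μ B) (h : IndepFun A B μ) :
    ∫ ω, A ω * (starRingEnd ℂ) (B ω) ∂μ = 0 := by
  have hc : IndepFun A (fun ω => (starRingEnd ℂ) (B ω)) μ :=
    h.comp measurable_id Complex.continuous_conj.measurable
  rw [hc.integral_fun_mul_eq_mul_integral hA.memLp.1 (memLp_conj hB.memLp).1,
    hA.integral_eq_zero, zero_mul]

lemma integral_mul_conj_symm (A B : Ω → ℂ) :
    ∫ ω, B ω * (starRingEnd ℂ) (A ω) ∂μ =
      (starRingEnd ℂ) (∫ ω, A ω * (starRingEnd ℂ) (B ω) ∂μ) := by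
  rw [← integral_conj]
  simp [mul_comm]

lemma integral_mul_conj_self_of_map_eq {A : Ω → ℂ} (hA : Measurable A) {v : ℝ} (hv : 0 ≤ v)
    (h : μ.map A = complexGaussian v) : ∫ ω, A ω * (starRingEnd ℂ) (A ω) ∂μ = v := by
  have e : ∀ ω, A ω * (starRingEnd ℂ) (A ω) = ((‖A ω‖ ^ 2 : ℝ) : ℂ) := fun ω => by
    rw [Complex.mul_conj']; push_cast; rfl
  simp_rw [e]
  rw [integral_complex_ofReal, ← integral_norm_sq_complexGaussian hv, ← h,
    integral_map hA.aemeasurable (by fun_prop)]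

end Independence

end GIC

/-! ### The entropies seen by one receiver. -/

namespace GIC

variable {Ω : Type*} [MeasurableSpace Ω] {μ : Measure Ω}

/-- The covariance matrix of `(X, X', Z, W, V)`. -/
def covMatrix (P P' τ v' : ℝ) (r : ℂ) : Fin 5 → Fin 5 → ℂ :=
  ![![(P : ℂ), 0, 0, 0, 0], ![0, (P' : ℂ), 0, 0, 0], ![0, 0, 1, r, 0],
    ![0, 0, (starRingEnd ℂ) r, (τ : ℂ), 0], ![0, 0, 0, 0, (v' : ℂ)]]

/-- The variables seen by one receiver: both inputs, channel and genie noise, auxiliary noise. -/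
structure IsGaussianModel (μ : Measure Ω) (X X' Z W V : Ω → ℂ) (P P' τ v' : ℝ) (r : ℂ) :
    Prop where
  circ : IsCircularGaussian μ fun ω i => ![X, X', Z, W, V] i ω
  cov : ∀ i j, ∫ ω, ![X, X', Z, W, V] i ω * (starRingEnd ℂ) (![X, X', Z, W, V] j ω) ∂μ =
    covMatrix P P' τ v' r i j

/-- The correlated pair (Z, W) enters as a single independent block, and joint circularity of that
block supplies what independence cannot. -/
lemma isGaussianModel {X X' Z W V : Ω → ℂ} {P P' τ v' : ℝ} {r : ℂ}
    (mX : Measurable X) (mX' : Measurable X') (mZ : Measurable Z) (mW : Measurable W)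
    (mV : Measurable V) (hP : 0 ≤ P) (hP' : 0 ≤ P') (hτ : 0 ≤ τ) (hv' : 0 ≤ v')
    (lX : μ.map X = complexGaussian P) (lX' : μ.map X' = complexGaussian P')
    (lZ : μ.map Z = complexGaussian 1) (lW : μ.map W = complexGaussian τ)
    (lV : μ.map V = complexGaussian v')
    (joint : IsCircularGaussianPair (μ.map fun ω => (Z ω, W ω)))
    (corr : ∫ ω, Z ω * (starRingEnd ℂ) (W ω) ∂μ = r)
    (indep : iIndep ![MeasurableSpace.comap X inferInstance,
      MeasurableSpace.comap X' inferInstance,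
      MeasurableSpace.comap (fun ω => (Z ω, W ω)) inferInstance,
      MeasurableSpace.comap V inferInstance] μ) :
    IsGaussianModel μ X X' Z W V P P' τ v' r := by
  obtain ⟨i1, i2, i3⟩ := indepFun_chain_of_iIndep mX mX' (mZ.prodMk mW) mV indep
  have cX := isCircularGaussian_of_map_eq mX hP lX
  have cX' := isCircularGaussian_of_map_eq mX' hP' lX'
  have cV := isCircularGaussian_of_map_eq mV hv' lV
  have cN := isCircularGaussian_of_pair mZ mW joint
  have cZ := cN.fst
  have cW := cN.snd
  have hT := cX.prodMk (cX'.prodMk (cN.prodMk cV i3) i2) i1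
  have z1 := cX.integral_mul_conj_eq_zero cX' (i1.comp measurable_id measurable_fst)
  have z2 := cX.integral_mul_conj_eq_zero cZ
    (i1.comp (ψ := fun p : ℂ × (ℂ × ℂ) × ℂ => p.2.1.1) measurable_id (by fun_prop))
  have z3 := cX.integral_mul_conj_eq_zero cW
    (i1.comp (ψ := fun p : ℂ × (ℂ × ℂ) × ℂ => p.2.1.2) measurable_id (by fun_prop))
  have z4 := cX.integral_mul_conj_eq_zero cV
    (i1.comp (ψ := fun p : ℂ × (ℂ × ℂ) × ℂ => p.2.2) measurable_id (by fun_prop))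
  have z5 := cX'.integral_mul_conj_eq_zero cZ
    (i2.comp (ψ := fun p : (ℂ × ℂ) × ℂ => p.1.1) measurable_id (by fun_prop))
  have z6 := cX'.integral_mul_conj_eq_zero cW
    (i2.comp (ψ := fun p : (ℂ × ℂ) × ℂ => p.1.2) measurable_id (by fun_prop))
  have z7 := cX'.integral_mul_conj_eq_zero cV
    (i2.comp (ψ := fun p : (ℂ × ℂ) × ℂ => p.2) measurable_id (by fun_prop))
  have z8 := cZ.integral_mul_conj_eq_zero cV
    (i3.comp (φ := fun p : ℂ × ℂ => p.1) (by fun_prop) measurable_id)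
  have z9 := cW.integral_mul_conj_eq_zero cV
    (i3.comp (φ := fun p : ℂ × ℂ => p.2) (by fun_prop) measurable_id)
  have d1 := integral_mul_conj_self_of_map_eq mX hP lX
  have d2 := integral_mul_conj_self_of_map_eq mX' hP' lX'
  have d3 := integral_mul_conj_self_of_map_eq mZ zero_le_one lZ
  have d4 := integral_mul_conj_self_of_map_eq mW hτ lW
  have d5 := integral_mul_conj_self_of_map_eq mV hv' lV
  refine ⟨?_, fun i j => ?_⟩
  · let L : (ℂ × ℂ × (ℂ × ℂ) × ℂ) →L[ℂ] (Fin 5 → ℂ) := LinearMap.toContinuousLinearMap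
      { toFun := fun p => ![p.1, p.2.1, p.2.2.1.1, p.2.2.1.2, p.2.2.2]
        map_add' := fun p q => by funext i; fin_cases i <;> rfl
        map_smul' := fun c p => by funext i; fin_cases i <;> rfl }
    have h := hT.map L
    convert h using 1
    funext ω i
    fin_cases i <;> rfl
  -- Entries on or above the diagonal are among the computed moments; those below follow by
  -- conjugate symmetry.
  · fin_cases i <;> fin_cases j <;>
      simp only [covMatrix, Fin.zero_eta, Fin.mk_one, Fin.reduceFinMk, Matrix.cons_val] <;>
      first
        | assumption
        | simpa using d3
        | (rw [integral_mul_conj_symm]; simp only [*, map_zero])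

section Entropy

variable {X X' Z W V : Ω → ℂ} {P P' τ v' : ℝ} {r : ℂ}

lemma IsGaussianModel.variance_sub (h : IsGaussianModel μ X X' Z W V P P' τ v' r) :
    GIC.variance μ (fun ω => Z ω - W ω) = τ + 1 - 2 * r.re := by
  have e : (fun ω => Z ω - W ω) = linComb ![X, X', Z, W, V] ![0, 0, 1, -1, 0] := by
    funext ω; simp [linComb, Fin.sum_univ_five, sub_eq_add_neg]
  refine variance_linComb h.circ h.cov ?_ e
  simp only [covForm, covMatrix, Fin.sum_univ_five]
  apply Complex.ext
  · simp
    ring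
  · simp

lemma IsGaussianModel.condVariance_sub [IsProbabilityMeasure μ]
    (h : IsGaussianModel μ X X' Z W V P P' τ v' r) {s : ℝ} (hs : s = τ + 1 - 2 * r.re)
    (hs0 : 0 < s) :
    condVariance μ W (fun ω => Z ω - W ω) = τ - ‖r - τ‖ ^ 2 / s := by
  have e : (fun ω => Z ω - W ω) = linComb ![X, X', Z, W, V] ![0, 0, 1, -1, 0] := by
    funext ω; simp [linComb, Fin.sum_univ_five, sub_eq_add_neg]
  have e' : W = linComb ![X, X', Z, W, V] ![0, 0, 0, 1, 0] := by
    funext ω; simp [linComb, Fin.sum_univ_five]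
  have hsC : (s : ℂ) ≠ 0 := Complex.ofReal_ne_zero.2 hs0.ne'
  -- The regression coefficient of W on Z - W is E[W (Z - W)*] / s, and E[W (Z - W)*] = r* - τ.
  rw [condVariance_linComb h.circ h.cov (κ := (starRingEnd ℂ) (r - τ) / s) (A := τ) (D := s)
    ?_ ?_ ?_ ?_ e' e]
  · rw [norm_div, Complex.norm_conj, Complex.norm_real, Real.norm_of_nonneg hs0.le]
    field_simp
  · simp [covForm, covMatrix, Fin.sum_univ_five]
  · rw [div_mul_cancel₀ _ hsC]
    simp [covForm, covMatrix, Fin.sum_univ_five]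
    ring
  · rw [map_div₀, Complex.conj_conj, Complex.conj_ofReal, div_mul_cancel₀ _ hsC]
    simp [covForm, covMatrix, Fin.sum_univ_five]
    ring
  · simp only [covForm, covMatrix, Fin.sum_univ_five]
    apply Complex.ext
    · simp [hs]
      ring
    · simp

/-- Since Y - U = X + Z - W, the variables Y and X + Z - W have the same conditional variance given
U; the two sides compute it from either one. -/
lemma norm_add_sq_div (Q P τ : ℝ) (r : ℂ) (hD : 0 < Q + τ) :
    P + Q + 1 - ‖(Q : ℂ) + r‖ ^ 2 / (Q + τ) =
      P + (τ + 1 - 2 * r.re) - ‖r - τ‖ ^ 2 / (Q + τ) := by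
  rw [← Complex.normSq_eq_norm_sq, ← Complex.normSq_eq_norm_sq, Complex.normSq_apply,
    Complex.normSq_apply]
  simp
  field_simp
  ring

/-- The entropies of the genie-aided bound in terms of the covariance parameters. -/
lemma IsGaussianModel.entropy_sum [IsProbabilityMeasure μ]
    (h : IsGaussianModel μ X X' Z W V P P' τ v' r) (hP : 0 ≤ P) (hP' : 0 ≤ P')
    (g g' : ℂ) {s Q S c k : ℝ} (hs : s = τ + 1 - 2 * r.re) (hs0 : 0 < s) (hQ : Q = ‖g‖ ^ 2 * P')
    (hD : 0 < Q + τ) (hS : S = P + s - ‖r - τ‖ ^ 2 / (Q + τ)) (hS0 : 0 < S)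
    (hk : k ^ 2 * v' = c) (hS' : 0 < ‖g'‖ ^ 2 * S + c) {Y U : Ω → ℂ}
    (hY : ∀ ω, Y ω = X ω + g * X' ω + Z ω) (hU : ∀ ω, U ω = g * X' ω + W ω) :
    entropy μ Y - condEntropy μ Y X + entropy μ U - entropy μ (fun ω => W ω - Z ω)
        + condEntropy μ Y U - condEntropy μ (fun ω => g' * Y ω + k * V ω) U =
      Real.logb 2 ((P + Q + 1) / (Q + 1)) + Real.logb 2 ((Q + τ) / s)
        + Real.logb 2 (S / (‖g'‖ ^ 2 * S + c)) := by
  have hQ0 : 0 ≤ Q := hQ ▸ by positivity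
  have eY : Y = linComb ![X, X', Z, W, V] ![1, g, 1, 0, 0] := by
    funext ω; simp [linComb, Fin.sum_univ_five, hY]
  have eX : X = linComb ![X, X', Z, W, V] ![1, 0, 0, 0, 0] := by
    funext ω; simp [linComb, Fin.sum_univ_five]
  have eU : U = linComb ![X, X', Z, W, V] ![0, g, 0, 1, 0] := by
    funext ω; simp [linComb, Fin.sum_univ_five, hU]
  have eN : (fun ω => W ω - Z ω) = linComb ![X, X', Z, W, V] ![0, 0, -1, 1, 0] := by
    funext ω; simp [linComb, Fin.sum_univ_five]; ring
  have eC : (fun ω => g' * Y ω + k * V ω) =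
      linComb ![X, X', Z, W, V] ![g', g' * g, g', 0, k] := by
    funext ω; simp [linComb, Fin.sum_univ_five, hY]; ring
  have hQC : (Q : ℂ) = g * (starRingEnd ℂ) g * P' := by
    rw [hQ, Complex.mul_conj']; push_cast; ring
  have hkC : (k : ℂ) ^ 2 * v' = c := by rw [← hk]; push_cast; ring
  have hDC : ((Q + τ : ℝ) : ℂ) ≠ 0 := Complex.ofReal_ne_zero.2 hD.ne'
  have cYY : covForm (covMatrix P P' τ v' r) ![1, g, 1, 0, 0] ![1, g, 1, 0, 0] =
      ((P + Q + 1 : ℝ) : ℂ) := by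
    push_cast
    rw [hQC]
    simp [covForm, covMatrix, Fin.sum_univ_five]
  have cUU : covForm (covMatrix P P' τ v' r) ![0, g, 0, 1, 0] ![0, g, 0, 1, 0] =
      ((Q + τ : ℝ) : ℂ) := by
    push_cast
    rw [hQC]
    simp [covForm, covMatrix, Fin.sum_univ_five]
  have hYX : condEntropy μ Y X = Real.logb 2 (Real.pi * Real.exp 1 * (Q + 1)) := by
    have e : Q + 1 = (P + Q + 1) - ‖(1 : ℂ)‖ ^ 2 * P := by simp; ring
    rw [e]
    refine condEntropy_linComb h.circ h.cov cYY ?_ ?_ ?_ (by rw [← e]; positivity) eY eX <;>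
      simp [covForm, covMatrix, Fin.sum_univ_five]
  have hNN : entropy μ (fun ω => W ω - Z ω) = Real.logb 2 (Real.pi * Real.exp 1 * s) := by
    refine entropy_linComb h.circ h.cov hs0 ?_ eN
    simp only [covForm, covMatrix, Fin.sum_univ_five]
    apply Complex.ext
    · simp [hs]
      ring
    · simp
  have hnorm := norm_add_sq_div Q P τ r hD
  rw [← hs, ← hS] at hnorm
  have hYU : condEntropy μ Y U = Real.logb 2 (Real.pi * Real.exp 1 * S) := by
    have e : S = (P + Q + 1) - ‖((Q : ℂ) + r) / (Q + τ : ℝ)‖ ^ 2 * (Q + τ) := by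
      rw [← hnorm, norm_div, Complex.norm_real, Real.norm_of_nonneg hD.le]
      field_simp
    rw [e]
    refine condEntropy_linComb h.circ h.cov cYY ?_ ?_ cUU (by rwa [← e]) eY eU
    · rw [div_mul_cancel₀ _ hDC, hQC]
      simp [covForm, covMatrix, Fin.sum_univ_five]
    · rw [map_div₀, Complex.conj_ofReal, div_mul_cancel₀ _ hDC, map_add, Complex.conj_ofReal, hQC]
      simp [covForm, covMatrix, Fin.sum_univ_five]
  have hCU : condEntropy μ (fun ω => g' * Y ω + k * V ω) U =
      Real.logb 2 (Real.pi * Real.exp 1 * (‖g'‖ ^ 2 * S + c)) := by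
    -- The auxiliary noise is uncorrelated with U, so the regression coefficient is g' times that of
    -- Y on U.
    have e : ‖g'‖ ^ 2 * S + c = (‖g'‖ ^ 2 * (P + Q + 1) + c) -
        ‖g' * ((Q : ℂ) + r) / (Q + τ : ℝ)‖ ^ 2 * (Q + τ) := by
      rw [← hnorm, norm_div, norm_mul, Complex.norm_real, Real.norm_of_nonneg hD.le]
      field_simp
      ring
    rw [e]
    refine condEntropy_linComb h.circ h.cov ?_ ?_ ?_ cUU (by rwa [← e]) eC eU
    · push_cast
      rw [← Complex.mul_conj', hQC, ← hkC]
      simp [covForm, covMatrix, Fin.sum_univ_five]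
      ring
    · rw [div_mul_cancel₀ _ hDC, hQC]
      simp [covForm, covMatrix, Fin.sum_univ_five]
      ring
    · rw [map_div₀, Complex.conj_ofReal, div_mul_cancel₀ _ hDC, map_mul, map_add,
        Complex.conj_ofReal, hQC]
      simp [covForm, covMatrix, Fin.sum_univ_five]
      ring
  have hYe : entropy μ Y = Real.logb 2 (Real.pi * Real.exp 1 * (P + Q + 1)) :=
    entropy_linComb h.circ h.cov (by positivity) cYY eY
  have hUe : entropy μ U = Real.logb 2 (Real.pi * Real.exp 1 * (Q + τ)) :=
    entropy_linComb h.circ h.cov hD cUU eU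
  have hpe : Real.pi * Real.exp 1 ≠ 0 := by positivity
  -- The six entropies pair off into three differences, in each of which the factor πe cancels.
  have key : ∀ x y : ℝ, 0 < x → 0 < y → Real.logb 2 (x / y) =
      Real.logb 2 (Real.pi * Real.exp 1 * x) - Real.logb 2 (Real.pi * Real.exp 1 * y) :=
    fun x y hx hy => by
      rw [Real.logb_div hx.ne' hy.ne', Real.logb_mul hpe hx.ne', Real.logb_mul hpe hy.ne']
      ring
  rw [hYe, hYX, hUe, hNN, hYU, hCU, key _ _ (by positivity) (by positivity), key _ _ hD hs0,
    key _ _ hS0 hS']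
  ring

end Entropy
end GIC

/-! ### Algebra of the regression parameters. -/

namespace GIC

/-- The regression of the genie noise on `Z - W`, in terms of `β = (r - τ)* / s`. -/
lemma genie_regression {s v τ : ℝ} {r : ℂ} (hs0 : 0 < s) (hs : s = τ + 1 - 2 * r.re)
    (hv : v = τ - ‖r - τ‖ ^ 2 / s) :
    ‖1 + (starRingEnd ℂ) (r - τ) / s‖ ^ 2 * s + v = 1 ∧
      ‖(starRingEnd ℂ) (r - τ) / s‖ ^ 2 * s + v = τ ∧
      ‖(starRingEnd ℂ) (r - τ) / s‖ ^ 2 * s ^ 2 = ‖r - τ‖ ^ 2 := by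
  have hn : ‖(starRingEnd ℂ) (r - τ) / s‖ ^ 2 = ‖r - τ‖ ^ 2 / s ^ 2 := by
    rw [norm_div, Complex.norm_conj, Complex.norm_real, Real.norm_of_nonneg hs0.le, div_pow]
  refine ⟨?_, ?_, ?_⟩
  -- The first identity is Var Z = 1 read from Z = N + W = (1 + β)N + V; the second is Var W = τ
  -- read from W = βN + V.
  · have hsC : (s : ℂ) ≠ 0 := Complex.ofReal_ne_zero.2 hs0.ne'
    have e : 1 + (starRingEnd ℂ) (r - τ) / s = (s + (starRingEnd ℂ) (r - τ)) / s := by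
      field_simp
    have e2 : ‖(s : ℂ) + (starRingEnd ℂ) (r - τ)‖ ^ 2 =
        s ^ 2 + 2 * s * (r.re - τ) + ‖r - τ‖ ^ 2 := by
      rw [← Complex.normSq_eq_norm_sq, ← Complex.normSq_eq_norm_sq, Complex.normSq_apply,
        Complex.normSq_apply]
      simp
      ring
    rw [e, norm_div, div_pow, e2, Complex.norm_real, Real.norm_of_nonneg hs0.le, hv]
    field_simp
    rw [hs]
    ring
  · rw [hn, hv]
    field_simp
    ring
  · rw [hn]
    field_simp

/-- Substituting ‖r - τ‖² = s(τ - v) turns the residual variance into P + s(Q + v)/(Q + τ), which is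
visibly positive. -/
lemma residual_pos {s v τ P Q : ℝ} {r : ℂ} (hs0 : 0 < s) (hv0 : 0 < v) (hP : 0 ≤ P) (hQ : 0 ≤ Q)
    (hv : v = τ - ‖r - τ‖ ^ 2 / s) :
    0 < Q + τ ∧ 0 < P + s - ‖r - τ‖ ^ 2 / (Q + τ) := by
  have hγ : ‖r - τ‖ ^ 2 = s * (τ - v) := by rw [hv]; field_simp; ring
  have hτ : 0 < τ := by
    have : 0 ≤ ‖r - τ‖ ^ 2 / s := by positivity
    linarith
  have hD : 0 < Q + τ := by linarith
  refine ⟨hD, ?_⟩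
  have e : P + s - ‖r - τ‖ ^ 2 / (Q + τ) = P + s * (Q + v) / (Q + τ) := by
    rw [hγ]; field_simp; ring
  rw [e]
  positivity

/-- The excess noise may vanish, so positivity comes from ‖g‖²S unless g = 0, and then from v. -/
lemma crossed_residual_pos {s v S : ℝ} {g : ℂ} (hv0 : 0 < v) (hS : 0 < S)
    (hc : ‖g‖ ^ 2 * s ≤ v) : 0 < ‖g‖ ^ 2 * S + (v - ‖g‖ ^ 2 * s) := by
  rcases eq_or_ne g 0 with rfl | hg
  · simpa using hv0
  · have : 0 < ‖g‖ ^ 2 * S := by positivity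
    linarith

/-- The scaling in the auxiliary noise is chosen to leave exactly the excess variance of T in the
converse. -/
lemma sqrt_scale_sq {s v a : ℝ} (hv0 : 0 < v) (hc : a * s ≤ v) :
    √(1 - a * v⁻¹ * s) ^ 2 * v = v - a * s := by
  have e : a * v⁻¹ * s = a * s / v := by field_simp
  rw [Real.sq_sqrt, e]
  · field_simp
  · rw [e, sub_nonneg, div_le_one hv0]
    exact hc

/-- The displayed closed form of the entropy expression of one receiver. -/
lemma closedForm_eq {s τ v' P Q σ : ℝ} {ρ g g' : ℂ} {P' : ℝ} (hτ : τ = σ ^ 2)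
    (hs : s = τ + 1 - 2 * (ρ * σ).re) (hQ : Q = ‖g‖ ^ 2 * P') (hQ0 : 0 ≤ Q) (hD : 0 < Q + τ) :
    Real.logb 2 ((P + Q + 1) / (Q + 1)) + Real.logb 2 ((Q + τ) / s)
        + Real.logb 2 ((P + s - ‖ρ * σ - τ‖ ^ 2 / (Q + τ)) /
          (‖g'‖ ^ 2 * (P + s - ‖ρ * σ - τ‖ ^ 2 / (Q + τ)) + (v' - ‖g'‖ ^ 2 * s))) =
      Real.logb 2 (1 + P / (‖g‖ ^ 2 * P' + 1))
        + Real.logb 2 ((‖g‖ ^ 2 * P' + σ ^ 2) / (σ ^ 2 + 1 - 2 * (ρ * σ).re))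
        + Real.logb 2
          ((P + ‖g‖ ^ 2 * P' + 1
              - ‖(‖g‖ : ℂ) ^ 2 * P' + ρ * σ‖ ^ 2 / (‖g‖ ^ 2 * P' + σ ^ 2))
            / (‖g'‖ ^ 2 * P + v'
              - ‖g' * ρ * σ - g' * (σ : ℂ) ^ 2‖ ^ 2 / (‖g‖ ^ 2 * P' + σ ^ 2))) := by
  have e1 : 1 + P / (Q + 1) = (P + Q + 1) / (Q + 1) := by field_simp; ring
  have e2 : (‖g‖ : ℂ) ^ 2 * P' = (Q : ℂ) := by rw [hQ]; push_cast; ring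
  have e3 : ‖g' * ρ * σ - g' * (σ : ℂ) ^ 2‖ ^ 2 = ‖g'‖ ^ 2 * ‖ρ * σ - τ‖ ^ 2 := by
    rw [← mul_pow, ← norm_mul, hτ]
    push_cast
    ring_nf
  have e4 := norm_add_sq_div Q P τ (ρ * σ) hD
  rw [e2, e3, ← hQ, ← hτ, e1, e4, ← hs]
  have e5 : ‖g'‖ ^ 2 * P + v' - ‖g'‖ ^ 2 * ‖ρ * σ - τ‖ ^ 2 / (Q + τ) =
      ‖g'‖ ^ 2 * (P + s - ‖ρ * σ - τ‖ ^ 2 / (Q + τ)) + (v' - ‖g'‖ ^ 2 * s) := by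
    ring
  rw [e5]

end GIC

/-! ### The bound and its closed form. -/

theorem mainTheorem8
    (h₁₂ h₂₁ : ℂ) (hweak₁₂ : ‖h₁₂‖ ≤ 1) (hweak₂₁ : ‖h₂₁‖ ≤ 1)
    (P₁ P₂ : ℝ) (hP₁ : 0 ≤ P₁) (hP₂ : 0 ≤ P₂)
    {Ω : Type*} [MeasurableSpace Ω] (μ : Measure Ω) [IsProbabilityMeasure μ]
    -- Gaussian inputs, channel noises, genie noises and auxiliary noises
    (X₁ X₂ Z₁ Z₂ W₁ W₂ V₁ V₂ : Ω → ℂ)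
    (mX₁ : Measurable X₁) (mX₂ : Measurable X₂) (mZ₁ : Measurable Z₁) (mZ₂ : Measurable Z₂)
    (mW₁ : Measurable W₁) (mW₂ : Measurable W₂) (mV₁ : Measurable V₁) (mV₂ : Measurable V₂)
    (lX₁ : μ.map X₁ = GIC.complexGaussian P₁) (lX₂ : μ.map X₂ = GIC.complexGaussian P₂)
    (lZ₁ : μ.map Z₁ = GIC.complexGaussian 1) (lZ₂ : μ.map Z₂ = GIC.complexGaussian 1)
    -- `W i` has variance `σ i ^ 2 ≤ 1` and correlation coefficient `ρ i` with `Z i`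
    (σ₁ σ₂ : ℝ) (ρ₁ ρ₂ : ℂ) (hσ₁ : 0 ≤ σ₁) (hσ₂ : 0 ≤ σ₂) (hσ₁' : σ₁ ^ 2 ≤ 1) (hσ₂' : σ₂ ^ 2 ≤ 1)
    (lW₁ : μ.map W₁ = GIC.complexGaussian (σ₁ ^ 2))
    (lW₂ : μ.map W₂ = GIC.complexGaussian (σ₂ ^ 2))
    (joint₁ : GIC.IsCircularGaussianPair (μ.map fun ω => (Z₁ ω, W₁ ω)))
    (joint₂ : GIC.IsCircularGaussianPair (μ.map fun ω => (Z₂ ω, W₂ ω)))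
    (corr₁ : ∫ ω, Z₁ ω * (starRingEnd ℂ) (W₁ ω) ∂μ = ρ₁ * σ₁)
    (corr₂ : ∫ ω, Z₂ ω * (starRingEnd ℂ) (W₂ ω) ∂μ = ρ₂ * σ₂)
    -- `s i` is the variance of `Z i - W i`, and `v i` that of `W i` given `Z i - W i`
    (s₁ s₂ v₁ v₂ : ℝ)
    (hs₁ : s₁ = GIC.variance μ (fun ω => Z₁ ω - W₁ ω))
    (hs₂ : s₂ = GIC.variance μ (fun ω => Z₂ ω - W₂ ω))
    (hv₁ : v₁ = GIC.condVariance μ W₁ (fun ω => Z₁ ω - W₁ ω))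
    (hv₂ : v₂ = GIC.condVariance μ W₂ (fun ω => Z₂ ω - W₂ ω))
    -- nondegeneracy: the variables `Z i - W i` and `V i` have densities
    (s₁_pos : 0 < s₁) (s₂_pos : 0 < s₂) (v₁_pos : 0 < v₁) (v₂_pos : 0 < v₂)
    (lV₁ : μ.map V₁ = GIC.complexGaussian v₁) (lV₂ : μ.map V₂ = GIC.complexGaussian v₂)
    -- mutual independence of the two inputs, the pair `(Z i, W i)` and the auxiliary noise
    (indep₁ : iIndep ![MeasurableSpace.comap X₁ inferInstance,
      MeasurableSpace.comap X₂ inferInstance,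
      MeasurableSpace.comap (fun ω => (Z₁ ω, W₁ ω)) inferInstance,
      MeasurableSpace.comap V₂ inferInstance] μ)
    (indep₂ : iIndep ![MeasurableSpace.comap X₁ inferInstance,
      MeasurableSpace.comap X₂ inferInstance,
      MeasurableSpace.comap (fun ω => (Z₂ ω, W₂ ω)) inferInstance,
      MeasurableSpace.comap V₁ inferInstance] μ)
    -- channel outputs, genie signals and scaled auxiliary noises
    (Y₁ Y₂ U₁ U₂ V₁' V₂' : Ω → ℂ)
    (hY₁ : ∀ ω, Y₁ ω = X₁ ω + h₁₂ * X₂ ω + Z₁ ω)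
    (hY₂ : ∀ ω, Y₂ ω = h₂₁ * X₁ ω + X₂ ω + Z₂ ω)
    (hU₁ : ∀ ω, U₁ ω = h₁₂ * X₂ ω + W₁ ω)
    (hU₂ : ∀ ω, U₂ ω = h₂₁ * X₁ ω + W₂ ω)
    (hV₁' : ∀ ω, V₁' ω = (√(1 - ‖h₁₂‖ ^ 2 * v₁⁻¹ * s₂) : ℝ) * V₁ ω)
    (hV₂' : ∀ ω, V₂' ω = (√(1 - ‖h₂₁‖ ^ 2 * v₂⁻¹ * s₁) : ℝ) * V₂ ω)
    -- the conditions on `(W₁, W₂)`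
    (cond₁ : ‖h₁₂‖ ^ 2 * s₂ ≤ v₁) (cond₂ : ‖h₂₁‖ ^ 2 * s₁ ≤ v₂)
    -- the entropy expression of the bound
    (B : ℝ)
    (hB : B = 1 / 2 *
      (GIC.entropy μ Y₁ - GIC.condEntropy μ Y₁ X₁
        + GIC.entropy μ U₁ - GIC.entropy μ (fun ω => W₁ ω - Z₁ ω)
        + GIC.condEntropy μ Y₁ U₁ - GIC.condEntropy μ (fun ω => h₂₁ * Y₁ ω + V₂' ω) U₁
        + GIC.entropy μ Y₂ - GIC.condEntropy μ Y₂ X₂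
        + GIC.entropy μ U₂ - GIC.entropy μ (fun ω => W₂ ω - Z₂ ω)
        + GIC.condEntropy μ Y₂ U₂ - GIC.condEntropy μ (fun ω => h₁₂ * Y₂ ω + V₁' ω) U₂)) :
    (∀ R ∈ GIC.capacityRegion h₁₂ h₂₁ P₁ P₂, R.1 + R.2 ≤ B) ∧
    B = 1 / 2 *
      (Real.logb 2 (1 + P₁ / (‖h₁₂‖ ^ 2 * P₂ + 1))
        + Real.logb 2 ((‖h₁₂‖ ^ 2 * P₂ + σ₁ ^ 2) / (σ₁ ^ 2 + 1 - 2 * (ρ₁ * σ₁).re))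
        + Real.logb 2
          ((P₁ + ‖h₁₂‖ ^ 2 * P₂ + 1
              - ‖(‖h₁₂‖ : ℂ) ^ 2 * P₂ + ρ₁ * σ₁‖ ^ 2 / (‖h₁₂‖ ^ 2 * P₂ + σ₁ ^ 2))
            / (‖h₂₁‖ ^ 2 * P₁ + v₂
              - ‖h₂₁ * ρ₁ * σ₁ - h₂₁ * (σ₁ : ℂ) ^ 2‖ ^ 2 / (‖h₁₂‖ ^ 2 * P₂ + σ₁ ^ 2)))
        + Real.logb 2 (1 + P₂ / (‖h₂₁‖ ^ 2 * P₁ + 1))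
        + Real.logb 2 ((‖h₂₁‖ ^ 2 * P₁ + σ₂ ^ 2) / (σ₂ ^ 2 + 1 - 2 * (ρ₂ * σ₂).re))
        + Real.logb 2
          ((P₂ + ‖h₂₁‖ ^ 2 * P₁ + 1
              - ‖(‖h₂₁‖ : ℂ) ^ 2 * P₁ + ρ₂ * σ₂‖ ^ 2 / (‖h₂₁‖ ^ 2 * P₁ + σ₂ ^ 2))
            / (‖h₁₂‖ ^ 2 * P₂ + v₁
              - ‖h₁₂ * ρ₂ * σ₂ - h₁₂ * (σ₂ : ℂ) ^ 2‖ ^ 2 / (‖h₂₁‖ ^ 2 * P₁ + σ₂ ^ 2)))) := by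
  have gm₁ := GIC.isGaussianModel mX₁ mX₂ mZ₁ mW₁ mV₂ hP₁ hP₂ (sq_nonneg σ₁) v₂_pos.le lX₁ lX₂
    lZ₁ lW₁ lV₂ joint₁ corr₁ indep₁
  -- Receiver 2 is receiver 1 with the users exchanged, so the first two independent variables are
  -- swapped.
  have gm₂ := GIC.isGaussianModel mX₂ mX₁ mZ₂ mW₂ mV₁ hP₂ hP₁ (sq_nonneg σ₂) v₁_pos.le lX₂ lX₁
    lZ₂ lW₂ lV₁ joint₂ corr₂ (GIC.iIndep_swap_zero_one indep₂)
  have es₁ := hs₁.trans gm₁.variance_sub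
  have es₂ := hs₂.trans gm₂.variance_sub
  have ev₁ := hv₁.trans (gm₁.condVariance_sub es₁ s₁_pos)
  have ev₂ := hv₂.trans (gm₂.condVariance_sub es₂ s₂_pos)
  have hQ₁ : 0 ≤ ‖h₁₂‖ ^ 2 * P₂ := by positivity
  have hQ₂ : 0 ≤ ‖h₂₁‖ ^ 2 * P₁ := by positivity
  obtain ⟨hD₁, hS₁⟩ := GIC.residual_pos s₁_pos v₁_pos hP₁ hQ₁ ev₁
  obtain ⟨hD₂, hS₂⟩ := GIC.residual_pos s₂_pos v₂_pos hP₂ hQ₂ ev₂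
  have hS₁' := GIC.crossed_residual_pos v₂_pos hS₁ cond₂
  have hS₂' := GIC.crossed_residual_pos v₁_pos hS₂ cond₁
  have hY₂' : ∀ ω, Y₂ ω = X₂ ω + h₂₁ * X₁ ω + Z₂ ω := fun ω => by rw [hY₂]; ring
  have E₁ := gm₁.entropy_sum hP₁ hP₂ h₁₂ h₂₁ es₁ s₁_pos rfl hD₁ rfl hS₁
    (GIC.sqrt_scale_sq v₂_pos cond₂) hS₁' hY₁ hU₁
  have E₂ := gm₂.entropy_sum hP₂ hP₁ h₂₁ h₁₂ es₂ s₂_pos rfl hD₂ rfl hS₂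
    (GIC.sqrt_scale_sq v₁_pos cond₁) hS₂' hY₂' hU₂
  simp only [← hV₂'] at E₁
  simp only [← hV₁'] at E₂
  have hsum := congrArg (fun x => 1 / 2 * x) (congrArg₂ (fun x y => x + y) E₁ E₂)
  beta_reduce at hsum
  have hB' := hB.trans (Eq.trans (by ring) hsum)
  refine ⟨fun R hR => ?_, ?_⟩
  · obtain ⟨a₁, b₁, c₁⟩ := GIC.genie_regression s₁_pos es₁ ev₁
    obtain ⟨a₂, b₂, c₂⟩ := GIC.genie_regression s₂_pos es₂ ev₂
    -- The identities `a₁`, `a₂` give unit channel noise; `b₁`, `b₂` turn σ² ≤ 1 into the ordering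
    -- of variances needed for worst additive noise; `c₁`, `c₂` match the residual variances.
    have key := GIC.sum_rate_le_of_forall_code (fun n M₁ M₂ C hM₁ hM₂ =>
      C.rate_le hM₁ hM₂ hP₁ hP₂ s₁_pos s₂_pos v₁_pos v₂_pos a₁ a₂ (b₁.trans_le hσ₁')
        (b₂.trans_le hσ₂') cond₁ cond₂ (by rw [b₁]) (by rw [b₂]) (by rw [c₁]) (by rw [c₂])) hR
    rw [hB']
    simp only [Real.logb, ← add_div]
    exact key
  · rw [hB', GIC.closedForm_eq rfl es₁ rfl hQ₁ hD₁, GIC.closedForm_eq rfl es₂ rfl hQ₂ hD₂]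
    ring
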